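/- Let $\mathcal D_z$ be a fixed sub-Gaussian probability distribution on $\mathbb R$ (its mean $\mu$ need not be zero; sub-Gaussian means that for some $c\ge 0$, $\mathbb E\,e^{t(z-\mu)}\le e^{ct^2/2}$ for all $t\in\mathbb R$ when $z\sim\mathcal D_z$), and let $\lambda>0$, $\gamma>0$ and $\alpha,\sigma_\varepsilon\in\mathbb R$ be fixed. Let $n,d\to\infty$ along a sequence with $d/n\to\gamma$, and for each pair $(n,d)$ in the sequence let $A\in\mathbb R^{n\times n}$ and $B\in\mathbb R^{d\times d}$ be arbitrary deterministic matrices. Let $Z\in\mathbb R^{n\times d}$ have i.i.d. entries with law $\mathcal D_z$, let $G\in\mathbb R^{n\times d}$ have i.i.d. Gaussian entries with the same mean and variance as $\mathcal D_z$, and let $\beta_\star\sim\mathsf N(0,\tfrac{\alpha^2}{d}I_d)$ and $\varepsilon\sim\mathsf N(0,\sigma_\varepsilon^2 I_n)$, where $Z,\beta_\star,\varepsilon$ are mutually independent and $G,\beta_\star,\varepsilon$ are mutually independent (nothing is assumed on the joint law of $Z$ and $G$). Put $X=AZB$, $y=X\beta_\star+\varepsilon$, $\tilde X=AGB$, $\tilde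 y=\tilde X\beta_\star+\varepsilon$, and consider the ridge estimators $$\hat\beta=(X^\top X+\lambda n I_d)^{-1}X^\top y,\qquad \tilde\beta=(\tilde X^\top\tilde X+\lambda n I_d)^{-1}\tilde X^\top\tilde y,$$ with estimation errors $R(\hat\beta)=\|\hat\beta-\beta_\star\|_2^2$ and $R(\tilde\beta)=\|\tilde\beta-\beta_\star\|_2^2$. Then $|R(\hat\beta)-R(\tilde\beta)|\to 0$ with probability $1-o(1)$; that is, for every $\eta>0$, $$\mathbb P\big(|R(\hat\beta)-R(\tilde\beta)|\le\eta\big)\to 1 .$$ -/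

import Mathlib

open MeasureTheory ProbabilityTheory Filter Topology
open scoped Matrix

noncomputable section

/-- A probability law `D` on the real line is sub-Gaussian: the centred variable `z - E z`, with
`z ~ D`, has a sub-Gaussian moment generating function for some variance proxy `c`. The mean
itself may be nonzero. -/
def IsSubGaussianLaw (D : Measure ℝ) : Prop :=
  ∃ c : NNReal, HasSubgaussianMGF (fun z : ℝ => z - ∫ x, x ∂D) c D

/-- The Gaussian law on the real line with the same mean and variance as `D`. -/
def matchingGaussian (D : Measure ℝ) : Measure ℝ :=
  gaussianReal (∫ x, x ∂D) (Real.toNNReal (variance (fun z : ℝ => z) D))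

/-- Law of an `n × d` array (the entries of a random matrix) that is i.i.d. with law `D`. -/
def iidMatrixLaw (D : Measure ℝ) (n d : ℕ) : Measure (Fin n → Fin d → ℝ) :=
  Measure.pi fun _ : Fin n => Measure.pi fun _ : Fin d => D

/-- The law `N(0, (α² / d) I_d)` of the coefficient vector. -/
def coefficientLaw (α : ℝ) (d : ℕ) : Measure (Fin d → ℝ) :=
  Measure.pi fun _ : Fin d => gaussianReal 0 (Real.toNNReal (α ^ 2 / d))

/-- The law `N(0, σ² I_n)` of the noise vector. -/
def noiseLaw (σ : ℝ) (n : ℕ) : Measure (Fin n → ℝ) :=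
  Measure.pi fun _ : Fin n => gaussianReal 0 (Real.toNNReal (σ ^ 2))

/-- Joint law of `(W, β, ε)` when the array `W` has i.i.d. entries with law `D`, the coefficient
vector is `β ~ N(0, (α² / d) I_d)`, the noise is `ε ~ N(0, σ² I_n)`, and `W`, `β`, `ε` are
mutually independent. -/
def modelLaw (D : Measure ℝ) (α σ : ℝ) (n d : ℕ) :
    Measure ((Fin n → Fin d → ℝ) × (Fin d → ℝ) × (Fin n → ℝ)) :=
  (iidMatrixLaw D n d).prod ((coefficientLaw α d).prod (noiseLaw σ n))

/-- The ridge estimator `(XᵀX + lam n I_d)⁻¹ Xᵀ y` from the data set `(X, y)`. -/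
def ridge {n d : ℕ} (lam : ℝ) (X : Matrix (Fin n) (Fin d) ℝ) (y : Fin n → ℝ) : Fin d → ℝ :=
  (Xᵀ * X + (lam * (n : ℝ)) • (1 : Matrix (Fin d) (Fin d) ℝ))⁻¹ *ᵥ (Xᵀ *ᵥ y)

/-- The estimation error `R(b) = ‖b - β‖₂²`, in the Euclidean norm. -/
def estimationError {d : ℕ} (b β : Fin d → ℝ) : ℝ :=
  ‖WithLp.toLp 2 (b - β)‖ ^ 2

/-- The estimation error of ridge regression with covariates `X = A W B`, where `W` is given by
its array of entries, and responses `y = X β + ε`. -/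
def ridgeError {n d : ℕ} (lam : ℝ) (A : Matrix (Fin n) (Fin n) ℝ) (B : Matrix (Fin d) (Fin d) ℝ)
    (W : Fin n → Fin d → ℝ) (β : Fin d → ℝ) (ε : Fin n → ℝ) : ℝ :=
  let X : Matrix (Fin n) (Fin d) ℝ := A * Matrix.of W * B
  estimationError (ridge lam X (X *ᵥ β + ε)) β

end

-- Given `X`, the ridge error is linear in the Gaussian pair (β, ε). With Y = X / √(λn) and Q = (1 +
-- YᵀY)⁻¹, it equals -Qβ + (λn)^(-1/2) Q Yᵀ ε. Hence R is a quadratic form with conditional variance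
-- O(1/n) and conditional mean w tr Q² + w' (tr Q - tr Q²), where w = α²/d and w' = σ²/(λn)
-- (`estimationError_ridge`, `integral_ridgeError_sub_sq_le`). Rescaling Y slightly and taking a
-- finite difference expresses tr Q² through tr Q, so the conditional mean is close to a
-- combination, with coefficients O(1/n), of two resolvent traces (`abs_conditionalRisk_sub_le`).
-- Changing one row of the random array moves such a trace by at most 1, so the combination
-- concentrates (`integral_trace_combination_sub_sq_le`). What remains is deterministic: E tr (1 +
-- XᵀX)⁻¹ differs by o(n) between the two entry laws, uniformly in A and B
-- (`exists_trace_comparison`).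
--
-- Nonzero means cost a rank-one perturbation, that is at most 1 per law. For standardized entries
-- and A, B of norm at most L, Lindeberg replacement applies (`abs_integral_sub_le_of_bounded`).
-- Changing one entry moves X in a rank-one direction, so the third-order remainder of the trace is
-- O(n^(-3/2)) without a dimension factor, and the nd replacements cost O_L(√n).
--
-- Unbounded A and B are the main difficulty. The trace depends only on AᵀA and BBᵀ, so A and B may
-- be taken as orthogonal matrices with nonnegative diagonal weights u and v. A scale moved from u
-- to v makes the numbers of weights above 1 comparable (`exists_balancing_scale`). Truncating the
-- weights at L then changes the trace by at most the resolvent mass on the rows with weight above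
-- 1, in a model where those rows have weight L, the others weight 1, and the columns are restricted
-- to an equally large set (`trace_gramRes_truncate`). Approximate integration by parts bounds the
-- mean of this mass by O(n/L) + O_L(√n) (`integral_sum_gramRes_le`). Taking L large first and n
-- large afterwards gives o(n).

set_option linter.unusedSectionVars false
set_option linter.unusedDecidableInType false

-- Gram resolvents: variational formula, trace duality and rank-one perturbations.

section GramResolvent

variable {m p q : Type*} [Fintype m] [Fintype p] [Fintype q] [DecidableEq m] [DecidableEq p]
  [DecidableEq q]

/-- The resolvent `(1 + XᵀX)⁻¹` of the Gram matrix of `X`. -/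
noncomputable def gramRes (X : Matrix m p ℝ) : Matrix p p ℝ := (1 + Xᵀ * X)⁻¹

theorem dotProduct_self_nonneg' (x : p → ℝ) : 0 ≤ x ⬝ᵥ x :=
  Finset.sum_nonneg fun i _ => mul_self_nonneg (x i)

theorem dotProduct_gram_mulVec (X : Matrix m p ℝ) (x y : p → ℝ) :
    x ⬝ᵥ ((1 + Xᵀ * X) *ᵥ y) = x ⬝ᵥ y + (X *ᵥ x) ⬝ᵥ (X *ᵥ y) := by
  rw [Matrix.add_mulVec, Matrix.one_mulVec, dotProduct_add, ← Matrix.mulVec_mulVec,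
    Matrix.dotProduct_mulVec x Xᵀ, Matrix.vecMul_transpose]

theorem isUnit_det_of_coercive {G : Matrix p p ℝ} (hG : ∀ x, x ⬝ᵥ x ≤ x ⬝ᵥ (G *ᵥ x)) :
    IsUnit G.det := by
  rw [isUnit_iff_ne_zero]
  intro h
  obtain ⟨v, hv, hv0⟩ := Matrix.exists_mulVec_eq_zero_iff.mpr h
  have := hG v
  rw [hv0, dotProduct_zero] at this
  exact hv (dotProduct_self_eq_zero.mp (le_antisymm this (dotProduct_self_nonneg' v)))

theorem gram_coercive (X : Matrix m p ℝ) (x : p → ℝ) :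
    x ⬝ᵥ x ≤ x ⬝ᵥ ((1 + Xᵀ * X) *ᵥ x) := by
  rw [dotProduct_gram_mulVec]
  linarith [dotProduct_self_nonneg' (X *ᵥ x)]

theorem isUnit_det_gram (X : Matrix m p ℝ) : IsUnit (1 + Xᵀ * X).det :=
  isUnit_det_of_coercive (gram_coercive X)

theorem gramRes_mul (X : Matrix m p ℝ) : gramRes X * (1 + Xᵀ * X) = 1 :=
  Matrix.nonsing_inv_mul _ (isUnit_det_gram X)

theorem mul_gramRes (X : Matrix m p ℝ) : (1 + Xᵀ * X) * gramRes X = 1 :=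
  Matrix.mul_nonsing_inv _ (isUnit_det_gram X)

theorem gramRes_transpose (X : Matrix m p ℝ) : (gramRes X)ᵀ = gramRes X := by
  unfold gramRes
  rw [Matrix.transpose_nonsing_inv]
  simp [Matrix.transpose_mul]

theorem gramRes_mulVec_dotProduct (X : Matrix m p ℝ) (x y : p → ℝ) :
    x ⬝ᵥ (gramRes X *ᵥ y) = (gramRes X *ᵥ x) ⬝ᵥ (gramRes X *ᵥ y)
      + (X *ᵥ (gramRes X *ᵥ x)) ⬝ᵥ (X *ᵥ (gramRes X *ᵥ y)) := by
  rw [← dotProduct_gram_mulVec, Matrix.mulVec_mulVec, mul_gramRes, Matrix.one_mulVec,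
    Matrix.dotProduct_mulVec, ← Matrix.mulVec_transpose, gramRes_transpose]

/-- The variational lower bound for the diagonal of the resolvent. -/
theorem le_gramRes_diag (X : Matrix m p ℝ) (j : p) (x : p → ℝ) :
    2 * x j - x ⬝ᵥ x - (X *ᵥ x) ⬝ᵥ (X *ᵥ x) ≤ gramRes X j j := by
  set y := gramRes X *ᵥ Pi.single j 1 with hy
  have h1 : (1 + Xᵀ * X) *ᵥ y = Pi.single j 1 := by
    rw [hy, Matrix.mulVec_mulVec, mul_gramRes, Matrix.one_mulVec]
  have h2 : y j = gramRes X j j := by simp [hy]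
  have h3 := gram_coercive X (x - y)
  have h4 := dotProduct_self_nonneg' (x - y)
  have h5 : (x - y) ⬝ᵥ ((1 + Xᵀ * X) *ᵥ (x - y))
      = x ⬝ᵥ ((1 + Xᵀ * X) *ᵥ x) - 2 * x j + y j := by
    have h6 : y ⬝ᵥ ((1 + Xᵀ * X) *ᵥ x) = x j := by
      rw [dotProduct_gram_mulVec, dotProduct_comm y, dotProduct_comm (X *ᵥ y),
        ← dotProduct_gram_mulVec, h1]; simp
    rw [Matrix.mulVec_sub, sub_dotProduct, dotProduct_sub, dotProduct_sub, h6, h1]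
    simp; ring
  rw [dotProduct_gram_mulVec X x x] at h5
  linarith

/-- The lower bound `le_gramRes_diag` is attained at the `j`-th column of the resolvent. The
diagonal entry is thus a maximum over test vectors, hence monotone in the quadratic form. -/
theorem gramRes_diag_eq (X : Matrix m p ℝ) (j : p) :
    gramRes X j j = 2 * (gramRes X *ᵥ Pi.single j 1) j
      - (gramRes X *ᵥ Pi.single j 1) ⬝ᵥ (gramRes X *ᵥ Pi.single j 1)
      - (X *ᵥ (gramRes X *ᵥ Pi.single j 1)) ⬝ᵥ (X *ᵥ (gramRes X *ᵥ Pi.single j 1)) := by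
  have h := gramRes_mulVec_dotProduct X (Pi.single j 1) (Pi.single j 1)
  have h2 : (gramRes X *ᵥ Pi.single j 1) j = gramRes X j j := by simp
  rw [single_one_dotProduct, h2] at h
  rw [h2]
  linarith

/-- Comparison of diagonal entries of two resolvents through their quadratic forms. -/
theorem gramRes_diag_le {X : Matrix m p ℝ} {Y : Matrix q p ℝ} {j : p}
    (h : ∀ x : p → ℝ, ∃ y : p → ℝ, y j = x j ∧
      y ⬝ᵥ y + (Y *ᵥ y) ⬝ᵥ (Y *ᵥ y) ≤ x ⬝ᵥ x + (X *ᵥ x) ⬝ᵥ (X *ᵥ x)) :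
    gramRes X j j ≤ gramRes Y j j := by
  obtain ⟨y, hy, hle⟩ := h (gramRes X *ᵥ Pi.single j 1)
  rw [gramRes_diag_eq]
  have := le_gramRes_diag Y j y
  rw [hy] at this
  linarith

theorem gramRes_diag_nonneg (X : Matrix m p ℝ) (j : p) : 0 ≤ gramRes X j j := by
  simpa using le_gramRes_diag X j 0

theorem gramRes_diag_le_one (X : Matrix m p ℝ) (j : p) : gramRes X j j ≤ 1 := by
  rw [gramRes_diag_eq]
  set y := gramRes X *ᵥ Pi.single j 1
  have h1 := dotProduct_self_nonneg' (X *ᵥ y)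
  have h2 : y j * y j ≤ y ⬝ᵥ y :=
    Finset.single_le_sum (f := fun i => y i * y i) (fun i _ => mul_self_nonneg _)
      (Finset.mem_univ j)
  nlinarith [sq_nonneg (y j - 1)]

theorem gramRes_push (X : Matrix m p ℝ) : X * gramRes X = gramRes Xᵀ * X := by
  have h1 := mul_gramRes X
  have h2 := gramRes_mul Xᵀ
  rw [Matrix.transpose_transpose] at h2
  calc X * gramRes X = gramRes Xᵀ * (1 + X * Xᵀ) * (X * gramRes X) := by rw [h2, Matrix.one_mul]
    _ = gramRes Xᵀ * (X * ((1 + Xᵀ * X) * gramRes X)) := by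
        simp only [Matrix.mul_add, Matrix.add_mul, Matrix.mul_one, Matrix.one_mul,
          Matrix.mul_assoc]
    _ = gramRes Xᵀ * X := by rw [h1, Matrix.mul_one]

theorem one_sub_gramRes (X : Matrix m p ℝ) : Xᵀ * gramRes Xᵀ * X = 1 - gramRes X := by
  rw [Matrix.mul_assoc, ← gramRes_push, ← Matrix.mul_assoc, eq_sub_iff_add_eq, add_comm]
  simpa [Matrix.add_mul] using mul_gramRes X

theorem one_sub_gramRes' (X : Matrix m p ℝ) : X * (Xᵀ * gramRes Xᵀ) = 1 - gramRes Xᵀ := by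
  have := mul_gramRes Xᵀ
  rw [Matrix.transpose_transpose, Matrix.add_mul, Matrix.one_mul] at this
  rw [eq_sub_iff_add_eq, add_comm, ← Matrix.mul_assoc, this]

/-- `Xᵀ * X` and `X * Xᵀ` share their nonzero spectrum. This identity lets row and column resolvents
be exchanged throughout. -/
theorem trace_gramRes_transpose (X : Matrix m p ℝ) :
    (gramRes Xᵀ).trace - Fintype.card m = (gramRes X).trace - Fintype.card p := by
  have h1 := congrArg Matrix.trace (one_sub_gramRes X)
  have h2 := congrArg Matrix.trace (one_sub_gramRes' X)
  rw [Matrix.trace_sub, Matrix.trace_one] at h1 h2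
  rw [← Matrix.trace_mul_comm X, h2] at h1
  linarith

theorem trace_gramRes_nonneg (X : Matrix m p ℝ) : 0 ≤ (gramRes X).trace :=
  Finset.sum_nonneg fun j _ => gramRes_diag_nonneg X j

theorem trace_gramRes_le (X : Matrix m p ℝ) : (gramRes X).trace ≤ Fintype.card p := by
  calc (gramRes X).trace ≤ ∑ _j : p, (1 : ℝ) :=
        Finset.sum_le_sum fun j _ => gramRes_diag_le_one X j
    _ = _ := by simp

/-- A rank one positive update lowers the trace of the inverse by at most one. -/
theorem trace_inv_rank_one_update {G : Matrix p p ℝ} (hs : Gᵀ = G)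
    (hG : ∀ x, x ⬝ᵥ x ≤ x ⬝ᵥ (G *ᵥ x)) (w : p → ℝ) :
    0 ≤ (G⁻¹).trace - ((G + Matrix.vecMulVec w w)⁻¹).trace ∧
      (G⁻¹).trace - ((G + Matrix.vecMulVec w w)⁻¹).trace ≤ 1 := by
  set G' := G + Matrix.vecMulVec w w with hG'
  have hcoer : ∀ x, x ⬝ᵥ x ≤ x ⬝ᵥ (G' *ᵥ x) := by
    intro x
    rw [hG', Matrix.add_mulVec, dotProduct_add, Matrix.vecMulVec_mulVec]
    have : x ⬝ᵥ (MulOpposite.op (w ⬝ᵥ x) • w) = (w ⬝ᵥ x) * (w ⬝ᵥ x) := by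
      rw [dotProduct_comm x]
      simp only [dotProduct, Pi.smul_apply, op_smul_eq_mul]
      rw [Finset.sum_mul]
      exact Finset.sum_congr rfl fun i _ => by ring
    rw [this]
    nlinarith [hG x, mul_self_nonneg (w ⬝ᵥ x)]
  have hu := isUnit_det_of_coercive hG
  have hu' := isUnit_det_of_coercive hcoer
  have h1 := Matrix.nonsing_inv_mul G hu
  have h1' := Matrix.mul_nonsing_inv G' hu'
  have h0 := Matrix.mul_nonsing_inv G hu
  -- Sherman–Morrison in resolvent form. With `u = G⁻¹ *ᵥ w` the drop of the trace becomes |u|² / (1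
  -- + w · u), and coercivity of `G` gives |u|² ≤ w · u.
  have hdiff : G⁻¹ - G'⁻¹ = Matrix.vecMulVec (G⁻¹ *ᵥ w) (w ᵥ* G'⁻¹) := by
    have : Matrix.vecMulVec w w = G' - G := by rw [hG']; abel
    rw [← Matrix.mul_vecMulVec, ← Matrix.vecMulVec_mul, this, Matrix.sub_mul, Matrix.mul_sub,
      h1', Matrix.mul_one, ← Matrix.mul_assoc, h1, Matrix.one_mul]
  have hs' : G'ᵀ = G' := by rw [hG', Matrix.transpose_add, hs, Matrix.transpose_vecMulVec]
  have hi : (G⁻¹)ᵀ = G⁻¹ := by rw [Matrix.transpose_nonsing_inv, hs]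
  have hi' : (G'⁻¹)ᵀ = G'⁻¹ := by rw [Matrix.transpose_nonsing_inv, hs']
  have htr : (G⁻¹).trace - (G'⁻¹).trace = (G'⁻¹ *ᵥ w) ⬝ᵥ (G⁻¹ *ᵥ w) := by
    rw [← Matrix.trace_sub, hdiff, Matrix.trace_vecMulVec, dotProduct_comm,
      ← Matrix.mulVec_transpose, hi']
  set u := G⁻¹ *ᵥ w with hu_def
  set v := G'⁻¹ *ᵥ w with hv_def
  have hGu : G *ᵥ u = w := by rw [hu_def, Matrix.mulVec_mulVec, h0, Matrix.one_mulVec]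
  have hv : u - v = (w ⬝ᵥ v) • u := by
    have := congrArg (fun M => M *ᵥ w) hdiff
    simp only [Matrix.sub_mulVec, Matrix.vecMulVec_mulVec] at this
    rw [← hu_def, ← hv_def] at this
    rw [this, ← Matrix.dotProduct_mulVec, ← hv_def]
    ext i; simp [mul_comm]
  have hr : u ⬝ᵥ u ≤ w ⬝ᵥ u := by
    have := hG u; rw [hGu] at this; rwa [dotProduct_comm w]
  have huu := dotProduct_self_nonneg' u
  have hwv : w ⬝ᵥ u - w ⬝ᵥ v = (w ⬝ᵥ v) * (w ⬝ᵥ u) := by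
    rw [← dotProduct_sub, hv, dotProduct_smul, smul_eq_mul]
  have hvu : v ⬝ᵥ u = (1 - w ⬝ᵥ v) * (u ⬝ᵥ u) := by
    have : v = (1 - w ⬝ᵥ v) • u := by rw [sub_smul, one_smul, ← hv]; abel
    conv_lhs => rw [this]
    rw [smul_dotProduct, smul_eq_mul]
  have hpos : 0 < 1 + w ⬝ᵥ u := by linarith
  have hone : (1 - w ⬝ᵥ v) * (1 + w ⬝ᵥ u) = 1 := by linarith
  have hx : 1 - w ⬝ᵥ v = 1 / (1 + w ⬝ᵥ u) := by field_simp; linarith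
  rw [htr, hvu, hx]
  refine ⟨by positivity, ?_⟩
  rw [div_mul_eq_mul_div, div_le_one hpos]
  linarith

/-- Completing the square, the new Gram matrix plus `c cᵀ` equals the old one plus `w wᵀ`, with c =
Xᵀa / |a| and w = |a| b + c. Two rank-one updates of opposite effect each move the trace by an
amount in [0, 1], so the net change is at most 1. -/
theorem abs_trace_gramRes_add_vecMulVec (X : Matrix m p ℝ) (a : m → ℝ) (b : p → ℝ) :
    |(gramRes (X + Matrix.vecMulVec a b)).trace - (gramRes X).trace| ≤ 1 := by
  by_cases ha : a ⬝ᵥ a = 0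
  · rw [dotProduct_self_eq_zero] at ha
    simp [ha]
  set s := Real.sqrt (a ⬝ᵥ a) with hs
  have hpos : 0 < a ⬝ᵥ a := lt_of_le_of_ne (dotProduct_self_nonneg' a) (Ne.symm ha)
  have hs0 : 0 < s := Real.sqrt_pos.mpr hpos
  have hss : s * s = a ⬝ᵥ a := Real.mul_self_sqrt hpos.le
  set c := s⁻¹ • (Xᵀ *ᵥ a) with hc
  set w := s • b + c with hw
  have key : (X + Matrix.vecMulVec a b)ᵀ * (X + Matrix.vecMulVec a b) + Matrix.vecMulVec c c
      = Xᵀ * X + Matrix.vecMulVec w w := by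
    ext i j
    have e : ∀ i, (Xᵀ *ᵥ a) i = s * c i := by intro i; simp [hc, hs0.ne']
    have e1 : (Xᵀ * Matrix.vecMulVec a b) i j = s * c i * b j := by
      rw [Matrix.mul_vecMulVec, Matrix.vecMulVec_apply, e]
    have e2 : (Matrix.vecMulVec b a * X) i j = b i * (s * c j) := by
      rw [Matrix.vecMulVec_mul, Matrix.vecMulVec_apply, ← Matrix.mulVec_transpose, e]
    have e3 : (Matrix.vecMulVec b a * Matrix.vecMulVec a b) i j = (s * s) * b i * b j := by
      rw [Matrix.vecMulVec_mul, Matrix.vecMulVec_apply, Matrix.vecMul_vecMulVec, hss]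
      simp; ring
    rw [Matrix.transpose_add, Matrix.transpose_vecMulVec, Matrix.add_mul, Matrix.mul_add,
      Matrix.mul_add]
    simp only [Matrix.add_apply, e1, e2, e3, Matrix.vecMulVec_apply, hw, Pi.add_apply,
      Pi.smul_apply, smul_eq_mul]
    ring
  have hsym : ∀ Y : Matrix m p ℝ, (1 + Yᵀ * Y)ᵀ = 1 + Yᵀ * Y := by
    intro Y; simp [Matrix.transpose_mul]
  have h1 := trace_inv_rank_one_update (hsym X) (gram_coercive X) w
  have h2 := trace_inv_rank_one_update (hsym (X + Matrix.vecMulVec a b))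
    (gram_coercive (X + Matrix.vecMulVec a b)) c
  rw [add_assoc, key, ← add_assoc] at h2
  unfold gramRes
  rw [abs_le]
  constructor <;> linarith [h1.1, h1.2, h2.1, h2.2]

end GramResolvent

-- Linearization by a skew-symmetric block matrix, and resolvent expansions.

section LinearizedResolvent

open scoped Matrix.Norms.L2Operator

variable {m p q l : Type*} [Fintype m] [Fintype p] [Fintype q] [Fintype l] [DecidableEq m]
  [DecidableEq p] [DecidableEq q] [DecidableEq l]

theorem norm_toLp_sq (x : p → ℝ) : ‖WithLp.toLp 2 x‖ ^ 2 = x ⬝ᵥ x := by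
  rw [EuclideanSpace.norm_sq_eq]
  simp [dotProduct, sq]

theorem norm_toLp_mulVec_le (M : Matrix m p ℝ) (x : p → ℝ) :
    ‖WithLp.toLp 2 (M *ᵥ x)‖ ≤ ‖M‖ * ‖WithLp.toLp 2 x‖ := by
  simpa using Matrix.l2_opNorm_mulVec M (WithLp.toLp 2 x)

theorem l2_opNorm_le_of_dotProduct_le {M : Matrix m p ℝ} {c : ℝ} (hc : 0 ≤ c)
    (h : ∀ x, (M *ᵥ x) ⬝ᵥ (M *ᵥ x) ≤ c ^ 2 * (x ⬝ᵥ x)) : ‖M‖ ≤ c := by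
  rw [Matrix.l2_opNorm_def]
  refine ContinuousLinearMap.opNorm_le_bound _ hc fun x => ?_
  have h1 := h (WithLp.ofLp x)
  rw [← norm_toLp_sq, ← norm_toLp_sq, ← mul_pow] at h1
  exact (abs_le_of_sq_le_sq' h1 (by positivity)).2

theorem dotProduct_mulVec_self_le (M : Matrix m p ℝ) (x : p → ℝ) :
    (M *ᵥ x) ⬝ᵥ (M *ᵥ x) ≤ ‖M‖ ^ 2 * (x ⬝ᵥ x) := by
  rw [← norm_toLp_sq, ← norm_toLp_sq, ← mul_pow]
  exact pow_le_pow_left₀ (norm_nonneg _) (norm_toLp_mulVec_le M x) 2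

theorem sum_sq_col_le (M : Matrix m p ℝ) (j : p) : ∑ i, M i j ^ 2 ≤ ‖M‖ ^ 2 := by
  have h := dotProduct_mulVec_self_le M (Pi.single j 1)
  simpa [dotProduct, sq, Pi.single_apply] using h

theorem abs_apply_le_norm (M : Matrix m p ℝ) (i : m) (j : p) : |M i j| ≤ ‖M‖ := by
  refine abs_le_of_sq_le_sq ?_ (norm_nonneg _)
  exact (Finset.single_le_sum (f := fun i => M i j ^ 2) (fun i _ => sq_nonneg _)
    (Finset.mem_univ i)).trans (sum_sq_col_le M j)

theorem l2_opNorm_transpose (M : Matrix m p ℝ) : ‖Mᵀ‖ = ‖M‖ := by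
  rw [← Matrix.conjTranspose_eq_transpose_of_trivial, Matrix.l2_opNorm_conjTranspose]

theorem l2_opNorm_le_one_of_transpose_mul_self {M : Matrix m p ℝ} (h : Mᵀ * M = 1) :
    ‖M‖ ≤ 1 := by
  refine l2_opNorm_le_of_dotProduct_le zero_le_one fun x => ?_
  rw [Matrix.dotProduct_mulVec, ← Matrix.mulVec_transpose, Matrix.mulVec_mulVec, h,
    Matrix.one_mulVec]
  simp

/-- The skew-symmetric linearization of `X`. -/
noncomputable def skewBlock (X : Matrix m p ℝ) : Matrix (m ⊕ p) (m ⊕ p) ℝ :=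
  Matrix.fromBlocks 0 X (-Xᵀ) 0

/-- The resolvent `(1 + skewBlock X)⁻¹`, whose diagonal blocks are Gram resolvents. -/
noncomputable def linRes (X : Matrix m p ℝ) : Matrix (m ⊕ p) (m ⊕ p) ℝ :=
  Matrix.fromBlocks (gramRes Xᵀ) (-(gramRes Xᵀ * X)) (Xᵀ * gramRes Xᵀ) (gramRes X)

theorem one_add_skewBlock_mul_linRes (X : Matrix m p ℝ) : (1 + skewBlock X) * linRes X = 1 := by
  have h1 := mul_gramRes Xᵀ
  rw [Matrix.transpose_transpose, Matrix.add_mul, Matrix.one_mul, Matrix.mul_assoc] at h1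
  rw [skewBlock, linRes, ← Matrix.fromBlocks_one, Matrix.fromBlocks_add,
    Matrix.fromBlocks_multiply]
  simp only [add_zero, zero_add, Matrix.one_mul]
  congr 1
  · rw [gramRes_push]; abel
  · rw [Matrix.neg_mul]; abel
  · rw [Matrix.neg_mul, Matrix.mul_neg, neg_neg, ← Matrix.mul_assoc, one_sub_gramRes]; abel

theorem linRes_mul_one_add_skewBlock (X : Matrix m p ℝ) : linRes X * (1 + skewBlock X) = 1 :=
  mul_eq_one_comm.mp (one_add_skewBlock_mul_linRes X)

theorem skewBlock_transpose (X : Matrix m p ℝ) : (skewBlock X)ᵀ = -skewBlock X := by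
  simp [skewBlock, Matrix.fromBlocks_transpose, Matrix.fromBlocks_neg]

theorem dotProduct_skewBlock (X : Matrix m p ℝ) (v : m ⊕ p → ℝ) :
    v ⬝ᵥ (skewBlock X *ᵥ v) = 0 := by
  have h : v ⬝ᵥ (skewBlock X *ᵥ v) = -(v ⬝ᵥ (skewBlock X *ᵥ v)) := by
    conv_lhs => rw [Matrix.dotProduct_mulVec, ← Matrix.mulVec_transpose, skewBlock_transpose,
      Matrix.neg_mulVec, neg_dotProduct, dotProduct_comm]
  linarith

/-- For skew K one has |(1 + K) w|² = |w|² + |K w|². Since K is linear in `X`, perturbation series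
involve only copies of this contraction and of the direction, which is why the linearization is
preferred to `gramRes`. -/
theorem norm_linRes_le (X : Matrix m p ℝ) : ‖linRes X‖ ≤ 1 := by
  refine l2_opNorm_le_of_dotProduct_le zero_le_one fun v => ?_
  set w := linRes X *ᵥ v with hw
  have hv : v = w + skewBlock X *ᵥ w := by
    have : (1 + skewBlock X) *ᵥ w = v := by
      rw [hw, Matrix.mulVec_mulVec, one_add_skewBlock_mul_linRes, Matrix.one_mulVec]
    rw [← this, Matrix.add_mulVec, Matrix.one_mulVec]
  have hk := dotProduct_skewBlock X w
  have : v ⬝ᵥ v = w ⬝ᵥ w + (skewBlock X *ᵥ w) ⬝ᵥ (skewBlock X *ᵥ w) := by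
    rw [hv]
    simp only [add_dotProduct, dotProduct_add]
    rw [dotProduct_comm (skewBlock X *ᵥ w) w, hk]; ring
  rw [this]
  linarith [dotProduct_self_nonneg' (skewBlock X *ᵥ w)]

/-- Transfers trace expansions of `linRes` to `gramRes`, up to a factor 2 and a constant. -/
theorem trace_linRes (X : Matrix m p ℝ) :
    (linRes X).trace = 2 * (gramRes X).trace + Fintype.card m - Fintype.card p := by
  have := trace_gramRes_transpose X
  have h : (linRes X).trace = (gramRes Xᵀ).trace + (gramRes X).trace := by
    simp [linRes, Matrix.trace, Fintype.sum_sum_type]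
  linarith

theorem skewBlock_add_smul (X E : Matrix m p ℝ) (z : ℝ) :
    skewBlock (X + z • E) = skewBlock X + z • skewBlock E := by
  ext (i | i) (j | j) <;> simp [skewBlock]; ring

/-- First resolvent identity. -/
theorem linRes_add_smul (X E : Matrix m p ℝ) (z : ℝ) :
    linRes (X + z • E) = linRes X - z • (linRes X * skewBlock E * linRes (X + z • E)) := by
  have h1 := linRes_mul_one_add_skewBlock X
  have h2 := one_add_skewBlock_mul_linRes (X + z • E)
  rw [skewBlock_add_smul] at h2
  have : linRes X - linRes (X + z • E)
      = linRes X * (z • skewBlock E) * linRes (X + z • E) := by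
    calc linRes X - linRes (X + z • E)
        = linRes X * ((1 + (skewBlock X + z • skewBlock E)) * linRes (X + z • E))
          - (linRes X * (1 + skewBlock X)) * linRes (X + z • E) := by
          rw [h1, h2, Matrix.mul_one, Matrix.one_mul]
      _ = _ := by noncomm_ring
  rw [eq_sub_iff_add_eq', ← Matrix.smul_mul, ← Matrix.mul_smul, ← this]
  abel

theorem linRes_expand_two (X E : Matrix m p ℝ) (z : ℝ) :
    linRes (X + z • E) = linRes X - z • (linRes X * skewBlock E * linRes X)
      + z ^ 2 • (linRes X * skewBlock E * linRes X * skewBlock E * linRes (X + z • E)) := by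
  conv_lhs => rw [linRes_add_smul]
  conv_lhs => rw [linRes_add_smul]
  simp only [Matrix.mul_sub, smul_sub, Matrix.mul_smul, smul_smul, Matrix.mul_assoc]
  rw [sq]; abel

theorem linRes_expand_three (X E : Matrix m p ℝ) (z : ℝ) :
    linRes (X + z • E) = linRes X - z • (linRes X * skewBlock E * linRes X)
      + z ^ 2 • (linRes X * skewBlock E * linRes X * skewBlock E * linRes X)
      - z ^ 3 • (linRes X * skewBlock E * linRes X * skewBlock E * linRes X * skewBlock E
        * linRes (X + z • E)) := by
  conv_lhs => rw [linRes_expand_two]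
  conv_lhs => enter [2]; rw [linRes_add_smul]
  simp only [Matrix.mul_sub, smul_sub, Matrix.mul_smul, smul_smul, Matrix.mul_assoc]
  rw [show z ^ 2 * z = z ^ 3 by ring]; abel

/-- The first coordinate embedding. -/
noncomputable def inlMat (m p : Type*) [DecidableEq m] : Matrix (m ⊕ p) m ℝ :=
  Matrix.fromRows 1 0

/-- The second coordinate embedding. -/
noncomputable def inrMat (m p : Type*) [DecidableEq p] : Matrix (m ⊕ p) p ℝ :=
  Matrix.fromRows 0 1

theorem norm_inlMat_le : ‖inlMat m p‖ ≤ 1 :=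
  l2_opNorm_le_one_of_transpose_mul_self (by
    rw [inlMat, Matrix.transpose_fromRows, Matrix.fromCols_mul_fromRows]; simp)

theorem norm_inrMat_le : ‖inrMat m p‖ ≤ 1 :=
  l2_opNorm_le_one_of_transpose_mul_self (by
    rw [inrMat, Matrix.transpose_fromRows, Matrix.fromCols_mul_fromRows]; simp)

theorem skewBlock_eq (E : Matrix m p ℝ) :
    skewBlock E = inlMat m p * E * (inrMat m p)ᵀ - inrMat m p * Eᵀ * (inlMat m p)ᵀ := by
  ext (i | i) (j | j) <;>
    simp [skewBlock, inlMat, inrMat, Matrix.transpose_fromRows, Matrix.fromRows_mul,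
      Matrix.mul_fromCols]

theorem inrMat_linRes_inlMat (X : Matrix m p ℝ) :
    (inrMat m p)ᵀ * linRes X * inlMat m p = Xᵀ * gramRes Xᵀ := by
  rw [inrMat, inlMat, linRes, Matrix.transpose_fromRows, Matrix.fromCols_mul_fromBlocks,
    Matrix.fromCols_mul_fromRows]
  simp

theorem inlMat_linRes_inlMat (X : Matrix m p ℝ) :
    (inlMat m p)ᵀ * linRes X * inlMat m p = gramRes Xᵀ := by
  rw [inlMat, linRes, Matrix.transpose_fromRows, Matrix.fromCols_mul_fromBlocks,
    Matrix.fromCols_mul_fromRows]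
  simp

theorem inrMat_linRes_inrMat (X : Matrix m p ℝ) :
    (inrMat m p)ᵀ * linRes X * inrMat m p = gramRes X := by
  rw [inrMat, linRes, Matrix.transpose_fromRows, Matrix.fromCols_mul_fromBlocks,
    Matrix.fromCols_mul_fromRows]
  simp

theorem l2_opNorm_mul_le {M : Matrix m p ℝ} {N : Matrix p q ℝ} {a b : ℝ} (hM : ‖M‖ ≤ a)
    (hN : ‖N‖ ≤ b) : ‖M * N‖ ≤ a * b :=
  (Matrix.l2_opNorm_mul M N).trans
    (mul_le_mul hM hN (norm_nonneg _) ((norm_nonneg _).trans hM))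

theorem norm_gramRes_le (X : Matrix m p ℝ) : ‖gramRes X‖ ≤ 1 := by
  rw [← inrMat_linRes_inrMat]
  have h1 : ‖(inrMat m p)ᵀ‖ ≤ 1 := by rw [l2_opNorm_transpose]; exact norm_inrMat_le
  simpa using l2_opNorm_mul_le (l2_opNorm_mul_le h1 (norm_linRes_le X))
    (norm_inrMat_le (m := m) (p := p))

theorem norm_skewBlock_le (E : Matrix m p ℝ) : ‖skewBlock E‖ ≤ 2 * ‖E‖ := by
  rw [skewBlock_eq]
  have h1 : ‖(inrMat m p)ᵀ‖ ≤ 1 := by rw [l2_opNorm_transpose]; exact norm_inrMat_le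
  have h2 : ‖(inlMat m p)ᵀ‖ ≤ 1 := by rw [l2_opNorm_transpose]; exact norm_inlMat_le
  have a := l2_opNorm_mul_le (l2_opNorm_mul_le (norm_inlMat_le (m := m) (p := p)) le_rfl
    (N := E)) h1
  have b := l2_opNorm_mul_le (l2_opNorm_mul_le (norm_inrMat_le (m := m) (p := p)) le_rfl
    (N := Eᵀ)) h2
  rw [l2_opNorm_transpose] at b
  refine (norm_sub_le _ _).trans ?_
  linarith

end LinearizedResolvent

-- Expansions of the resolvent along a single matrix entry.

section EntryPerturbation

open scoped Matrix.Norms.L2Operator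

variable {m p q l : Type*} [Fintype m] [Fintype p] [Fintype q] [Fintype l] [DecidableEq m]
  [DecidableEq p] [DecidableEq q] [DecidableEq l]

/-- The effect on `s • (A * W * B)` of adding one to the entry `(i, j)` of `W`. -/
noncomputable def entryDir (s : ℝ) (A : Matrix m m ℝ) (B : Matrix p p ℝ) (i : m) (j : p) :
    Matrix m p ℝ := s • (A * Matrix.single i j (1 : ℝ) * B)

theorem norm_single_le (i : m) (j : p) : ‖(Matrix.single i j 1 : Matrix m p ℝ)‖ ≤ 1 := by
  refine l2_opNorm_le_of_dotProduct_le zero_le_one fun x => ?_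
  have : (Matrix.single i j (1 : ℝ)) *ᵥ x = Pi.single i (x j) := by
    rw [Matrix.single_mulVec]; simp [Pi.single]
  rw [this, single_dotProduct, Pi.single_eq_same, one_pow, one_mul]
  exact Finset.single_le_sum (f := fun i => x i * x i) (fun i _ => mul_self_nonneg _)
    (Finset.mem_univ j)

theorem norm_entryDir_le (s : ℝ) (A : Matrix m m ℝ) (B : Matrix p p ℝ) (i : m) (j : p) :
    ‖entryDir s A B i j‖ ≤ |s| * (‖A‖ * ‖B‖) := by
  rw [entryDir, norm_smul, Real.norm_eq_abs]
  refine mul_le_mul_of_nonneg_left ?_ (abs_nonneg s)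
  simpa using l2_opNorm_mul_le (l2_opNorm_mul_le (le_refl ‖A‖) (norm_single_le i j))
    (le_refl ‖B‖)

theorem norm_skewBlock_entryDir_le (s : ℝ) (A : Matrix m m ℝ) (B : Matrix p p ℝ) (i : m)
    (j : p) : ‖skewBlock (entryDir s A B i j)‖ ≤ 2 * (|s| * (‖A‖ * ‖B‖)) :=
  (norm_skewBlock_le _).trans (by linarith [norm_entryDir_le s A B i j])

theorem trace_mul_single_mul (M : Matrix p m ℝ) (A : Matrix m m ℝ) (B : Matrix p p ℝ) (i : m)
    (j : p) : (M * (A * Matrix.single i j (1 : ℝ) * B)).trace = (B * M * A) j i := by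
  rw [← Matrix.mul_assoc, ← Matrix.mul_assoc, Matrix.trace_mul_cycle, Matrix.mul_assoc,
    ← Matrix.mul_assoc, ← Matrix.mul_assoc, Matrix.trace_mul_comm]
  simp [Matrix.trace_single_mul]

theorem abs_trace_mul_entryDir_le (s : ℝ) (A : Matrix m m ℝ) (B : Matrix p p ℝ) (i : m)
    (j : p) (M : Matrix p m ℝ) :
    |(M * entryDir s A B i j).trace| ≤ |s| * (‖A‖ * ‖B‖) * ‖M‖ := by
  rw [entryDir, Matrix.mul_smul, Matrix.trace_smul, trace_mul_single_mul, smul_eq_mul, abs_mul,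
    mul_assoc]
  refine mul_le_mul_of_nonneg_left ?_ (abs_nonneg s)
  refine (abs_apply_le_norm _ _ _).trans ?_
  have := l2_opNorm_mul_le (l2_opNorm_mul_le (le_refl ‖B‖) (le_refl ‖M‖)) (le_refl ‖A‖)
  linarith

/-- The direction has rank at most two, so the trace reduces to two matrix entries and is bounded by
operator norms with no dimension factor. The Lindeberg error is small enough only because of this.
-/
theorem abs_trace_mul_skewBlock_entryDir_le (s : ℝ) (A : Matrix m m ℝ) (B : Matrix p p ℝ)
    (i : m) (j : p) (M : Matrix (m ⊕ p) (m ⊕ p) ℝ) :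
    |(M * skewBlock (entryDir s A B i j)).trace| ≤ 2 * (|s| * (‖A‖ * ‖B‖)) * ‖M‖ := by
  set E := entryDir s A B i j with hE
  have h1 : ‖(inrMat m p)ᵀ‖ ≤ 1 := by rw [l2_opNorm_transpose]; exact norm_inrMat_le
  have h2 : ‖(inlMat m p)ᵀ‖ ≤ 1 := by rw [l2_opNorm_transpose]; exact norm_inlMat_le
  have e : (M * skewBlock E).trace = ((inrMat m p)ᵀ * M * inlMat m p * E).trace
      - (((inlMat m p)ᵀ * M * inrMat m p)ᵀ * E).trace := by
    rw [skewBlock_eq, Matrix.mul_sub, Matrix.trace_sub]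
    congr 1
    · rw [← Matrix.mul_assoc, Matrix.trace_mul_comm]
      simp only [Matrix.mul_assoc]
    · rw [← Matrix.mul_assoc, Matrix.trace_mul_comm, ← Matrix.trace_transpose]
      simp only [Matrix.transpose_mul, Matrix.transpose_transpose, Matrix.mul_assoc]
      rw [Matrix.trace_mul_comm]
      simp only [Matrix.mul_assoc]
  have b1 : ‖(inrMat m p)ᵀ * M * inlMat m p‖ ≤ ‖M‖ := by
    simpa using l2_opNorm_mul_le (l2_opNorm_mul_le h1 (le_refl ‖M‖)) norm_inlMat_le
  have b2 : ‖((inlMat m p)ᵀ * M * inrMat m p)ᵀ‖ ≤ ‖M‖ := by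
    rw [l2_opNorm_transpose]
    simpa using l2_opNorm_mul_le (l2_opNorm_mul_le h2 (le_refl ‖M‖)) norm_inrMat_le
  have c1 := abs_trace_mul_entryDir_le s A B i j ((inrMat m p)ᵀ * M * inlMat m p)
  have c2 := abs_trace_mul_entryDir_le s A B i j ((inlMat m p)ᵀ * M * inrMat m p)ᵀ
  have hk : 0 ≤ |s| * (‖A‖ * ‖B‖) := by positivity
  have d1 := mul_le_mul_of_nonneg_left b1 hk
  have d2 := mul_le_mul_of_nonneg_left b2 hk
  rw [e]
  refine (abs_sub _ _).trans ?_
  linarith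

/-- Third order expansion of the trace of the resolvent along a single entry. -/
theorem trace_gramRes_expansion (s : ℝ) (A : Matrix m m ℝ) (B : Matrix p p ℝ) (i : m) (j : p)
    (X : Matrix m p ℝ) : ∃ c0 c1 c2 : ℝ, ∀ z : ℝ,
      |(gramRes (X + z • entryDir s A B i j)).trace - (c0 + c1 * z + c2 * z ^ 2)|
        ≤ (2 * (|s| * (‖A‖ * ‖B‖))) ^ 3 * |z| ^ 3 := by
  set E := entryDir s A B i j with hE
  set k := 2 * (|s| * (‖A‖ * ‖B‖)) with hk
  have hk0 : 0 ≤ k := by positivity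
  set R := linRes X with hR
  set K := skewBlock E with hK
  have hKn : ‖K‖ ≤ k := norm_skewBlock_entryDir_le s A B i j
  have hRn : ‖R‖ ≤ 1 := norm_linRes_le X
  -- Half the coefficients of `linRes_expand_three`; the cardinalities come from `trace_linRes`.
  refine ⟨(R.trace + Fintype.card p - Fintype.card m) / 2, -(R * K * R).trace / 2,
    (R * K * R * K * R).trace / 2, fun z => ?_⟩
  have h1 := trace_linRes (X + z • E)
  have h2 := congrArg Matrix.trace (linRes_expand_three X E z)
  simp only [Matrix.trace_add, Matrix.trace_sub, Matrix.trace_smul, smul_eq_mul] at h2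
  set Rz := linRes (X + z • E) with hRz
  have hRzn : ‖Rz‖ ≤ 1 := norm_linRes_le _
  have h3 : |(R * K * R * K * R * K * Rz).trace| ≤ k ^ 3 := by
    -- Cycling puts one `K` last, where its low rank is used against the trace; the other two enter
    -- through their operator norms.
    have e : (R * K * R * K * R * K * Rz).trace = ((Rz * (R * K * R * K * R)) * K).trace := by
      rw [Matrix.trace_mul_comm, ← Matrix.mul_assoc]
    rw [e]
    refine (abs_trace_mul_skewBlock_entryDir_le s A B i j _).trans ?_
    have : ‖Rz * (R * K * R * K * R)‖ ≤ k ^ 2 := by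
      have := l2_opNorm_mul_le hRzn (l2_opNorm_mul_le (l2_opNorm_mul_le (l2_opNorm_mul_le
        (l2_opNorm_mul_le hRn hKn) hRn) hKn) hRn)
      refine this.trans (le_of_eq (by ring))
    calc _ ≤ k * k ^ 2 := mul_le_mul_of_nonneg_left this hk0
      _ = k ^ 3 := by ring
  have h4 : (gramRes (X + z • E)).trace - ((R.trace + Fintype.card p - Fintype.card m) / 2
      + -(R * K * R).trace / 2 * z + (R * K * R * K * R).trace / 2 * z ^ 2)
      = -(z ^ 3 * (R * K * R * K * R * K * Rz).trace) / 2 := by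
    linarith
  rw [h4, abs_div, abs_neg, abs_mul, abs_pow, abs_two]
  have h5 : |z| ^ 3 * |(R * K * R * K * R * K * Rz).trace| ≤ |z| ^ 3 * k ^ 3 :=
    mul_le_mul_of_nonneg_left h3 (by positivity)
  have h6 : 0 ≤ |z| ^ 3 * k ^ 3 := by positivity
  linarith

/-- First order expansions of a resolvent entry and of its derivative along a single entry. -/
theorem linRes_entry_expansion (s : ℝ) (A : Matrix m m ℝ) (B : Matrix p p ℝ) (i : m) (j : p)
    (X : Matrix m p ℝ) (U : Matrix q (m ⊕ p) ℝ) (V : Matrix (m ⊕ p) l ℝ) (a : q) (b : l) :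
    ∃ c0 c1 : ℝ, ∀ z : ℝ,
      |(U * linRes (X + z • entryDir s A B i j) * V) a b - (c0 + c1 * z)|
        ≤ 2 * (‖U‖ * ‖V‖ * (2 * (|s| * (‖A‖ * ‖B‖))) ^ 2) * z ^ 2 ∧
      |-(U * (linRes (X + z • entryDir s A B i j) * skewBlock (entryDir s A B i j)
          * linRes (X + z • entryDir s A B i j)) * V) a b - c1|
        ≤ 2 * (‖U‖ * ‖V‖ * (2 * (|s| * (‖A‖ * ‖B‖))) ^ 2) * |z| := by
  set E := entryDir s A B i j with hE
  set k := 2 * (|s| * (‖A‖ * ‖B‖)) with hk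
  have hk0 : 0 ≤ k := by positivity
  set R := linRes X with hR
  set K := skewBlock E with hK
  have hKn : ‖K‖ ≤ k := norm_skewBlock_entryDir_le s A B i j
  have hRn : ‖R‖ ≤ 1 := norm_linRes_le X
  have hUMV : ∀ (M : Matrix (m ⊕ p) (m ⊕ p) ℝ) (c : ℝ), ‖M‖ ≤ c →
      |(U * M * V) a b| ≤ ‖U‖ * ‖V‖ * c := by
    intro M c hM
    refine (abs_apply_le_norm _ _ _).trans ((l2_opNorm_mul_le (l2_opNorm_mul_le (le_refl ‖U‖)
      hM) (le_refl ‖V‖)).trans (le_of_eq (by ring)))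
  refine ⟨(U * R * V) a b, -(U * (R * K * R) * V) a b, fun z => ?_⟩
  set Rz := linRes (X + z • E) with hRz
  have hRzn : ‖Rz‖ ≤ 1 := norm_linRes_le _
  have hkk : ‖R * K * R * K * Rz‖ ≤ k ^ 2 := by
    have := l2_opNorm_mul_le (l2_opNorm_mul_le (l2_opNorm_mul_le
        (l2_opNorm_mul_le hRn hKn) hRn) hKn) hRzn
    exact this.trans (le_of_eq (by ring))
  have hkk' : ‖R * K * Rz * K * Rz‖ ≤ k ^ 2 := by
    have := l2_opNorm_mul_le (l2_opNorm_mul_le (l2_opNorm_mul_le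
        (l2_opNorm_mul_le hRn hKn) hRzn) hKn) hRzn
    exact this.trans (le_of_eq (by ring))
  have hC : 0 ≤ ‖U‖ * ‖V‖ * k ^ 2 := by positivity
  constructor
  · have e : (U * Rz * V) a b - ((U * R * V) a b + -(U * (R * K * R) * V) a b * z)
        = z ^ 2 * (U * (R * K * R * K * Rz) * V) a b := by
      have := congrArg (fun M => (U * M * V) a b) (linRes_expand_two X E z)
      simp only [Matrix.mul_add, Matrix.mul_sub, Matrix.mul_smul, Matrix.add_mul,
        Matrix.sub_mul, Matrix.smul_mul, Matrix.add_apply, Matrix.sub_apply, Matrix.smul_apply,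
        smul_eq_mul] at this
      rw [← hRz, ← hR, ← hK] at this
      rw [this]; ring
    rw [e, abs_mul, abs_of_nonneg (sq_nonneg z)]
    have := mul_le_mul_of_nonneg_left (hUMV _ _ hkk) (sq_nonneg z)
    nlinarith [mul_nonneg hC (sq_nonneg z)]
  · have e1 : Rz - R = -(z • (R * K * Rz)) := by
      have := linRes_add_smul X E z
      rw [← hRz, ← hR, ← hK] at this
      rw [sub_eq_iff_eq_add, neg_add_eq_sub]; exact this
    -- Both outer resolvents move with `z`, giving two terms of order `k ^ 2`; this is the factor 2
    -- in the bounds.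
    have e2 : Rz * K * Rz - R * K * R = -(z • (R * K * Rz * K * Rz))
        - z • (R * K * R * K * Rz) := by
      have : Rz * K * Rz - R * K * R = (Rz - R) * K * Rz + R * K * (Rz - R) := by noncomm_ring
      rw [this, e1]
      simp only [Matrix.neg_mul, Matrix.mul_neg, Matrix.smul_mul, Matrix.mul_smul,
        Matrix.mul_assoc]
      abel
    have e3 : -(U * (Rz * K * Rz) * V) a b - -(U * (R * K * R) * V) a b
        = z * (U * (R * K * Rz * K * Rz) * V) a b + z * (U * (R * K * R * K * Rz) * V) a b := by
      have := congrArg (fun M => (U * M * V) a b) e2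
      simp only [Matrix.mul_neg, Matrix.mul_sub, Matrix.mul_smul, Matrix.neg_mul,
        Matrix.sub_mul, Matrix.smul_mul, Matrix.neg_apply, Matrix.sub_apply, Matrix.smul_apply,
        smul_eq_mul] at this
      linarith
    rw [e3]
    refine (abs_add_le _ _).trans ?_
    rw [abs_mul, abs_mul]
    have a1 := mul_le_mul_of_nonneg_left (hUMV _ _ hkk) (abs_nonneg z)
    have a2 := mul_le_mul_of_nonneg_left (hUMV _ _ hkk') (abs_nonneg z)
    linarith

end EntryPerturbation

-- Coordinate resampling, Lindeberg replacement and approximate integration by parts.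

section ProductMeasure

variable {ι : Type*} [Fintype ι] [DecidableEq ι]

/-- Coordinate `i` is overwritten by an independent sample, so `μ i` no longer matters. This is how
integrals are conditioned on all the other coordinates. -/
theorem map_update_pi {E : Type*} [MeasurableSpace E] (μ : ι → Measure E)
    [∀ i, IsProbabilityMeasure (μ i)] (i : ι) (ν : Measure E) [IsProbabilityMeasure ν] :
    ((Measure.pi μ).prod ν).map (fun w => Function.update w.1 i w.2)
      = Measure.pi (Function.update μ i ν) := by
  have hprob : ∀ j, IsProbabilityMeasure (Function.update μ i ν j) := by
    intro j
    by_cases h : j = i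
    · subst h; simpa using (inferInstance : IsProbabilityMeasure ν)
    · simpa [h] using (inferInstance : IsProbabilityMeasure (μ j))
  have hmeas : Measurable (fun w : (ι → E) × E => Function.update w.1 i w.2) := by
    rw [measurable_pi_iff]
    intro j
    by_cases h : j = i
    · subst h; simpa using measurable_snd
    · simp only [Function.update_of_ne h]; fun_prop
  symm
  apply Measure.pi_eq
  intro s hs
  rw [Measure.map_apply hmeas (MeasurableSet.univ_pi hs)]
  have : (fun w : (ι → E) × E => Function.update w.1 i w.2) ⁻¹' (Set.univ.pi s)
      = (Set.univ.pi (Function.update s i Set.univ)) ×ˢ (s i) := by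
    ext w
    simp only [Set.mem_preimage, Set.mem_pi, Set.mem_univ, true_imp_iff, Set.mem_prod]
    constructor
    · intro h
      refine ⟨fun j => ?_, by simpa using h i⟩
      by_cases hj : j = i
      · subst hj; simp
      · simpa [hj] using h j
    · rintro ⟨h1, h2⟩ j
      by_cases hj : j = i
      · subst hj; simpa using h2
      · simpa [hj] using h1 j
  rw [this, Measure.prod_prod, Measure.pi_pi, ← Finset.mul_prod_erase Finset.univ _
    (Finset.mem_univ i), ← Finset.mul_prod_erase Finset.univ (fun j => Function.update μ i ν j (s j))
    (Finset.mem_univ i)]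
  simp only [Function.update_self, measure_univ, one_mul]
  rw [mul_comm]
  congr 1
  refine Finset.prod_congr rfl fun j hj => ?_
  have hj' : j ≠ i := Finset.ne_of_mem_erase hj
  simp [hj']

theorem measurable_update_pair {E : Type*} [MeasurableSpace E] (i : ι) :
    Measurable (fun w : (ι → E) × E => Function.update w.1 i w.2) := by
  rw [measurable_pi_iff]
  intro j
  by_cases h : j = i
  · subst h; simpa using measurable_snd
  · simp only [Function.update_of_ne h]; fun_prop

theorem integral_pi_update {E : Type*} [MeasurableSpace E] (μ : ι → Measure E)
    [∀ i, IsProbabilityMeasure (μ i)] (i : ι) (ν : Measure E) [IsProbabilityMeasure ν]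
    {F : (ι → E) → ℝ} (hF : Integrable F (Measure.pi (Function.update μ i ν))) :
    ∫ x, F x ∂Measure.pi (Function.update μ i ν)
      = ∫ x, ∫ z, F (Function.update x i z) ∂ν ∂Measure.pi μ := by
  rw [← map_update_pi] at hF ⊢
  rw [integral_map (measurable_update_pair i).aemeasurable hF.1]
  exact integral_prod _ (hF.comp_measurable (measurable_update_pair i))

/-- Probability laws on the line with mean zero, variance one and third absolute moment at
most `M`. -/
structure IsStandardized (ν : Measure ℝ) (M : ℝ) : Prop where
  prob : IsProbabilityMeasure ν
  memLp : MemLp (fun z : ℝ => z) 3 ν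
  mean : ∫ z, z ∂ν = 0
  var : ∫ z, z ^ 2 ∂ν = 1
  third : ∫ z, |z| ^ 3 ∂ν ≤ M

namespace IsStandardized

variable {ν : Measure ℝ} {M : ℝ}

theorem integrable_id (h : IsStandardized ν M) : Integrable (fun z : ℝ => z) ν :=
  have := h.prob
  memLp_one_iff_integrable.mp (h.memLp.mono_exponent (by norm_num))

theorem integrable_sq (h : IsStandardized ν M) : Integrable (fun z : ℝ => z ^ 2) ν :=
  have := h.prob
  (h.memLp.mono_exponent (q := 3) (p := 2) (by norm_num)).integrable_sq

theorem integrable_cube (h : IsStandardized ν M) : Integrable (fun z : ℝ => |z| ^ 3) ν := by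
  have := h.memLp.integrable_norm_rpow (by norm_num) (by norm_num)
  simpa using this

theorem nonneg (h : IsStandardized ν M) : 0 ≤ M :=
  (integral_nonneg fun z => by positivity).trans h.third

theorem integral_abs_le_one (h : IsStandardized ν M) : ∫ z, |z| ∂ν ≤ 1 := by
  have := h.prob
  calc ∫ z, |z| ∂ν ≤ ∫ z, (z ^ 2 + 1) / 2 ∂ν := by
        refine integral_mono h.integrable_id.abs
          ((h.integrable_sq.add (integrable_const 1)).div_const 2) fun z => ?_
        show |z| ≤ (z ^ 2 + 1) / 2
        nlinarith [sq_nonneg (|z| - 1), sq_abs z]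
    _ = 1 := by
        rw [integral_div, integral_add h.integrable_sq (integrable_const 1), h.var]
        simp

end IsStandardized

/-- Both laws have the same moments up to order two, so each gives the quadratic part the mean `c0 +
c2`; only the cubic remainders differ. -/
theorem integral_expansion_diff {ν1 ν2 : Measure ℝ} {M : ℝ} (h1 : IsStandardized ν1 M)
    (h2 : IsStandardized ν2 M) {f : ℝ → ℝ} (hf1 : Integrable f ν1) (hf2 : Integrable f ν2)
    {C c0 c1 c2 : ℝ} (hC : 0 ≤ C)
    (hf : ∀ z, |f z - (c0 + c1 * z + c2 * z ^ 2)| ≤ C * |z| ^ 3) :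
    |∫ z, f z ∂ν1 - ∫ z, f z ∂ν2| ≤ C * (2 * M) := by
  have key : ∀ ν : Measure ℝ, IsStandardized ν M → Integrable f ν →
      |∫ z, f z ∂ν - (c0 + c2)| ≤ C * M := by
    intro ν h hfi
    have := h.prob
    have hi : Integrable (fun z : ℝ => c0 + c1 * z + c2 * z ^ 2) ν :=
      ((integrable_const c0).add (h.integrable_id.const_mul c1)).add
        (h.integrable_sq.const_mul c2)
    have hi1 : Integrable (fun z : ℝ => c0 + c1 * z) ν :=
      (integrable_const c0).add (h.integrable_id.const_mul c1)
    have e : ∫ z, (c0 + c1 * z + c2 * z ^ 2) ∂ν = c0 + c2 := by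
      rw [integral_add hi1
        (h.integrable_sq.const_mul c2), integral_add (integrable_const c0)
        (h.integrable_id.const_mul c1), integral_const_mul, integral_const_mul, h.mean, h.var]
      simp
    rw [← e, ← integral_sub hfi hi]
    calc |∫ z, (f z - (c0 + c1 * z + c2 * z ^ 2)) ∂ν|
        ≤ ∫ z, |f z - (c0 + c1 * z + c2 * z ^ 2)| ∂ν := abs_integral_le_integral_abs
      _ ≤ ∫ z, C * |z| ^ 3 ∂ν :=
          integral_mono (hfi.sub hi).abs (h.integrable_cube.const_mul C) hf
      _ ≤ C * M := by
          rw [integral_const_mul]; exact mul_le_mul_of_nonneg_left h.third hC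
  have a := abs_le.mp (key ν1 h1 hf1)
  have b := abs_le.mp (key ν2 h2 hf2)
  rw [abs_le]
  constructor <;> linarith [a.1, a.2, b.1, b.2]

theorem integrable_of_bounded {α : Type*} [MeasurableSpace α] {μ : Measure α}
    [IsFiniteMeasure μ] {f : α → ℝ} (hf : Measurable f) {C : ℝ} (hb : ∀ x, |f x| ≤ C) :
    Integrable f μ :=
  Integrable.of_bound hf.aestronglyMeasurable C (Eventually.of_forall fun x => hb x)

/-- Lindeberg replacement: a bounded function which admits a second order expansion with cubic
remainder along every coordinate has nearly the same mean under two i.i.d. standardized laws. -/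
theorem lindeberg_replacement {ν1 ν2 : Measure ℝ} {M : ℝ} (h1 : IsStandardized ν1 M)
    (h2 : IsStandardized ν2 M) {F : (ι → ℝ) → ℝ} (hF : Measurable F) {b C : ℝ}
    (hb : ∀ x, |F x| ≤ b) (hC : 0 ≤ C)
    (hexp : ∀ x i, ∃ c0 c1 c2 : ℝ, ∀ z : ℝ,
      |F (Function.update x i z) - (c0 + c1 * z + c2 * z ^ 2)| ≤ C * |z| ^ 3) :
    |∫ x, F x ∂Measure.pi (fun _ : ι => ν1) - ∫ x, F x ∂Measure.pi (fun _ : ι => ν2)|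
      ≤ Fintype.card ι * (C * (2 * M)) := by
  have := h1.prob
  have := h2.prob
  have step : ∀ (μ : ι → Measure ℝ) [∀ i, IsProbabilityMeasure (μ i)] (i : ι),
      |∫ x, F x ∂Measure.pi (Function.update μ i ν1)
        - ∫ x, F x ∂Measure.pi (Function.update μ i ν2)| ≤ C * (2 * M) := by
    intro μ _ i
    have hprob : ∀ (ν : Measure ℝ) [IsProbabilityMeasure ν] (j : ι),
        IsProbabilityMeasure (Function.update μ i ν j) := by
      intro ν _ j
      by_cases h : j = i
      · subst h; simpa
      · simpa [h] using (inferInstance : IsProbabilityMeasure (μ j))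
    have := hprob ν1
    have := hprob ν2
    have hmu : ∀ x : ι → ℝ, Measurable fun z : ℝ => F (Function.update x i z) := fun x =>
      hF.comp ((measurable_update_pair i).comp measurable_prodMk_left)
    have hi : ∀ (ν : Measure ℝ) [IsProbabilityMeasure ν],
        Integrable (fun x => ∫ z, F (Function.update x i z) ∂ν) (Measure.pi μ) := fun ν _ =>
      ((integrable_of_bounded (μ := (Measure.pi μ).prod ν)
        (hF.comp (measurable_update_pair i)) fun w => hb _)).integral_prod_left
    rw [integral_pi_update μ i ν1 (integrable_of_bounded hF hb),
      integral_pi_update μ i ν2 (integrable_of_bounded hF hb), ← integral_sub (hi ν1) (hi ν2)]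
    have hpt : ∀ x : ι → ℝ, |∫ z, F (Function.update x i z) ∂ν1
        - ∫ z, F (Function.update x i z) ∂ν2| ≤ C * (2 * M) := by
      intro x
      obtain ⟨c0, c1, c2, h⟩ := hexp x i
      exact integral_expansion_diff h1 h2 (integrable_of_bounded (hmu x) fun z => hb _)
        (integrable_of_bounded (hmu x) fun z => hb _) hC h
    calc _ ≤ ∫ x, |∫ z, F (Function.update x i z) ∂ν1
        - ∫ z, F (Function.update x i z) ∂ν2| ∂Measure.pi μ := abs_integral_le_integral_abs
      _ ≤ ∫ _x, C * (2 * M) ∂Measure.pi μ :=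
          integral_mono ((hi ν1).sub (hi ν2)).abs (integrable_const _) hpt
      _ = C * (2 * M) := by simp
  -- Hybrid product laws: `ν1` on the coordinates in `s` and `ν2` elsewhere, with one exchange for
  -- each inserted coordinate.
  have hyb : ∀ s : Finset ι, |∫ x, F x ∂Measure.pi (fun i => if i ∈ s then ν1 else ν2)
      - ∫ x, F x ∂Measure.pi (fun _ : ι => ν2)| ≤ s.card * (C * (2 * M)) := by
    intro s
    induction s using Finset.induction_on with
    | empty => simp
    | insert a s ha ih =>
      have hp : ∀ i, IsProbabilityMeasure (if i ∈ s then ν1 else ν2) := by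
        intro i; split_ifs <;> infer_instance
      have e1 : (fun i => if i ∈ insert a s then ν1 else ν2)
          = Function.update (fun i => if i ∈ s then ν1 else ν2) a ν1 := by
        ext1 i
        by_cases h : i = a
        · subst h; simp
        · simp [h]
      have e2 : (fun i => if i ∈ s then ν1 else ν2)
          = Function.update (fun i => if i ∈ s then ν1 else ν2) a ν2 := by
        ext1 i
        by_cases h : i = a
        · subst h; simp [ha]
        · simp [h]
      have h3 := step (fun i => if i ∈ s then ν1 else ν2) a
      rw [← e1, ← e2] at h3
      rw [Finset.card_insert_of_notMem ha, Nat.cast_add, Nat.cast_one, add_mul, one_mul]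
      have := abs_sub_le (∫ x, F x ∂Measure.pi (fun i => if i ∈ insert a s then ν1 else ν2))
        (∫ x, F x ∂Measure.pi (fun i => if i ∈ s then ν1 else ν2))
        (∫ x, F x ∂Measure.pi (fun _ : ι => ν2))
      linarith
  simpa using hyb Finset.univ

/-- Approximate integration by parts for i.i.d. standardized coordinates. -/
theorem abs_integral_stein_le {ν : Measure ℝ} {M : ℝ} (h : IsStandardized ν M)
    {f f' : (ι → ℝ) → ℝ} (hf : Measurable f) (hf' : Measurable f') {b C : ℝ}
    (hb : ∀ x, |f x| ≤ b) (hb' : ∀ x, |f' x| ≤ b) (hC : 0 ≤ C) (i : ι)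
    (hexp : ∀ x, ∃ c0 c1 : ℝ, ∀ z : ℝ,
      |f (Function.update x i z) - (c0 + c1 * z)| ≤ C * z ^ 2 ∧
      |f' (Function.update x i z) - c1| ≤ C * |z|) :
    Integrable (fun x => x i * f x) (Measure.pi fun _ : ι => ν) ∧
    |∫ x, (x i * f x - f' x) ∂Measure.pi (fun _ : ι => ν)| ≤ C * (M + 1) := by
  have := h.prob
  have hxi : Integrable (fun x : ι → ℝ => x i) (Measure.pi fun _ : ι => ν) :=
    (measurePreserving_eval (fun _ : ι => ν) i).integrable_comp_of_integrable h.integrable_id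
  have hxf : Integrable (fun x : ι → ℝ => x i * f x) (Measure.pi fun _ : ι => ν) := by
    have := hxi.bdd_mul (c := b) hf.aestronglyMeasurable (Eventually.of_forall fun x => hb x)
    simpa [mul_comm] using this
  refine ⟨hxf, ?_⟩
  have hint := hxf.sub (integrable_of_bounded (μ := Measure.pi fun _ : ι => ν) hf' hb')
  have hupd : Function.update (fun _ : ι => ν) i ν = fun _ => ν := Function.update_eq_self i _
  have hint0 := hint
  rw [← hupd] at hint
  have e := integral_pi_update (fun _ : ι => ν) i ν hint
  rw [hupd] at e
  simp only [Pi.sub_apply] at e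
  rw [e]
  rw [← map_update_pi] at hint
  have hint2 := (hint.comp_measurable (measurable_update_pair i)).integral_prod_left
  have hmu : ∀ x : ι → ℝ, Measurable fun z : ℝ => f (Function.update x i z) := fun x =>
    hf.comp ((measurable_update_pair i).comp measurable_prodMk_left)
  have hmu' : ∀ x : ι → ℝ, Measurable fun z : ℝ => f' (Function.update x i z) := fun x =>
    hf'.comp ((measurable_update_pair i).comp measurable_prodMk_left)
  have hpt : ∀ x : ι → ℝ, |∫ z, (Function.update x i z i * f (Function.update x i z)
      - f' (Function.update x i z)) ∂ν| ≤ C * (M + 1) := by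
    intro x
    obtain ⟨c0, c1, hc⟩ := hexp x
    simp only [Function.update_self]
    have i1 : Integrable (fun z => z * f (Function.update x i z)) ν := by
      have := h.integrable_id.bdd_mul (c := b) (hmu x).aestronglyMeasurable
        (Eventually.of_forall fun x => hb _)
      simpa [mul_comm] using this
    have i2 := integrable_of_bounded (μ := ν) (hmu' x) fun z => hb' _
    have i3 : Integrable (fun z : ℝ => c0 * z + c1 * z ^ 2 - c1) ν :=
      ((h.integrable_id.const_mul c0).add (h.integrable_sq.const_mul c1)).sub
        (integrable_const c1)
    have i4 : Integrable (fun z : ℝ => c0 * z + c1 * z ^ 2) ν :=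
      (h.integrable_id.const_mul c0).add (h.integrable_sq.const_mul c1)
    have i5 : Integrable (fun z => z * f (Function.update x i z) - f' (Function.update x i z)) ν :=
      i1.sub i2
    -- This is `z * (c0 + c1 * z) - c1`, the contribution of the linear model. It vanishes exactly
    -- by mean zero and variance one, leaving C|z|³ + C|z| as the error.
    have e3 : ∫ z : ℝ, (c0 * z + c1 * z ^ 2 - c1) ∂ν = 0 := by
      rw [integral_sub i4 (integrable_const c1), integral_add (h.integrable_id.const_mul c0)
        (h.integrable_sq.const_mul c1), integral_const_mul, integral_const_mul, h.mean, h.var]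
      simp
    have e4 : ∫ z, (z * f (Function.update x i z) - f' (Function.update x i z)) ∂ν
        = ∫ z, ((z * f (Function.update x i z) - f' (Function.update x i z))
          - (c0 * z + c1 * z ^ 2 - c1)) ∂ν := by
      rw [integral_sub i5 i3, e3, sub_zero]
    rw [e4]
    calc _ ≤ ∫ z, |(z * f (Function.update x i z) - f' (Function.update x i z))
          - (c0 * z + c1 * z ^ 2 - c1)| ∂ν := abs_integral_le_integral_abs
      _ ≤ ∫ z, (C * |z| ^ 3 + C * |z|) ∂ν := by
          refine integral_mono ((i1.sub i2).sub i3).abs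
            ((h.integrable_cube.const_mul C).add (h.integrable_id.abs.const_mul C)) fun z => ?_
          obtain ⟨a1, a2⟩ := hc z
          have : (z * f (Function.update x i z) - f' (Function.update x i z))
              - (c0 * z + c1 * z ^ 2 - c1)
              = z * (f (Function.update x i z) - (c0 + c1 * z))
                - (f' (Function.update x i z) - c1) := by ring
          show |_| ≤ _
          rw [this]
          refine (abs_sub _ _).trans (add_le_add ?_ a2)
          rw [abs_mul]
          calc |z| * _ ≤ |z| * (C * z ^ 2) := mul_le_mul_of_nonneg_left a1 (abs_nonneg z)
            _ = C * |z| ^ 3 := by rw [← sq_abs]; ring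
      _ ≤ C * (M + 1) := by
          rw [integral_add (h.integrable_cube.const_mul C) (h.integrable_id.abs.const_mul C),
            integral_const_mul, integral_const_mul, mul_add]
          exact add_le_add (mul_le_mul_of_nonneg_left h.third hC)
            (mul_le_mul_of_nonneg_left h.integral_abs_le_one hC)
  calc _ ≤ ∫ x, |∫ z, (Function.update x i z i * f (Function.update x i z)
      - f' (Function.update x i z)) ∂ν| ∂Measure.pi (fun _ : ι => ν) :=
        abs_integral_le_integral_abs
    _ ≤ ∫ _x, C * (M + 1) ∂Measure.pi (fun _ : ι => ν) :=
        integral_mono hint2.abs (integrable_const _) hpt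
    _ = C * (M + 1) := by simp

end ProductMeasure

-- Continuity of resolvents, and the model matrix as a function of its entries.

section Continuity

variable {m p : Type*} [Fintype m] [Fintype p] [DecidableEq m] [DecidableEq p]

theorem continuous_gramRes : Continuous (gramRes : Matrix m p ℝ → Matrix p p ℝ) := by
  have h : Continuous fun X : Matrix m p ℝ => 1 + Xᵀ * X :=
    continuous_const.add ((continuous_id.matrix_transpose).matrix_mul continuous_id)
  have e : (gramRes : Matrix m p ℝ → Matrix p p ℝ)
      = fun X => ((1 + Xᵀ * X).det)⁻¹ • (1 + Xᵀ * X).adjugate := by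
    ext1 X
    rw [gramRes, Matrix.inv_def, Ring.inverse_eq_inv']
  rw [e]
  exact (h.matrix_det.inv₀ fun X => (isUnit_det_gram X).ne_zero).smul h.matrix_adjugate

theorem continuous_linRes : Continuous (linRes : Matrix m p ℝ → Matrix (m ⊕ p) (m ⊕ p) ℝ) := by
  have h1 : Continuous fun X : Matrix m p ℝ => gramRes Xᵀ :=
    continuous_gramRes.comp continuous_id.matrix_transpose
  exact h1.matrix_fromBlocks ((h1.matrix_mul continuous_id).neg)
    (continuous_id.matrix_transpose.matrix_mul h1) continuous_gramRes

/-- The matrix `s • (A * W * B)`, where `W` has the entries `x`. -/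
noncomputable def sandwich (s : ℝ) (A : Matrix m m ℝ) (B : Matrix p p ℝ) (x : m × p → ℝ) :
    Matrix m p ℝ := s • (A * Matrix.of (fun i j => x (i, j)) * B)

theorem continuous_sandwich (s : ℝ) (A : Matrix m m ℝ) (B : Matrix p p ℝ) :
    Continuous (sandwich s A B) := by
  have h : Continuous fun x : m × p → ℝ => (Matrix.of fun i j => x (i, j) : Matrix m p ℝ) :=
    continuous_matrix fun i j => continuous_apply (i, j)
  exact ((continuous_const.matrix_mul h).matrix_mul continuous_const).const_smul s

/-- The expansion point has the entry `(i, j)` set to zero, so the increment is the value `z`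
itself, to which the moment conditions apply. -/
theorem sandwich_update (s : ℝ) (A : Matrix m m ℝ) (B : Matrix p p ℝ) (x : m × p → ℝ) (i : m)
    (j : p) (z : ℝ) : sandwich s A B (Function.update x (i, j) z)
      = sandwich s A B (Function.update x (i, j) 0) + z • entryDir s A B i j := by
  have : (Matrix.of fun i' j' => Function.update x (i, j) z (i', j') : Matrix m p ℝ)
      = Matrix.of (fun i' j' => Function.update x (i, j) 0 (i', j'))
        + z • Matrix.single i j (1 : ℝ) := by
    ext i' j'
    by_cases h : (i', j') = (i, j)
    · obtain ⟨rfl, rfl⟩ := Prod.mk.inj h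
      simp
    · have h2 : ¬ (i = i' ∧ j = j') := fun h3 => h (by rw [h3.1, h3.2])
      simp [Function.update_of_ne h, h2]
  rw [sandwich, sandwich, entryDir, this, Matrix.mul_add, Matrix.add_mul, smul_add,
    Matrix.mul_smul, Matrix.smul_mul, smul_comm z s]

end Continuity

-- Approximate integration by parts for resolvents.

section Stein

open scoped Matrix.Norms.L2Operator

variable {m p : Type*} [Fintype m] [Fintype p] [DecidableEq m] [DecidableEq p]

/-- Each column has Euclidean norm at most the operator norm. The double sum therefore has order
`card m` rather than `card m * card p`, which makes this term negligible. -/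
theorem sum_abs_mul_entries_le (M M' : Matrix p m ℝ) {c : ℝ} (hM : ‖M‖ ≤ c) (hM' : ‖M'‖ ≤ c) :
    |∑ i, ∑ j, M j i * M' j i| ≤ Fintype.card m * c ^ 2 := by
  have hcol : ∀ (N : Matrix p m ℝ) (i : m), ‖N‖ ≤ c → ∑ j, N j i ^ 2 ≤ c ^ 2 := fun N i h =>
    (sum_sq_col_le N i).trans (pow_le_pow_left₀ (norm_nonneg _) h 2)
  calc |∑ i, ∑ j, M j i * M' j i| ≤ ∑ i, |∑ j, M j i * M' j i| := Finset.abs_sum_le_sum_abs _ _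
    _ ≤ ∑ _i : m, c ^ 2 := by
        refine Finset.sum_le_sum fun i _ => ?_
        calc |∑ j, M j i * M' j i| ≤ ∑ j, |M j i * M' j i| := Finset.abs_sum_le_sum_abs _ _
          _ ≤ ∑ j, (M j i ^ 2 + M' j i ^ 2) / 2 := by
              refine Finset.sum_le_sum fun j _ => ?_
              rw [abs_mul]
              nlinarith [sq_nonneg (|M j i| - |M' j i|), sq_abs (M j i), sq_abs (M' j i)]
          _ ≤ c ^ 2 := by
              rw [← Finset.sum_div, Finset.sum_add_distrib]
              linarith [hcol M i hM, hcol M' i hM']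
    _ = _ := by simp

/-- The direction is the sum of two rank-one blocks. The term with diagonal indices `j j` and `i i`
sums over all entries to a product of two traces; the other sums to a remainder. -/
theorem resolvent_derivative_entry (s : ℝ) (A : Matrix m m ℝ) (B : Matrix p p ℝ) (i : m) (j : p)
    (R : Matrix (m ⊕ p) (m ⊕ p) ℝ) (U : Matrix p (m ⊕ p) ℝ) (V : Matrix (m ⊕ p) m ℝ) :
    (U * (R * skewBlock (entryDir s A B i j) * R) * V) j i
      = s * ((U * R * inlMat m p * A) j i * (B * ((inrMat m p)ᵀ * R * V)) j i
        - (U * R * inrMat m p * Bᵀ) j j * (Aᵀ * ((inlMat m p)ᵀ * R * V)) i i) := by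
  have h1 : ∀ (P : Matrix p m ℝ) (T : Matrix p m ℝ) ,
      (P * Matrix.single i j (1 : ℝ) * T) j i = P j i * T j i := by
    intro P T
    simp [Matrix.mul_apply, Matrix.single_apply,
      ite_and]
  have h2 : ∀ (P : Matrix p p ℝ) (T : Matrix m m ℝ) ,
      (P * (Matrix.single i j (1 : ℝ))ᵀ * T) j i = P j j * T i i := by
    intro P T
    simp [Matrix.mul_apply, Matrix.single_apply, ite_and]
  rw [← h1, ← h2, skewBlock_eq, entryDir]
  simp only [Matrix.mul_sub, Matrix.sub_mul, Matrix.mul_smul, Matrix.smul_mul,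
    Matrix.transpose_smul, Matrix.transpose_mul, Matrix.sub_apply, Matrix.smul_apply,
    smul_eq_mul, Matrix.mul_assoc, mul_sub]

variable {ν : Measure ℝ} {M : ℝ}

/-- Approximate Gaussian integration by parts for the resolvent of `s • (A * W * B)`. -/
theorem abs_integral_resolvent_stein_le (h : IsStandardized ν M) {s a b : ℝ} (hs : 0 ≤ s)
    {A Θ : Matrix m m ℝ} {B : Matrix p p ℝ} (hA : ‖A‖ ≤ a) (hB : ‖B‖ ≤ b) (hΘ : ‖Θ‖ ≤ 1) :
    |∫ x, ((Θ.trace - (Θ * gramRes (sandwich s A B x)ᵀ).trace)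
        - s ^ 2 * ((B * gramRes (sandwich s A B x) * Bᵀ).trace
          * (Aᵀ * gramRes (sandwich s A B x)ᵀ * (Θ * A)).trace)) ∂Measure.pi fun _ : m × p => ν|
      ≤ s ^ 2 * (Fintype.card m * (a * b) ^ 2)
        + Fintype.card m * Fintype.card p * (8 * (s * a * b) ^ 3 * (M + 1)) := by
  have := h.prob
  have ha0 : 0 ≤ a := (norm_nonneg _).trans hA
  have hb0 : 0 ≤ b := (norm_nonneg _).trans hB
  set P := Measure.pi fun _ : m × p => ν with hP
  set X := sandwich s A B with hX
  have hr : ‖(inrMat m p)ᵀ‖ ≤ 1 := by rw [l2_opNorm_transpose]; exact norm_inrMat_le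
  set U : Matrix p (m ⊕ p) ℝ := B * (inrMat m p)ᵀ with hU
  set V : Matrix (m ⊕ p) m ℝ := s • (inlMat m p * (Θ * A)) with hV
  have hΘA : ‖Θ * A‖ ≤ a := by simpa using l2_opNorm_mul_le hΘ hA
  have hUn : ‖U‖ ≤ b := by simpa using l2_opNorm_mul_le hB hr
  have hVn : ‖V‖ ≤ s * a := by
    rw [hV, norm_smul, Real.norm_eq_abs, abs_of_nonneg hs]
    refine mul_le_mul_of_nonneg_left ?_ hs
    simpa using l2_opNorm_mul_le norm_inlMat_le hΘA
  set f : m → p → (m × p → ℝ) → ℝ := fun i j x => (U * linRes (X x) * V) j i with hf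
  set f' : m → p → (m × p → ℝ) → ℝ := fun i j x =>
    -(U * (linRes (X x) * skewBlock (entryDir s A B i j) * linRes (X x)) * V) j i with hf'
  have hlin : Continuous fun x => linRes (X x) :=
    continuous_linRes.comp (continuous_sandwich s A B)
  have hfc : ∀ i j, Continuous (f i j) := fun i j =>
    ((continuous_const.matrix_mul hlin).matrix_mul continuous_const).matrix_elem j i
  have hfc' : ∀ i j, Continuous (f' i j) := fun i j =>
    (((continuous_const.matrix_mul ((hlin.matrix_mul continuous_const).matrix_mul
      hlin)).matrix_mul continuous_const).matrix_elem j i).neg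
  have hent : ∀ i j (N : Matrix (m ⊕ p) (m ⊕ p) ℝ) (c : ℝ), ‖N‖ ≤ c →
      |(U * N * V) j i| ≤ b * c * (s * a) := fun i j N c hN =>
    (abs_apply_le_norm _ _ _).trans (l2_opNorm_mul_le (l2_opNorm_mul_le hUn hN) hVn)
  have hfb : ∀ i j x, |f i j x| ≤ b * (1 + 2 * (|s| * (‖A‖ * ‖B‖))) * (s * a) := fun i j x =>
    hent i j _ _ ((norm_linRes_le _).trans
      (le_add_of_nonneg_right (by positivity)))
  have hfb' : ∀ i j x, |f' i j x| ≤ b * (1 + 2 * (|s| * (‖A‖ * ‖B‖))) * (s * a) := fun i j x => by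
    simp only [hf', abs_neg]
    refine hent i j _ _ ?_
    have := l2_opNorm_mul_le (l2_opNorm_mul_le (norm_linRes_le (X x))
      (norm_skewBlock_entryDir_le s A B i j)) (norm_linRes_le (X x))
    linarith
  set C := 2 * (b * (s * a) * (2 * (s * (a * b))) ^ 2) with hC
  have hCle : 2 * (‖U‖ * ‖V‖ * (2 * (|s| * (‖A‖ * ‖B‖))) ^ 2) ≤ C := by
    rw [hC, abs_of_nonneg hs]
    have h1 : ‖U‖ * ‖V‖ ≤ b * (s * a) := mul_le_mul hUn hVn (norm_nonneg _) hb0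
    have h2 : ‖A‖ * ‖B‖ ≤ a * b := mul_le_mul hA hB (norm_nonneg _) ha0
    have h3 : 2 * (s * (‖A‖ * ‖B‖)) ≤ 2 * (s * (a * b)) := by
      have := mul_le_mul_of_nonneg_left h2 hs
      linarith
    have h4 := pow_le_pow_left₀ (by positivity) h3 2
    have h5 := mul_le_mul h1 h4 (by positivity) (by positivity)
    linarith
  have hst : ∀ i j, Integrable (fun x => x (i, j) * f i j x) P ∧
      |∫ x, (x (i, j) * f i j x - f' i j x) ∂P| ≤ C * (M + 1) := by
    intro i j
    refine abs_integral_stein_le h (hfc i j).measurable (hfc' i j).measurable (hfb i j)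
      (hfb' i j) (by positivity) (i, j) fun x => ?_
    obtain ⟨c0, c1, hc⟩ := linRes_entry_expansion s A B i j
      (sandwich s A B (Function.update x (i, j) 0)) U V j i
    refine ⟨c0, c1, fun z => ?_⟩
    simp only [hf, hf', hX]
    rw [sandwich_update]
    exact ⟨(hc z).1.trans (mul_le_mul_of_nonneg_right hCle (sq_nonneg z)),
      (hc z).2.trans (mul_le_mul_of_nonneg_right hCle (abs_nonneg z))⟩
  -- `f` is chosen so that pairing it with the entries rebuilds `X` inside a trace, giving tr(Θ X Xᵀ
  -- (1 + X Xᵀ)⁻¹) = tr(Θ - Θ (1 + X Xᵀ)⁻¹).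
  have hid1 : ∀ x, ∑ i, ∑ j, x (i, j) * f i j x
      = Θ.trace - (Θ * gramRes (X x)ᵀ).trace := by
    intro x
    have e1 : ∑ i, ∑ j, x (i, j) * f i j x
        = ((Matrix.of fun i j => x (i, j) : Matrix m p ℝ) * (U * linRes (X x) * V)).trace := by
      simp only [Matrix.trace, Matrix.diag, Matrix.mul_apply (M := (Matrix.of _)), Matrix.of_apply,
        hf]
    rw [e1]
    have e2 : U * linRes (X x) * V = s • (B * ((X x)ᵀ * gramRes (X x)ᵀ) * (Θ * A)) := by
      rw [← inrMat_linRes_inlMat, hU, hV]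
      simp only [Matrix.mul_smul, Matrix.mul_assoc]
    have e3 : Θ * (X x * ((X x)ᵀ * gramRes (X x)ᵀ)) = Θ - Θ * gramRes (X x)ᵀ := by
      rw [one_sub_gramRes', Matrix.mul_sub, Matrix.mul_one]
    rw [e2, ← Matrix.trace_sub, ← e3]
    set Y := (X x)ᵀ * gramRes (X x)ᵀ
    have e4 : X x = s • (A * Matrix.of (fun i j => x (i, j)) * B) := rfl
    rw [e4]
    simp only [Matrix.mul_smul, Matrix.smul_mul, Matrix.trace_smul]
    congr 1
    rw [← Matrix.mul_assoc, Matrix.trace_mul_comm]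
    simp only [Matrix.mul_assoc]
  set S : (m × p → ℝ) → ℝ := fun x => ∑ i, ∑ j,
    (U * linRes (X x) * inlMat m p * A) j i
      * (B * ((inrMat m p)ᵀ * linRes (X x) * (inlMat m p * (Θ * A)))) j i with hS
  -- The summed derivative is the product of traces in the statement, minus `s ^ 2 * S` with `S` of
  -- order `card m`.
  have hid2 : ∀ x, ∑ i, ∑ j, f' i j x = s ^ 2 * ((B * gramRes (X x) * Bᵀ).trace
      * (Aᵀ * gramRes (X x)ᵀ * (Θ * A)).trace) - s ^ 2 * S x := by
    intro x
    have e1 : (B * gramRes (X x) * Bᵀ) = U * linRes (X x) * inrMat m p * Bᵀ := by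
      rw [← inrMat_linRes_inrMat, hU]; simp only [Matrix.mul_assoc]
    have e2 : (Aᵀ * gramRes (X x)ᵀ * (Θ * A))
        = Aᵀ * ((inlMat m p)ᵀ * linRes (X x) * (inlMat m p * (Θ * A))) := by
      rw [← inlMat_linRes_inlMat]; simp only [Matrix.mul_assoc]
    rw [e1, e2, Matrix.trace, Matrix.trace, mul_comm (∑ _, _) (∑ _, _), Finset.sum_mul_sum, hS]
    simp only [Finset.mul_sum, ← Finset.sum_sub_distrib]
    refine Finset.sum_congr rfl fun i _ => Finset.sum_congr rfl fun j _ => ?_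
    simp only [hf']
    rw [resolvent_derivative_entry, hV]
    simp only [Matrix.mul_smul, Matrix.smul_apply, smul_eq_mul, Matrix.diag_apply]
    ring
  have hSb : ∀ x, |S x| ≤ Fintype.card m * (a * b) ^ 2 := by
    intro x
    refine sum_abs_mul_entries_le _ _ ?_ ?_
    · have := l2_opNorm_mul_le (l2_opNorm_mul_le (l2_opNorm_mul_le hUn (norm_linRes_le (X x)))
        norm_inlMat_le) hA
      linarith
    · have := l2_opNorm_mul_le hB (l2_opNorm_mul_le (l2_opNorm_mul_le hr (norm_linRes_le (X x)))
        (l2_opNorm_mul_le norm_inlMat_le hΘA))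
      linarith
  have hSi : Integrable S P := by
    refine integrable_of_bounded (Continuous.measurable ?_) hSb
    refine continuous_finsetSum _ fun i _ => continuous_finsetSum _ fun j _ => ?_
    exact ((((continuous_const.matrix_mul hlin).matrix_mul continuous_const).matrix_mul
      continuous_const).matrix_elem j i).mul ((continuous_const.matrix_mul
      ((continuous_const.matrix_mul hlin).matrix_mul continuous_const)).matrix_elem j i)
  have hfi : ∀ i j, Integrable (fun x => x (i, j) * f i j x - f' i j x) P := fun i j =>
    (hst i j).1.sub (integrable_of_bounded (hfc' i j).measurable (hfb' i j))
  have hsum : ∀ x, ((Θ.trace - (Θ * gramRes (X x)ᵀ).trace)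
      - s ^ 2 * ((B * gramRes (X x) * Bᵀ).trace * (Aᵀ * gramRes (X x)ᵀ * (Θ * A)).trace))
      = (∑ i, ∑ j, (x (i, j) * f i j x - f' i j x)) - s ^ 2 * S x := by
    intro x
    simp only [Finset.sum_sub_distrib]
    rw [hid1, hid2]; ring
  simp only [hsum]
  rw [integral_sub (integrable_finsetSum _ fun i _ => integrable_finsetSum _ fun j _ => hfi i j)
    (hSi.const_mul _), integral_const_mul, integral_finsetSum _ fun i _ =>
    integrable_finsetSum _ fun j _ => hfi i j]
  simp_rw [integral_finsetSum _ fun j _ => hfi _ j]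
  refine (abs_sub _ _).trans ?_
  rw [add_comm]
  refine add_le_add ?_ ?_
  · rw [abs_mul, abs_of_nonneg (sq_nonneg s)]
    refine mul_le_mul_of_nonneg_left ?_ (sq_nonneg s)
    calc |∫ x, S x ∂P| ≤ ∫ x, |S x| ∂P := abs_integral_le_integral_abs
      _ ≤ ∫ _x, (Fintype.card m * (a * b) ^ 2 : ℝ) ∂P :=
          integral_mono hSi.abs (integrable_const _) hSb
      _ = _ := by simp
  · calc |∑ i, ∑ j, ∫ x, (x (i, j) * f i j x - f' i j x) ∂P|
        ≤ ∑ i, ∑ j, |∫ x, (x (i, j) * f i j x - f' i j x) ∂P| :=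
          (Finset.abs_sum_le_sum_abs _ _).trans
            (Finset.sum_le_sum fun i _ => Finset.abs_sum_le_sum_abs _ _)
      _ ≤ ∑ _i : m, ∑ _j : p, C * (M + 1) :=
          Finset.sum_le_sum fun i _ => Finset.sum_le_sum fun j _ => (hst i j).2
      _ = _ := by
          simp only [Finset.sum_const, Finset.card_univ, nsmul_eq_mul, hC]
          ring

end Stein

-- Resolvent mass carried by heavily weighted rows.

section SmallSingularValues

open scoped Matrix.Norms.L2Operator

variable {m p q : Type*} [Fintype m] [Fintype p] [Fintype q] [DecidableEq m] [DecidableEq p]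
  [DecidableEq q]

theorem norm_diagonal_le {d : m → ℝ} {L : ℝ} (hL : 0 ≤ L) (h : ∀ i, |d i| ≤ L) :
    ‖Matrix.diagonal d‖ ≤ L := by
  rw [Matrix.l2_opNorm_diagonal]
  exact (pi_norm_le_iff_of_nonneg hL).mpr fun i => by simpa using h i

theorem norm_diagonal_mul_le {d : m → ℝ} {L : ℝ} (hL : 0 ≤ L) (h : ∀ i, |d i| ≤ L)
    {O : Matrix m m ℝ} (hO : Oᵀ * O = 1) : ‖Matrix.diagonal d * O‖ ≤ L := by
  simpa using l2_opNorm_mul_le (norm_diagonal_le hL h) (l2_opNorm_le_one_of_transpose_mul_self hO)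

theorem norm_mul_diagonal_le {d : m → ℝ} {L : ℝ} (hL : 0 ≤ L) (h : ∀ i, |d i| ≤ L)
    {O : Matrix m m ℝ} (hO : Oᵀ * O = 1) : ‖O * Matrix.diagonal d‖ ≤ L := by
  simpa using l2_opNorm_mul_le (l2_opNorm_le_one_of_transpose_mul_self hO) (norm_diagonal_le hL h)

theorem gramRes_diag_eq_one {X : Matrix m p ℝ} {j : p} (h : ∀ i, X i j = 0) :
    gramRes X j j = 1 := by
  refine le_antisymm (gramRes_diag_le_one X j) ?_
  have hX : X *ᵥ Pi.single j 1 = 0 := by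
    ext i; simp [h i]
  have := le_gramRes_diag X j (Pi.single j 1)
  rw [hX] at this
  simpa using (by norm_num at this; linarith : 1 ≤ gramRes X j j)

variable {ν : Measure ℝ} {M : ℝ}

/-- Few singular values of `D O W O' 1_J` are small: the expected resolvent mass carried by the
large weights of `D` is of order `N / L`. -/
theorem integral_sum_gramRes_le (h : IsStandardized ν M) {O : Matrix m m ℝ} (hO : Oᵀ * O = 1)
    {O' : Matrix p p ℝ} (hO' : O'ᵀ * O' = 1) {I : Finset m} {J : Finset p}
    (hIJ : I.card = J.card) {L N c : ℝ} (hL : 1 ≤ L) (hN : 1 ≤ N) (hc : 0 ≤ c)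
    (hm : Fintype.card m ≤ c * N) (hp : Fintype.card p ≤ c * N) :
    ∫ x, ∑ i ∈ I, gramRes (sandwich (1 / √N)
        (Matrix.diagonal (fun i => if i ∈ I then L else 1) * O)
        (O' * Matrix.diagonal (fun j => if j ∈ J then 1 else 0)) x)ᵀ i i
        ∂Measure.pi (fun _ : m × p => ν)
      ≤ (1 + c) ^ 2 * (N / L)
        + (2 + c) * ((c * L ^ 2 + 8 * c ^ 2 * L ^ 3 * (M + 1)) * √N) := by
  have := h.prob
  have hM := h.nonneg
  set P := Measure.pi fun _ : m × p => ν with hP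
  set d : m → ℝ := fun i => if i ∈ I then L else 1 with hd
  set e : p → ℝ := fun j => if j ∈ J then 1 else 0 with he
  set A := Matrix.diagonal d * O with hA
  set B := O' * Matrix.diagonal e with hB
  set X := sandwich (1 / √N) A B with hX
  have hXc : Continuous X := continuous_sandwich _ _ _
  have hOO : O * Oᵀ = 1 := mul_eq_one_comm.mp hO
  set t : (m × p → ℝ) → ℝ := fun x => ∑ i ∈ I, gramRes (X x)ᵀ i i with ht
  set t2 : (m × p → ℝ) → ℝ := fun x => ∑ i ∈ Iᶜ, gramRes (X x)ᵀ i i with ht2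
  set τ : (m × p → ℝ) → ℝ := fun x => ∑ j ∈ J, gramRes (X x) j j with hτ
  have hgc : Continuous fun x => gramRes (X x)ᵀ :=
    continuous_gramRes.comp hXc.matrix_transpose
  have hgc' : Continuous fun x => gramRes (X x) := continuous_gramRes.comp hXc
  have htc : Continuous t := continuous_finsetSum _ fun i _ => hgc.matrix_elem i i
  have ht2c : Continuous t2 := continuous_finsetSum _ fun i _ => hgc.matrix_elem i i
  have hτc : Continuous τ := continuous_finsetSum _ fun i _ => hgc'.matrix_elem i i
  have ht0 : ∀ x, 0 ≤ t x := fun x => Finset.sum_nonneg fun i _ => gramRes_diag_nonneg _ _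
  have ht20 : ∀ x, 0 ≤ t2 x := fun x => Finset.sum_nonneg fun i _ => gramRes_diag_nonneg _ _
  have hτ0 : ∀ x, 0 ≤ τ x := fun x => Finset.sum_nonneg fun i _ => gramRes_diag_nonneg _ _
  have hcard : ∀ {k : Type _} [Fintype k] [DecidableEq k] (K : Finset k) (g : k → ℝ),
      (∀ i, g i ≤ 1) → ∑ i ∈ K, g i ≤ K.card := by
    intro k _ _ K g hg
    calc ∑ i ∈ K, g i ≤ ∑ _i ∈ K, (1 : ℝ) := Finset.sum_le_sum fun i _ => hg i
      _ = K.card := by simp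
  have htI : ∀ x, t x ≤ I.card := fun x => hcard I _ fun i => gramRes_diag_le_one _ _
  have ht2I : ∀ x, t2 x ≤ (Iᶜ).card := fun x => hcard Iᶜ _ fun i => gramRes_diag_le_one _ _
  have hIm : (I.card : ℝ) ≤ Fintype.card m := by exact_mod_cast Finset.card_le_univ I
  have hIcm : ((Iᶜ).card : ℝ) = Fintype.card m - I.card := by
    rw [Finset.card_compl, Nat.cast_sub (Finset.card_le_univ I)]
  have hI0 : (0 : ℝ) ≤ I.card := Nat.cast_nonneg _
  -- the trace identity
  have hrel : ∀ x, τ x = t x + t2 x - Fintype.card m + I.card := by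
    intro x
    have h1 := trace_gramRes_transpose (X x)
    have h2 : (gramRes (X x)ᵀ).trace = t x + t2 x := by
      simp only [Matrix.trace, Matrix.diag, ht, ht2, Finset.sum_add_sum_compl]
    have h3 : (gramRes (X x)).trace = τ x + ∑ j ∈ Jᶜ, gramRes (X x) j j := by
      simp only [Matrix.trace, Matrix.diag, hτ, Finset.sum_add_sum_compl]
    have h4 : ∑ j ∈ Jᶜ, gramRes (X x) j j = Fintype.card p - J.card := by
      have : ∀ j ∈ Jᶜ, gramRes (X x) j j = 1 := by
        intro j hj
        refine gramRes_diag_eq_one fun i => ?_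
        have hj' : e j = 0 := by simp [he, Finset.mem_compl.mp hj]
        simp only [hX, sandwich, hB, ← Matrix.mul_assoc, Matrix.smul_apply, smul_eq_mul]
        rw [Matrix.mul_diagonal, hj']; simp
      rw [Finset.sum_congr rfl this, Finset.sum_const, Finset.card_compl, nsmul_eq_mul, mul_one,
        Nat.cast_sub (Finset.card_le_univ J)]
    rw [h2, h3, h4, ← hIJ] at h1
    linarith
  -- The equality of the cardinalities of `I` and `J` enters here: the row mass on `I` dominates the
  -- column mass on `J`, because the row mass off `I` is at most the number of such rows.
  have hτt : ∀ x, τ x ≤ t x := fun x => by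
    have := hrel x; have := ht2I x; rw [hIcm] at this; linarith
  -- integration by parts with a diagonal test matrix
  set E := c * L ^ 2 + 8 * c ^ 2 * L ^ 3 * (M + 1) with hE
  have hE0 : 0 ≤ E := by positivity
  -- The integration by parts error has two sources: a bounded term, and about N² entries with error
  -- N^(-3/2) each. Both fit into `E * √N`.
  have hN0 : 0 < N := by linarith
  have hsN : 1 ≤ √N := by rw [Real.le_sqrt' one_pos]; simpa using hN
  have hsq : √N * √N = N := Real.mul_self_sqrt hN0.le
  have herr : (1 / √N) ^ 2 * (Fintype.card m * (L * 1) ^ 2)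
      + Fintype.card m * Fintype.card p * (8 * (1 / √N * L * 1) ^ 3 * (M + 1)) ≤ E * √N := by
    have e1 : (1 / √N) ^ 2 * (Fintype.card m * (L * 1) ^ 2) ≤ c * L ^ 2 * √N := by
      have : (1 / √N) ^ 2 = 1 / N := by rw [div_pow, one_pow, sq, hsq]
      rw [this]
      calc 1 / N * (Fintype.card m * (L * 1) ^ 2) ≤ 1 / N * (c * N * (L * 1) ^ 2) := by gcongr
        _ = c * L ^ 2 := by field_simp
        _ ≤ c * L ^ 2 * √N := le_mul_of_one_le_right (by positivity) hsN
    have e2 : Fintype.card m * Fintype.card p * (8 * (1 / √N * L * 1) ^ 3 * (M + 1))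
        ≤ 8 * c ^ 2 * L ^ 3 * (M + 1) * √N := by
      calc Fintype.card m * Fintype.card p * (8 * (1 / √N * L * 1) ^ 3 * (M + 1))
          ≤ (c * N) * (c * N) * (8 * (1 / √N * L * 1) ^ 3 * (M + 1)) := by gcongr
        _ = 8 * c ^ 2 * L ^ 3 * (M + 1) * (N * N / √N ^ 3) := by field_simp
        _ = 8 * c ^ 2 * L ^ 3 * (M + 1) * √N := by
            congr 1
            rw [div_eq_iff (by positivity)]
            calc N * N = (√N * √N) * (√N * √N) := by rw [hsq]
              _ = _ := by ring
    rw [hE, add_mul]; exact add_le_add e1 e2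
  have hdL : ∀ i, |d i| ≤ L := by
    intro i
    simp only [hd]; split_ifs
    · rw [abs_of_nonneg (by linarith)]
    · simpa using hL
  have he1 : ∀ j, |e j| ≤ 1 := by
    intro j; simp only [he]; split_ifs <;> simp
  have htrB : ∀ x, (B * gramRes (X x) * Bᵀ).trace = τ x := by
    intro x
    rw [hB, Matrix.transpose_mul, Matrix.diagonal_transpose, Matrix.trace_mul_comm]
    have : Matrix.diagonal e * O'ᵀ * (O' * Matrix.diagonal e * gramRes (X x))
        = Matrix.diagonal e * (Matrix.diagonal e * gramRes (X x)) := by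
      calc _ = Matrix.diagonal e * (O'ᵀ * O') * (Matrix.diagonal e * gramRes (X x)) := by
            simp only [Matrix.mul_assoc]
        _ = _ := by rw [hO', Matrix.mul_one]
    rw [this]
    simp only [Matrix.trace, Matrix.diag, Matrix.diagonal_mul, hτ, he]
    rw [← Finset.sum_subset (Finset.subset_univ J)]
    · exact Finset.sum_congr rfl fun j hj => by simp [hj]
    · intro j _ hj; simp [hj]
  have hstein : ∀ (K : Finset m) (w : ℝ), (∀ i ∈ K, d i = w) →
      |∫ x, ((K.card - ∑ i ∈ K, gramRes (X x)ᵀ i i)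
        - 1 / N * (τ x * (w ^ 2 * ∑ i ∈ K, gramRes (X x)ᵀ i i))) ∂P| ≤ E * √N := by
    intro K w hw
    set θ : m → ℝ := fun i => if i ∈ K then 1 else 0 with hθ
    have hθn : ‖Matrix.diagonal θ‖ ≤ 1 := norm_diagonal_le zero_le_one fun i => by
      simp only [hθ]; split_ifs <;> simp
    have key := (abs_integral_resolvent_stein_le h (s := 1 / √N) (by positivity)
      (norm_diagonal_mul_le (by linarith) hdL hO) (norm_mul_diagonal_le zero_le_one he1 hO')
      hθn).trans herr
    rw [← hA, ← hB, ← hX] at key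
    have hpt : ∀ x, ((K.card - ∑ i ∈ K, gramRes (X x)ᵀ i i)
        - 1 / N * (τ x * (w ^ 2 * ∑ i ∈ K, gramRes (X x)ᵀ i i)))
        = ((Matrix.diagonal θ).trace - (Matrix.diagonal θ * gramRes (X x)ᵀ).trace)
        - (1 / √N) ^ 2 * ((B * gramRes (X x) * Bᵀ).trace
          * (Aᵀ * gramRes (X x)ᵀ * (Matrix.diagonal θ * A)).trace) := by
      intro x
      have e1 : (Matrix.diagonal θ).trace = K.card := by simp [hθ]
      have e2 : (Matrix.diagonal θ * gramRes (X x)ᵀ).trace = ∑ i ∈ K, gramRes (X x)ᵀ i i := by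
        simp only [Matrix.trace, Matrix.diag, Matrix.diagonal_mul, hθ, ite_mul, one_mul, zero_mul,
          Finset.sum_ite_mem, Finset.univ_inter]
      have e3 : (1 / √N) ^ 2 = 1 / N := by rw [div_pow, one_pow, sq, hsq]
      rw [e1, e2, e3, htrB]
      have : (Aᵀ * gramRes (X x)ᵀ * (Matrix.diagonal θ * A)).trace
          = (Matrix.diagonal d * gramRes (X x)ᵀ * Matrix.diagonal θ * Matrix.diagonal d).trace := by
        rw [hA, Matrix.transpose_mul, Matrix.diagonal_transpose]
        calc _ = (Oᵀ * (Matrix.diagonal d * gramRes (X x)ᵀ * Matrix.diagonal θ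
              * Matrix.diagonal d * O)).trace := by simp only [Matrix.mul_assoc]
          _ = _ := by
              rw [Matrix.trace_mul_comm, Matrix.mul_assoc, hOO, Matrix.mul_one]
      have e4 : (Matrix.diagonal d * gramRes (X x)ᵀ * Matrix.diagonal θ * Matrix.diagonal d).trace
          = w ^ 2 * ∑ i ∈ K, gramRes (X x)ᵀ i i := by
        simp only [Matrix.trace, Matrix.diag, Matrix.mul_diagonal, Matrix.diagonal_mul, hθ]
        rw [Finset.mul_sum, ← Finset.sum_subset (Finset.subset_univ K)]
        · refine Finset.sum_congr rfl fun i hi => ?_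
          rw [hw i hi, if_pos hi]; ring
        · intro i _ hi; rw [if_neg hi]; ring
      rw [this, e4]
    simp only [hpt]
    exact key
  -- The same identity is tested on the heavy rows (weight `L`) and on the light rows (weight 1):
  -- the first controls E[τ t], the second compares E t with E τ.
  have hs1 := hstein I L fun i hi => by simp [hd, hi]
  have hs2 := hstein Iᶜ 1
    fun i hi => by simp [hd, Finset.mem_compl.mp hi]
  -- integrability
  have it : Integrable t P := integrable_of_bounded htc.measurable fun x => by
    rw [abs_of_nonneg (ht0 x)]; exact htI x
  have it2 : Integrable t2 P := integrable_of_bounded ht2c.measurable fun x => by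
    rw [abs_of_nonneg (ht20 x)]; exact ht2I x
  have iτ : Integrable τ P := integrable_of_bounded hτc.measurable fun x => by
    rw [abs_of_nonneg (hτ0 x)]; exact (hτt x).trans (htI x)
  have itτ : Integrable (fun x => τ x * t x) P :=
    integrable_of_bounded (hτc.mul htc).measurable fun x => by
      rw [abs_of_nonneg (mul_nonneg (hτ0 x) (ht0 x))]
      exact mul_le_mul ((hτt x).trans (htI x)) (htI x) (ht0 x) hI0
  have it2τ : Integrable (fun x => τ x * t2 x) P :=
    integrable_of_bounded (hτc.mul ht2c).measurable fun x => by
      rw [abs_of_nonneg (mul_nonneg (hτ0 x) (ht20 x))]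
      exact mul_le_mul ((hτt x).trans (htI x)) (ht2I x) (ht20 x) hI0
  have hL0 : 0 < L := by linarith
  have k1 : ∫ x, τ x * t x ∂P ≤ N / L ^ 2 * (c * N + E * √N) := by
    have e1 : ∫ x, ((I.card - t x) - 1 / N * (τ x * (L ^ 2 * t x))) ∂P
        = I.card - ∫ x, t x ∂P - L ^ 2 / N * ∫ x, τ x * t x ∂P := by
      have : ∀ x, ((I.card - t x) - 1 / N * (τ x * (L ^ 2 * t x)))
          = (I.card - t x) - L ^ 2 / N * (τ x * t x) := fun x => by ring
      simp only [this]
      have i3 : Integrable (fun x => (I.card : ℝ) - t x) P := (integrable_const _).sub it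
      rw [integral_sub i3 (itτ.const_mul _), integral_sub (integrable_const _) it,
        integral_const_mul]
      simp
    have e2 := (abs_le.mp hs1).1
    rw [e1] at e2
    have e3 : 0 ≤ ∫ x, t x ∂P := integral_nonneg ht0
    have e4 : L ^ 2 / N * ∫ x, τ x * t x ∂P ≤ c * N + E * √N := by linarith
    calc ∫ x, τ x * t x ∂P = N / L ^ 2 * (L ^ 2 / N * ∫ x, τ x * t x ∂P) := by field_simp
      _ ≤ _ := mul_le_mul_of_nonneg_left e4 (by positivity)
  -- τ² ≤ τ t turns `k1` into a second moment bound, and 2τ ≤ (L/N) τ² + N/L, balanced at τ = N/L,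
  -- gives a first moment of order N/L.
  have k2 : ∫ x, τ x ∂P ≤ (c + 1) / 2 * (N / L) + E * √N / 2 := by
    have e1 : ∫ x, τ x ∂P ≤ ∫ x, (L / (2 * N) * (τ x * t x) + N / (2 * L)) ∂P := by
      refine integral_mono iτ ((itτ.const_mul _).add (integrable_const _)) fun x => ?_
      have a1 : τ x * τ x ≤ τ x * t x := mul_le_mul_of_nonneg_left (hτt x) (hτ0 x)
      have a2 : L / (2 * N) * (τ x * τ x) ≤ L / (2 * N) * (τ x * t x) :=
        mul_le_mul_of_nonneg_left a1 (by positivity)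
      have a3 : L / (2 * N) * (τ x * τ x) + N / (2 * L) - τ x
          = (L * τ x - N) ^ 2 / (2 * N * L) := by field_simp; ring
      have a4 : 0 ≤ (L * τ x - N) ^ 2 / (2 * N * L) := by positivity
      show τ x ≤ L / (2 * N) * (τ x * t x) + N / (2 * L)
      linarith
    rw [integral_add (itτ.const_mul _) (integrable_const _), integral_const_mul] at e1
    have e2 := mul_le_mul_of_nonneg_left k1 (show 0 ≤ L / (2 * N) by positivity)
    have e3 : L / (2 * N) * (N / L ^ 2 * (c * N + E * √N))
        = c / 2 * (N / L) + E * √N / 2 / L := by field_simp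
    have e4 : E * √N / 2 / L ≤ E * √N / 2 := div_le_self (by positivity) hL
    have e5 : ∫ _x, N / (2 * L) ∂P = 1 / 2 * (N / L) := by simp; field_simp
    rw [e5] at e1
    linarith
  -- On the light rows the deficit is `t - τ`, by the trace identity, and integration by parts
  -- equates its mean with E[τ t2] / N up to error, where `t2 ≤ c * N`.
  have k3 : ∫ x, t x ∂P ≤ (1 + c) * ∫ x, τ x ∂P + E * √N := by
    have e0 : ∀ x, (((Iᶜ).card - t2 x) - 1 / N * (τ x * (1 ^ 2 * t2 x)))
        = (t x - τ x) - 1 / N * (τ x * t2 x) := fun x => by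
      rw [hIcm]; have := hrel x; rw [one_pow, one_mul]; linarith
    have e1 : ∫ x, (((Iᶜ).card - t2 x) - 1 / N * (τ x * (1 ^ 2 * t2 x))) ∂P
        = ∫ x, t x ∂P - ∫ x, τ x ∂P - 1 / N * ∫ x, τ x * t2 x ∂P := by
      simp only [e0]
      have i3 : Integrable (fun x => t x - τ x) P := it.sub iτ
      rw [integral_sub i3 (it2τ.const_mul _), integral_sub it iτ, integral_const_mul]
    have e2 := (abs_le.mp hs2).2
    rw [e1] at e2
    have e3 : ∫ x, τ x * t2 x ∂P ≤ c * N * ∫ x, τ x ∂P := by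
      rw [← integral_const_mul]
      refine integral_mono it2τ (iτ.const_mul _) fun x => ?_
      have : t2 x ≤ c * N := by have := ht2I x; rw [hIcm] at this; linarith
      show τ x * t2 x ≤ c * N * τ x
      rw [mul_comm (c * N)]
      exact mul_le_mul_of_nonneg_left this (hτ0 x)
    have e4 : 1 / N * ∫ x, τ x * t2 x ∂P ≤ c * ∫ x, τ x ∂P := by
      calc _ ≤ 1 / N * (c * N * ∫ x, τ x ∂P) := mul_le_mul_of_nonneg_left e3 (by positivity)
        _ = _ := by field_simp
    linarith
  have k4 := mul_le_mul_of_nonneg_left k2 (show 0 ≤ 1 + c by linarith)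
  have hNL : 0 ≤ N / L := by positivity
  have hEN : 0 ≤ E * √N := by positivity
  have k5 : 0 ≤ (1 + c) * ((c + 1) / 2 * (N / L)) := by positivity
  have k6 : 0 ≤ (1 + c) * (E * √N) := by positivity
  have k7 : (1 + c) * ((c + 1) / 2 * (N / L)) * 2 = (1 + c) ^ 2 * (N / L) := by ring
  linarith

end SmallSingularValues

-- Truncating the weights, and universality for balanced weights.

section Truncation

variable {m p q : Type*} [Fintype m] [Fintype p] [Fintype q] [DecidableEq m] [DecidableEq p]
  [DecidableEq q]

theorem dotProduct_self_mono {x y : p → ℝ} (h : ∀ i, |x i| ≤ |y i|) : x ⬝ᵥ x ≤ y ⬝ᵥ y :=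
  Finset.sum_le_sum fun i _ => by
    have := mul_self_le_mul_self (abs_nonneg _) (h i)
    rwa [abs_mul_abs_self, abs_mul_abs_self] at this

/-- The condition on `y` keeps the vector fed to `Y` unchanged, so only the outer weights change. -/
theorem weighted_mulVec_le {Y : Matrix m p ℝ} {d d' : m → ℝ} {e e' : p → ℝ} {x y : p → ℝ}
    (hd : ∀ i, |d' i| ≤ |d i|) (hxy : ∀ j, e' j * y j = e j * x j) :
    ((Matrix.diagonal d' * Y * Matrix.diagonal e') *ᵥ y)
        ⬝ᵥ ((Matrix.diagonal d' * Y * Matrix.diagonal e') *ᵥ y)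
      ≤ ((Matrix.diagonal d * Y * Matrix.diagonal e) *ᵥ x)
        ⬝ᵥ ((Matrix.diagonal d * Y * Matrix.diagonal e) *ᵥ x) := by
  have e1 : ∀ (d : m → ℝ) (e x : p → ℝ),
      (Matrix.diagonal d * Y * Matrix.diagonal e) *ᵥ x
        = fun i => d i * (Y *ᵥ fun j => e j * x j) i := by
    intro d e x
    have : Matrix.diagonal e *ᵥ x = fun j => e j * x j := by
      ext j; rw [Matrix.mulVec_diagonal]
    rw [← Matrix.mulVec_mulVec, ← Matrix.mulVec_mulVec, this]
    ext i; rw [Matrix.mulVec_diagonal]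
  rw [e1, e1, funext hxy]
  refine dotProduct_self_mono fun i => ?_
  rw [abs_mul, abs_mul]
  exact mul_le_mul_of_nonneg_right (hd i) (abs_nonneg _)

/-- Comparison of resolvents of weighted matrices: shrinking the outer weights, and enlarging the
inner weights away from `j`, increases the diagonal entry `j`. -/
theorem gramRes_weighted_diag_le {Y : Matrix m p ℝ} {d d' : m → ℝ} {e e' : p → ℝ}
    (hd : ∀ i, |d' i| ≤ |d i|) (c : p → ℝ) (hc : ∀ j, |c j| ≤ 1) (he : ∀ j, e' j * c j = e j)
    {j : p} (hj : c j = 1) :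
    gramRes (Matrix.diagonal d * Y * Matrix.diagonal e) j j
      ≤ gramRes (Matrix.diagonal d' * Y * Matrix.diagonal e') j j := by
  refine gramRes_diag_le fun x => ⟨fun k => c k * x k, by simp [hj], add_le_add ?_ ?_⟩
  · refine dotProduct_self_mono fun i => ?_
    rw [abs_mul]
    exact mul_le_of_le_one_left (abs_nonneg _) (hc i)
  · exact weighted_mulVec_le hd fun k => by rw [← mul_assoc, he]

/-- Pathwise effect of truncating the row weights at level `L`. -/
theorem trace_gramRes_truncate (Y : Matrix m p ℝ) {u : m → ℝ} {v : p → ℝ} (hu : ∀ i, 0 ≤ u i)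
    {L : ℝ} (hL : 1 ≤ L) {I : Finset m} (hI : ∀ i, i ∈ I ↔ 1 < u i) {J : Finset p}
    (hJ : ∀ j ∈ J, 1 ≤ v j) :
    |(gramRes (Matrix.diagonal u * Y * Matrix.diagonal v)).trace
      - (gramRes (Matrix.diagonal (fun i => min (u i) L) * Y * Matrix.diagonal v)).trace|
      ≤ ∑ i ∈ I, gramRes (Matrix.diagonal (fun i => if i ∈ I then L else 1) * Y
        * Matrix.diagonal (fun j => if j ∈ J then (1 : ℝ) else 0))ᵀ i i := by
  have hL0 : 0 < L := by linarith
  have hmin0 : ∀ i, 0 ≤ min (u i) L := fun i => le_min (hu i) hL0.le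
  have htr : ∀ (d : m → ℝ) (e : p → ℝ), (Matrix.diagonal d * Y * Matrix.diagonal e)ᵀ
      = Matrix.diagonal e * Yᵀ * Matrix.diagonal d := by
    intro d e; simp [Matrix.transpose_mul, Matrix.mul_assoc]
  have hle : (gramRes (Matrix.diagonal u * Y * Matrix.diagonal v)).trace
      ≤ (gramRes (Matrix.diagonal (fun i => min (u i) L) * Y * Matrix.diagonal v)).trace := by
    refine Finset.sum_le_sum fun j _ => ?_
    refine gramRes_weighted_diag_le (fun i => ?_) (fun _ => 1) (by simp) (by simp) rfl
    rw [abs_of_nonneg (hmin0 i), abs_of_nonneg (hu i)]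
    exact min_le_left _ _
  rw [abs_of_nonpos (sub_nonpos.mpr hle), neg_sub]
  have t1 := trace_gramRes_transpose (Matrix.diagonal u * Y * Matrix.diagonal v)
  have t2 := trace_gramRes_transpose
    (Matrix.diagonal (fun i => min (u i) L) * Y * Matrix.diagonal v)
  -- The column-side comparison fixes the sign of the difference. Passing to the transposes indexes
  -- the same difference by rows, where only rows with `u i > L` can contribute positively.
  have t3 : (gramRes (Matrix.diagonal (fun i => min (u i) L) * Y * Matrix.diagonal v)ᵀ).trace
      - (gramRes (Matrix.diagonal u * Y * Matrix.diagonal v)ᵀ).trace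
      ≤ ∑ i ∈ I, gramRes (Matrix.diagonal (fun i => if i ∈ I then L else 1) * Y
        * Matrix.diagonal (fun j => if j ∈ J then (1 : ℝ) else 0))ᵀ i i := by
    simp only [htr]
    simp only [Matrix.trace, Matrix.diag]
    rw [← Finset.sum_sub_distrib, ← Finset.sum_filter_add_sum_filter_not Finset.univ (· ∈ I),
      Finset.filter_mem_eq_inter, Finset.univ_inter]
    -- Truncation shrinks the inner weights by the factor min(1, L / u k), which is 1 at an
    -- untruncated index `i`, so its diagonal entry cannot grow.
    have hout : ∀ i, u i ≤ L →
        gramRes (Matrix.diagonal v * Yᵀ * Matrix.diagonal (fun i => min (u i) L)) i i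
          ≤ gramRes (Matrix.diagonal v * Yᵀ * Matrix.diagonal u) i i := by
      intro i hi
      refine gramRes_weighted_diag_le (fun _ => le_rfl) (fun k => if u k ≤ L then 1 else L / u k)
        (fun k => ?_) (fun k => ?_) (by simp [hi])
      · split_ifs with hk
        · simp
        · have : 0 < u k := hL0.trans (not_le.mp hk)
          rw [abs_of_nonneg (by positivity)]
          exact (div_le_one this).mpr (not_le.mp hk).le
      · show u k * (if u k ≤ L then 1 else L / u k) = min (u k) L
        split_ifs with hk
        · rw [min_eq_left hk, mul_one]
        · have : 0 < u k := hL0.trans (not_le.mp hk)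
          rw [min_eq_right (not_le.mp hk).le]
          field_simp
    have hneg : ∑ i with i ∉ I,
        (gramRes (Matrix.diagonal v * Yᵀ * Matrix.diagonal (fun i => min (u i) L)) i i
          - gramRes (Matrix.diagonal v * Yᵀ * Matrix.diagonal u) i i) ≤ 0 := by
      refine Finset.sum_nonpos fun i hi => ?_
      have : ¬ 1 < u i := by rw [← hI]; exact (Finset.mem_filter.mp hi).2
      linarith [hout i ((not_lt.mp this).trans hL)]
    have hpos : ∑ i ∈ I,
        (gramRes (Matrix.diagonal v * Yᵀ * Matrix.diagonal (fun i => min (u i) L)) i i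
          - gramRes (Matrix.diagonal v * Yᵀ * Matrix.diagonal u) i i)
        ≤ ∑ i ∈ I, gramRes (Matrix.diagonal (fun j => if j ∈ J then (1 : ℝ) else 0) * Yᵀ
          * Matrix.diagonal (fun i => if i ∈ I then L else 1)) i i := by
      refine Finset.sum_le_sum fun i hi => ?_
      by_cases h : u i ≤ L
      · linarith [hout i h, gramRes_diag_nonneg (Matrix.diagonal (fun j => if j ∈ J then (1 : ℝ) else 0)
          * Yᵀ * Matrix.diagonal (fun i => if i ∈ I then L else 1)) i]
      · have h0 := gramRes_diag_nonneg (Matrix.diagonal v * Yᵀ * Matrix.diagonal u) i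
        refine (sub_le_self _ h0).trans ?_
        -- On a truncated row the subtracted entry is dropped. Outer weights fall to the indicator
        -- of `J`, inner weights rise to `L` on `I` and 1 off `I`; the multiplier is 1 at `i`
        -- because its weight is already `L`.
        refine gramRes_weighted_diag_le (fun j => ?_)
          (fun k => if k ∈ I then min (u k) L / L else min (u k) L) (fun k => ?_) (fun k => ?_) ?_
        · split_ifs with hj
          · rw [abs_one]; exact (hJ j hj).trans (le_abs_self _)
          · simp
        · split_ifs with hk
          · rw [abs_of_nonneg (div_nonneg (hmin0 k) hL0.le)]
            exact (div_le_one hL0).mpr (min_le_right _ _)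
          · rw [abs_of_nonneg (hmin0 k)]
            rw [hI] at hk
            exact (min_le_left _ _).trans (not_lt.mp hk)
        · show (if k ∈ I then L else 1) * (if k ∈ I then min (u k) L / L else min (u k) L) = _
          split_ifs with hk
          · field_simp
          · rw [one_mul]
        · simp only [hi, if_true, min_eq_right (not_le.mp h).le]
          exact div_self hL0.ne'
    linarith
  linarith

theorem sandwich_eq_weighted (s : ℝ) (u : m → ℝ) (v : p → ℝ) (O : Matrix m m ℝ)
    (O' : Matrix p p ℝ) (x : m × p → ℝ) :
    sandwich s (Matrix.diagonal u * O) (O' * Matrix.diagonal v) x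
      = Matrix.diagonal u * (s • (O * Matrix.of (fun i j => x (i, j)) * O'))
        * Matrix.diagonal v := by
  simp only [sandwich, Matrix.mul_smul, Matrix.smul_mul, Matrix.mul_assoc]

theorem sandwich_transpose (s : ℝ) (A : Matrix m m ℝ) (B : Matrix p p ℝ) (x : m × p → ℝ) :
    (sandwich s A B x)ᵀ = sandwich s Bᵀ Aᵀ (fun k => x k.swap) := by
  simp only [sandwich, Matrix.transpose_smul, Matrix.transpose_mul, Matrix.mul_assoc]
  rfl

theorem integral_pi_swap (ν : Measure ℝ) [IsProbabilityMeasure ν] (F : (p × m → ℝ) → ℝ) :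
    ∫ x, F (fun k => x k.swap) ∂Measure.pi (fun _ : m × p => ν)
      = ∫ x, F x ∂Measure.pi (fun _ : p × m => ν) := by
  have h := measurePreserving_piCongrLeft (fun _ : p × m => ν) (Equiv.prodComm m p)
  rw [← h.integral_comp' F]
  rfl

theorem integrable_trace_gramRes_sandwich (μ : Measure (m × p → ℝ)) [IsProbabilityMeasure μ]
    (s : ℝ) (A : Matrix m m ℝ) (B : Matrix p p ℝ) :
    Integrable (fun x => (gramRes (sandwich s A B x)).trace) μ := by
  refine integrable_of_bounded (C := Fintype.card p)
    ((continuous_gramRes.comp (continuous_sandwich s A B)).matrix_trace.measurable) fun x => ?_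
  rw [abs_of_nonneg (trace_gramRes_nonneg _)]
  exact trace_gramRes_le _

variable {ν : Measure ℝ} {M : ℝ}

/-- The bound of `integral_sum_gramRes_le`. -/
noncomputable def truncationError (c M L N : ℝ) : ℝ :=
  (1 + c) ^ 2 * (N / L) + (2 + c) * ((c * L ^ 2 + 8 * c ^ 2 * L ^ 3 * (M + 1)) * √N)

/-- The count hypothesis provides columns `J` of weight at least 1, exactly as many as the rows of
weight above 1, as `integral_sum_gramRes_le` requires. -/
theorem abs_integral_truncate_le (h : IsStandardized ν M) {O : Matrix m m ℝ} (hO : Oᵀ * O = 1)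
    {O' : Matrix p p ℝ} (hO' : O'ᵀ * O' = 1) {u : m → ℝ} {v : p → ℝ} (hu : ∀ i, 0 ≤ u i)
    (huv : (Finset.univ.filter fun i => 1 < u i).card
      ≤ (Finset.univ.filter fun j => 1 ≤ v j).card) {L N c : ℝ} (hL : 1 ≤ L) (hN : 1 ≤ N)
    (hc : 0 ≤ c) (hm : Fintype.card m ≤ c * N) (hp : Fintype.card p ≤ c * N) :
    |∫ x, (gramRes (sandwich (1 / √N) (Matrix.diagonal u * O) (O' * Matrix.diagonal v) x)).trace
        ∂Measure.pi (fun _ : m × p => ν)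
      - ∫ x, (gramRes (sandwich (1 / √N) (Matrix.diagonal (fun i => min (u i) L) * O)
        (O' * Matrix.diagonal v) x)).trace ∂Measure.pi (fun _ : m × p => ν)|
      ≤ truncationError c M L N := by
  have := h.prob
  obtain ⟨J, hJ, hcard⟩ := Finset.exists_subset_card_eq huv
  refine le_trans ?_ (integral_sum_gramRes_le h hO hO' hcard.symm hL hN hc hm hp)
  rw [← integral_sub (integrable_trace_gramRes_sandwich _ _ _ _)
    (integrable_trace_gramRes_sandwich _ _ _ _)]
  refine abs_integral_le_integral_abs.trans (integral_mono
    ((integrable_trace_gramRes_sandwich _ _ _ _).sub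
      (integrable_trace_gramRes_sandwich _ _ _ _)).abs ?_ fun x => ?_)
  · refine integrable_finsetSum _ fun i _ => integrable_of_bounded (C := 1)
      (((continuous_gramRes.comp (continuous_sandwich _ _ _).matrix_transpose).matrix_elem
        i i).measurable) fun x => ?_
    rw [abs_of_nonneg (gramRes_diag_nonneg _ _)]
    exact gramRes_diag_le_one _ _
  · simp only [sandwich_eq_weighted]
    exact trace_gramRes_truncate _ hu hL (by simp) fun j hj => (Finset.mem_filter.mp (hJ hj)).2

/-- Transposition exchanges row and column weights at the cost of a constant that cancels in
differences; column truncation thus follows from row truncation. -/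
theorem integral_trace_gramRes_swap (ν : Measure ℝ) [IsProbabilityMeasure ν] (s : ℝ)
    (A : Matrix m m ℝ) (B : Matrix p p ℝ) :
    ∫ x, (gramRes (sandwich s A B x)).trace ∂Measure.pi (fun _ : m × p => ν)
      = ∫ x, (gramRes (sandwich s Bᵀ Aᵀ x)).trace ∂Measure.pi (fun _ : p × m => ν)
        + (Fintype.card p - Fintype.card m) := by
  rw [← integral_pi_swap ν fun x => (gramRes (sandwich s Bᵀ Aᵀ x)).trace]
  have : ∀ x : m × p → ℝ, (gramRes (sandwich s A B x)).trace
      = (gramRes (sandwich s Bᵀ Aᵀ fun k => x k.swap)).trace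
        + (Fintype.card p - Fintype.card m) := by
    intro x
    rw [← sandwich_transpose]
    linarith [trace_gramRes_transpose (sandwich s A B x)]
  simp only [this]
  have hi : Integrable (fun x : m × p → ℝ => (gramRes (sandwich s Bᵀ Aᵀ fun k => x k.swap)).trace)
      (Measure.pi fun _ : m × p => ν) := by
    have : ∀ x : m × p → ℝ, (gramRes (sandwich s Bᵀ Aᵀ fun k => x k.swap)).trace
        = (gramRes (sandwich s A B x)).trace - (Fintype.card p - Fintype.card m) := by
      intro x
      rw [← sandwich_transpose]
      linarith [trace_gramRes_transpose (sandwich s A B x)]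
    simp only [this]
    exact (integrable_trace_gramRes_sandwich _ _ _ _).sub (integrable_const _)
  rw [integral_add hi (integrable_const _)]
  simp

/-- Truncating the column weights at level `L`. -/
theorem abs_integral_truncate_right_le (h : IsStandardized ν M) {O : Matrix m m ℝ}
    (hO : Oᵀ * O = 1) {O' : Matrix p p ℝ} (hO' : O'ᵀ * O' = 1) {u : m → ℝ} {v : p → ℝ}
    (hv : ∀ i, 0 ≤ v i) (huv : (Finset.univ.filter fun j => 1 < v j).card
      ≤ (Finset.univ.filter fun i => 1 ≤ u i).card) {L N c : ℝ} (hL : 1 ≤ L) (hN : 1 ≤ N)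
    (hc : 0 ≤ c) (hm : Fintype.card m ≤ c * N) (hp : Fintype.card p ≤ c * N) :
    |∫ x, (gramRes (sandwich (1 / √N) (Matrix.diagonal u * O) (O' * Matrix.diagonal v) x)).trace
        ∂Measure.pi (fun _ : m × p => ν)
      - ∫ x, (gramRes (sandwich (1 / √N) (Matrix.diagonal u * O)
        (O' * Matrix.diagonal fun j => min (v j) L) x)).trace ∂Measure.pi (fun _ : m × p => ν)|
      ≤ truncationError c M L N := by
  have := h.prob
  have hT : (Oᵀ)ᵀ * Oᵀ = 1 := by
    rw [Matrix.transpose_transpose]; exact mul_eq_one_comm.mp hO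
  have hT' : (O'ᵀ)ᵀ * O'ᵀ = 1 := by
    rw [Matrix.transpose_transpose]; exact mul_eq_one_comm.mp hO'
  have key := abs_integral_truncate_le h hT' hT hv huv hL hN hc hp hm
  rw [integral_trace_gramRes_swap, integral_trace_gramRes_swap ν _ _
    (O' * Matrix.diagonal fun j => min (v j) L)]
  simp only [Matrix.transpose_mul, Matrix.diagonal_transpose]
  rw [add_sub_add_right_eq_sub]
  exact key

open scoped Matrix.Norms.L2Operator in
/-- Universality of the mean resolvent trace for bounded dependency matrices. -/
theorem abs_integral_sub_le_of_bounded {ν1 ν2 : Measure ℝ} (h1 : IsStandardized ν1 M)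
    (h2 : IsStandardized ν2 M) {A : Matrix m m ℝ} {B : Matrix p p ℝ} {L N c : ℝ}
    (hA : ‖A‖ ≤ L) (hB : ‖B‖ ≤ L) (hN : 1 ≤ N) (hc : 0 ≤ c)
    (hm : Fintype.card m ≤ c * N) (hp : Fintype.card p ≤ c * N) :
    |∫ x, (gramRes (sandwich (1 / √N) A B x)).trace ∂Measure.pi (fun _ : m × p => ν1)
      - ∫ x, (gramRes (sandwich (1 / √N) A B x)).trace ∂Measure.pi (fun _ : m × p => ν2)|
      ≤ 16 * c ^ 2 * L ^ 6 * M * √N := by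
  have hM := h1.nonneg
  have hN0 : 0 < N := by linarith
  have hsN : 0 < √N := Real.sqrt_pos.mpr hN0
  have hsq : √N * √N = N := Real.mul_self_sqrt hN0.le
  have hL : 0 ≤ L := (norm_nonneg _).trans hA
  have key := lindeberg_replacement (ι := m × p) h1 h2
    (F := fun x => (gramRes (sandwich (1 / √N) A B x)).trace)
    ((continuous_gramRes.comp (continuous_sandwich _ A B)).matrix_trace.measurable)
    (b := Fintype.card p) (C := (2 * (1 / √N * (L * L))) ^ 3)
    (fun x => by rw [abs_of_nonneg (trace_gramRes_nonneg _)]; exact trace_gramRes_le _)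
    (by positivity) fun x k => by
      obtain ⟨c0, c1, c2, hexp⟩ := trace_gramRes_expansion (1 / √N) A B k.1 k.2
        (sandwich (1 / √N) A B (Function.update x (k.1, k.2) 0))
      refine ⟨c0, c1, c2, fun z => ?_⟩
      have e := sandwich_update (1 / √N) A B x k.1 k.2 z
      rw [Prod.mk.eta] at e hexp
      simp only [e]
      refine (hexp z).trans ?_
      rw [abs_of_nonneg (by positivity : (0 : ℝ) ≤ 1 / √N)]
      gcongr
  refine key.trans ?_
  rw [Fintype.card_prod, Nat.cast_mul]
  -- At most (c N)² replacements, each of order N^(-3/2).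
  calc (Fintype.card m * Fintype.card p : ℝ) * ((2 * (1 / √N * (L * L))) ^ 3 * (2 * M))
      ≤ (c * N) * (c * N) * ((2 * (1 / √N * (L * L))) ^ 3 * (2 * M)) := by gcongr
    _ = 16 * c ^ 2 * L ^ 6 * M * (N * N / √N ^ 3) := by field_simp; ring
    _ = _ := by
        congr 1
        rw [div_eq_iff (by positivity)]
        calc N * N = (√N * √N) * (√N * √N) := by rw [hsq]
          _ = _ := by ring

/-- The total comparison error for arbitrary dependency matrices, with a free truncation
level `L`. -/
noncomputable def comparisonError (c M L N : ℝ) : ℝ :=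
  4 * truncationError c M L N + 16 * c ^ 2 * L ^ 6 * M * √N

/-- Rows, then columns, are truncated under each of the two laws, which accounts for the four
truncation errors; Lindeberg replacement compares the truncated models. Since `L ≥ 1`, row
truncation does not alter which weights reach 1, so the second count survives. -/
theorem abs_integral_sub_le_of_balanced {ν1 ν2 : Measure ℝ} (h1 : IsStandardized ν1 M)
    (h2 : IsStandardized ν2 M) {O : Matrix m m ℝ}
    (hO : Oᵀ * O = 1) {O' : Matrix p p ℝ} (hO' : O'ᵀ * O' = 1) {u : m → ℝ} {v : p → ℝ}
    (hu : ∀ i, 0 ≤ u i) (hv : ∀ i, 0 ≤ v i)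
    (huv : (Finset.univ.filter fun i => 1 < u i).card
      ≤ (Finset.univ.filter fun j => 1 ≤ v j).card)
    (hvu : (Finset.univ.filter fun j => 1 < v j).card
      ≤ (Finset.univ.filter fun i => 1 ≤ u i).card) {L N c : ℝ} (hL : 1 ≤ L) (hN : 1 ≤ N)
    (hc : 0 ≤ c) (hm : Fintype.card m ≤ c * N) (hp : Fintype.card p ≤ c * N) :
    |∫ x, (gramRes (sandwich (1 / √N) (Matrix.diagonal u * O) (O' * Matrix.diagonal v) x)).trace
        ∂Measure.pi (fun _ : m × p => ν1)
      - ∫ x, (gramRes (sandwich (1 / √N) (Matrix.diagonal u * O) (O' * Matrix.diagonal v) x)).trace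
        ∂Measure.pi (fun _ : m × p => ν2)| ≤ comparisonError c M L N := by
  have hvu' : (Finset.univ.filter fun j => 1 < v j).card
      ≤ (Finset.univ.filter fun i => 1 ≤ min (u i) L).card := by
    simpa [hL] using hvu
  have hL0 : 0 ≤ L := by linarith
  have a1 := abs_integral_truncate_le h1 hO hO' hu huv hL hN hc hm hp
  have a2 := abs_integral_truncate_le h2 hO hO' hu huv hL hN hc hm hp
  have b1 := abs_integral_truncate_right_le h1 hO hO' hv hvu' hL hN hc hm hp
  have b2 := abs_integral_truncate_right_le h2 hO hO' hv hvu' hL hN hc hm hp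
  have hbd : ∀ w : ℝ, 0 ≤ w → |min w L| ≤ L := fun w hw => by
    rw [abs_of_nonneg (le_min hw hL0)]; exact min_le_right _ _
  have d := abs_integral_sub_le_of_bounded h1 h2
    (norm_diagonal_mul_le hL0 (fun i => hbd (u i) (hu i)) hO)
    (norm_mul_diagonal_le hL0 (fun i => hbd (v i) (hv i)) hO') hN hc hm hp
  rw [comparisonError]
  rw [abs_le] at *
  constructor <;> linarith [a1.1, a1.2, a2.1, a2.2, b1.1, b1.2, b2.1, b2.2, d.1, d.2]

end Truncation

-- Balancing the weights; the mean trace for arbitrary dependency matrices.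

section Comparison

variable {m p q : Type*} [Fintype m] [Fintype p] [Fintype q] [DecidableEq m] [DecidableEq p]
  [DecidableEq q]

/-- Two families of weights can be rescaled against each other so that they have the same number
of large members. -/
theorem exists_balancing_scale (u : m → ℝ) (v : p → ℝ) : ∃ κ : ℝ, 0 < κ ∧
    (Finset.univ.filter fun i => 1 < κ * u i).card
      ≤ (Finset.univ.filter fun j => κ ≤ v j).card ∧
    (Finset.univ.filter fun j => κ < v j).card
      ≤ (Finset.univ.filter fun i => 1 ≤ κ * u i).card := by
  -- `T` consists of the positive scales satisfying the second inequality. At its infimum the first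
  -- inequality should start to hold; the strict and weak signs are arranged to absorb ties there.
  set T : Set ℝ := {κ | 0 < κ ∧ (Finset.univ.filter fun j => κ < v j).card
    ≤ (Finset.univ.filter fun i => 1 ≤ κ * u i).card} with hT
  have hbelow : BddBelow T := ⟨0, fun κ h => h.1.le⟩
  have hne : T.Nonempty := by
    refine ⟨1 + ∑ j, |v j|, by positivity, ?_⟩
    have : (Finset.univ.filter fun j => 1 + ∑ j, |v j| < v j) = ∅ := by
      refine Finset.filter_eq_empty_iff.mpr fun j _ => not_lt.mpr ?_
      have := Finset.single_le_sum (f := fun j => |v j|) (fun i _ => abs_nonneg _)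
        (Finset.mem_univ j)
      linarith [le_abs_self (v j)]
    rw [this]; simp
  set c := sInf T with hc
  have hc0 : 0 ≤ c := le_csInf hne fun κ h => h.1.le
  -- Finitely many strict inequalities persist near `c`, so counts at `c` can be compared with
  -- counts at nearby scales on either side.
  have hnear : ∀ᶠ κ in 𝓝 c, (∀ j, c < v j → κ < v j) ∧ (∀ j, v j < c → v j < κ) ∧
      (∀ i, c * u i < 1 → κ * u i < 1) ∧ (∀ i, 1 < c * u i → 1 < κ * u i) := by
    have hcont : ∀ i, Tendsto (fun κ : ℝ => κ * u i) (𝓝 c) (𝓝 (c * u i)) := fun i =>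
      (continuous_id.mul continuous_const).tendsto c
    refine (eventually_all.mpr fun j => ?_).and ((eventually_all.mpr fun j => ?_).and
      ((eventually_all.mpr fun i => ?_).and (eventually_all.mpr fun i => ?_)))
    · by_cases h : c < v j
      · filter_upwards [eventually_lt_nhds h] with κ hκ _ using hκ
      · exact Eventually.of_forall fun κ h' => absurd h' h
    · by_cases h : v j < c
      · filter_upwards [eventually_gt_nhds h] with κ hκ _ using hκ
      · exact Eventually.of_forall fun κ h' => absurd h' h
    · by_cases h : c * u i < 1
      · filter_upwards [(hcont i).eventually (eventually_lt_nhds h)] with κ hκ _ using hκ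
      · exact Eventually.of_forall fun κ h' => absurd h' h
    · by_cases h : 1 < c * u i
      · filter_upwards [(hcont i).eventually (eventually_gt_nhds h)] with κ hκ _ using hκ
      · exact Eventually.of_forall fun κ h' => absurd h' h
  obtain ⟨ε, hε, hball⟩ := Metric.eventually_nhds_iff.mp hnear
  obtain ⟨κ, hκT, hκ⟩ := exists_lt_of_csInf_lt hne (show sInf T < c + ε by rw [← hc]; linarith)
  have hcκ : c ≤ κ := csInf_le hbelow hκT
  have hκnear := hball (y := κ) (by rw [Real.dist_eq, abs_of_nonneg (by linarith)]; linarith)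
  rcases hc0.eq_or_lt with h0 | hpos
  -- If the infimum is 0, a small member of `T` works: every `κ * u i` is then below 1 and the first
  -- count is empty.
  · refine ⟨κ, hκT.1, ?_, hκT.2⟩
    have : (Finset.univ.filter fun i => 1 < κ * u i) = ∅ :=
      Finset.filter_eq_empty_iff.mpr fun i _ => not_lt.mpr
        (hκnear.2.2.1 i (by rw [← h0]; simp)).le
    rw [this]; simp
  · refine ⟨c, hpos, ?_, ?_⟩
    -- A positive scale just below the infimum lies outside `T`; the failure of the second
    -- inequality there yields the first one at `c`.
    · set κ' := max (c / 2) (c - ε / 2) with hκ'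
      have h1 : κ' < c := max_lt (by linarith) (by linarith)
      have h2 : 0 < κ' := lt_max_of_lt_left (by linarith)
      have h3 := hball (y := κ') (by
        rw [Real.dist_eq, abs_of_neg (by linarith)]
        linarith [le_max_right (c / 2) (c - ε / 2)])
      have h4 : κ' ∉ T := fun h => not_lt.mpr (csInf_le hbelow h) h1
      have h5 : (Finset.univ.filter fun i => 1 ≤ κ' * u i).card
          < (Finset.univ.filter fun j => κ' < v j).card := by
        by_contra hcon
        exact h4 ⟨h2, not_lt.mp hcon⟩
      calc _ ≤ (Finset.univ.filter fun i => 1 ≤ κ' * u i).card :=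
            Finset.card_le_card (Finset.monotone_filter_right _ fun i _ hi => (h3.2.2.2 i hi).le)
        _ ≤ _ := h5.le
        _ ≤ _ := Finset.card_le_card (Finset.monotone_filter_right _ fun j _ hj => by
            by_contra hcon
            exact absurd (h3.2.1 j (not_le.mp hcon)) (not_lt.mpr hj.le))
    · calc _ ≤ (Finset.univ.filter fun j => κ < v j).card :=
            Finset.card_le_card (Finset.monotone_filter_right _ fun j _ hj => hκnear.1 j hj)
        _ ≤ _ := hκT.2
        _ ≤ _ := Finset.card_le_card (Finset.monotone_filter_right _ fun i _ hi => by
            by_contra hcon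
            exact absurd (hκnear.2.2.1 i (not_le.mp hcon)) (not_lt.mpr hi))

/-- Every Gram matrix is the Gram matrix of a weighted orthogonal matrix. -/
theorem exists_gram_eq (A : Matrix q m ℝ) : ∃ (u : m → ℝ) (O : Matrix m m ℝ), (∀ i, 0 ≤ u i) ∧
    Oᵀ * O = 1 ∧ Aᵀ * A = (Matrix.diagonal u * O)ᵀ * (Matrix.diagonal u * O) := by
  have hps : (Aᵀ * A).PosSemidef := by
    have := Matrix.posSemidef_conjTranspose_mul_self A
    rwa [Matrix.conjTranspose_eq_transpose_of_trivial] at this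
  have hH := hps.isHermitian
  set V : Matrix m m ℝ := hH.eigenvectorUnitary.1 with hV
  have hV1 : V * Vᵀ = 1 := by
    have := Unitary.coe_mul_star_self hH.eigenvectorUnitary
    rwa [Unitary.coe_star, Matrix.star_eq_conjTranspose,
      Matrix.conjTranspose_eq_transpose_of_trivial] at this
  refine ⟨fun i => √(hH.eigenvalues i), Vᵀ, fun i => Real.sqrt_nonneg _, by
    rw [Matrix.transpose_transpose]; exact hV1, ?_⟩
  have hspec := hH.spectral_theorem
  rw [Unitary.conjStarAlgAut_apply, Matrix.star_eq_conjTranspose,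
    Matrix.conjTranspose_eq_transpose_of_trivial, ← hV] at hspec
  refine hspec.trans ?_
  have : (Matrix.diagonal fun i => √(hH.eigenvalues i)) * Matrix.diagonal (fun i => √(hH.eigenvalues i))
      = Matrix.diagonal (RCLike.ofReal ∘ hH.eigenvalues : m → ℝ) := by
    rw [Matrix.diagonal_mul_diagonal]
    congr 1
    ext i
    simp [Real.mul_self_sqrt (hps.eigenvalues_nonneg i)]
  rw [← this]
  simp only [Matrix.transpose_mul, Matrix.transpose_transpose, Matrix.diagonal_transpose,
    Matrix.mul_assoc]

theorem trace_gramRes_congr_left {X : Matrix m p ℝ} {Y : Matrix q p ℝ} (h : Xᵀ * X = Yᵀ * Y) :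
    (gramRes X).trace = (gramRes Y).trace := by
  rw [gramRes, gramRes, h]

theorem trace_gramRes_congr_right {X : Matrix m p ℝ} {Y : Matrix m p ℝ}
    (h : X * Xᵀ = Y * Yᵀ) : (gramRes X).trace = (gramRes Y).trace := by
  have h1 := trace_gramRes_transpose X
  have h2 := trace_gramRes_transpose Y
  have h3 : gramRes Xᵀ = gramRes Yᵀ := by
    rw [gramRes, gramRes, Matrix.transpose_transpose, Matrix.transpose_transpose, h]
  rw [h3] at h1
  linarith

/-- `A` enters the Gram matrix only through `Aᵀ * A`; after transposition `B` enters only through `B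
* Bᵀ`. This permits replacing both by weighted orthogonal matrices. -/
theorem trace_gramRes_sandwich_congr (s : ℝ) {A A' : Matrix m m ℝ} {B B' : Matrix p p ℝ}
    (hA : Aᵀ * A = A'ᵀ * A') (hB : B * Bᵀ = B' * B'ᵀ) (x : m × p → ℝ) :
    (gramRes (sandwich s A B x)).trace = (gramRes (sandwich s A' B' x)).trace := by
  set W : Matrix m p ℝ := Matrix.of fun i j => x (i, j) with hW
  have e1 : (gramRes (sandwich s A B x)).trace = (gramRes (sandwich s A' B x)).trace := by
    refine trace_gramRes_congr_left ?_
    have : ∀ A : Matrix m m ℝ, (sandwich s A B x)ᵀ * sandwich s A B x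
        = (s * s) • (Bᵀ * (Wᵀ * (Aᵀ * A * (W * B)))) := by
      intro A
      simp only [sandwich, ← hW, Matrix.transpose_smul, Matrix.transpose_mul, Matrix.smul_mul,
        Matrix.mul_smul, smul_smul, Matrix.mul_assoc]
    rw [this, this, hA]
  have e2 : (gramRes (sandwich s A' B x)).trace = (gramRes (sandwich s A' B' x)).trace := by
    refine trace_gramRes_congr_right ?_
    have : ∀ B : Matrix p p ℝ, sandwich s A' B x * (sandwich s A' B x)ᵀ
        = (s * s) • (A' * (W * (B * Bᵀ * (Wᵀ * A'ᵀ)))) := by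
      intro B
      simp only [sandwich, ← hW, Matrix.transpose_smul, Matrix.transpose_mul, Matrix.smul_mul,
        Matrix.mul_smul, smul_smul, Matrix.mul_assoc]
    rw [this, this, hB]
  rw [e1, e2]

/-- Universality of the mean resolvent trace, uniformly over all dependency matrices. -/
theorem abs_integral_trace_sub_le {ν1 ν2 : Measure ℝ} {M : ℝ} (h1 : IsStandardized ν1 M)
    (h2 : IsStandardized ν2 M) (A : Matrix m m ℝ) (B : Matrix p p ℝ) {L N c : ℝ} (hL : 1 ≤ L)
    (hN : 1 ≤ N) (hc : 0 ≤ c) (hm : Fintype.card m ≤ c * N) (hp : Fintype.card p ≤ c * N) :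
    |∫ x, (gramRes (sandwich (1 / √N) A B x)).trace ∂Measure.pi (fun _ : m × p => ν1)
      - ∫ x, (gramRes (sandwich (1 / √N) A B x)).trace ∂Measure.pi (fun _ : m × p => ν2)|
      ≤ comparisonError c M L N := by
  obtain ⟨u, O, hu, hO, hA⟩ := exists_gram_eq A
  obtain ⟨v, O', hv, hO', hB⟩ := exists_gram_eq Bᵀ
  obtain ⟨κ, hκ, huv, hvu⟩ := exists_balancing_scale u v
  have hO'T : (O'ᵀ)ᵀ * O'ᵀ = 1 := by
    rw [Matrix.transpose_transpose]; exact mul_eq_one_comm.mp hO'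
  -- Balancing is free: the factor κ on the rows cancels κ⁻¹ on the columns.
  have hscale : ∀ x : m × p → ℝ, sandwich (1 / √N) (Matrix.diagonal u * O)
      (O'ᵀ * Matrix.diagonal v) x
      = sandwich (1 / √N) (Matrix.diagonal (fun i => κ * u i) * O)
        (O'ᵀ * Matrix.diagonal fun j => κ⁻¹ * v j) x := by
    intro x
    have d1 : (Matrix.diagonal fun i => κ * u i) = κ • Matrix.diagonal u := by
      rw [← Matrix.diagonal_smul]; rfl
    have d2 : (Matrix.diagonal fun j => κ⁻¹ * v j) = κ⁻¹ • Matrix.diagonal v := by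
      rw [← Matrix.diagonal_smul]; rfl
    rw [d1, d2, sandwich, sandwich]
    simp only [Matrix.smul_mul, Matrix.mul_smul, smul_smul]
    congr 1
    field_simp
  have hpt : ∀ x : m × p → ℝ, (gramRes (sandwich (1 / √N) A B x)).trace
      = (gramRes (sandwich (1 / √N) (Matrix.diagonal (fun i => κ * u i) * O)
        (O'ᵀ * Matrix.diagonal fun j => κ⁻¹ * v j) x)).trace := by
    intro x
    rw [← hscale]
    refine trace_gramRes_sandwich_congr _ hA ?_ x
    rw [Matrix.transpose_transpose] at hB
    rw [hB]
    simp [Matrix.transpose_mul]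
  simp only [hpt]
  have hiff : ∀ j, κ⁻¹ * v j = v j / κ := fun j => by rw [mul_comm, div_eq_mul_inv]
  refine abs_integral_sub_le_of_balanced h1 h2 hO hO'T (fun i => mul_nonneg hκ.le (hu i))
    (fun j => mul_nonneg (inv_nonneg.mpr hκ.le) (hv j)) ?_ ?_ hL hN hc hm hp
  · simpa only [hiff, one_le_div hκ] using huv
  · simpa only [hiff, one_lt_div hκ] using hvu

theorem tendsto_comparisonError (c M : ℝ) {ε : ℝ} (hc : 0 ≤ c) (hε : 0 < ε) :
    ∃ L : ℝ, 1 ≤ L ∧ ∀ᶠ N : ℝ in atTop, comparisonError c M L N ≤ ε * N := by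
  -- `L` makes the N/L term at most half of `ε * N`, independently of `N`; with `L` fixed, the rest
  -- is a constant times `√N`.
  set L := max 1 (4 * (1 + c) ^ 2 * (2 / ε)) with hL
  have hL1 : 1 ≤ L := le_max_left _ _
  refine ⟨L, hL1, ?_⟩
  set K := 4 * ((2 + c) * (c * L ^ 2 + 8 * c ^ 2 * L ^ 3 * (M + 1))) + 16 * c ^ 2 * L ^ 6 * M
    with hK
  have h1 : Tendsto (fun N : ℝ => √N) atTop atTop := Real.tendsto_sqrt_atTop
  filter_upwards [h1.eventually_ge_atTop (K * (2 / ε)), eventually_ge_atTop 0] with N hN hN0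
  have hs : √N * √N = N := Real.mul_self_sqrt hN0
  have e : comparisonError c M L N = 4 * (1 + c) ^ 2 * (N / L) + K * √N := by
    rw [comparisonError, truncationError, hK]; ring
  have e1 : 4 * (1 + c) ^ 2 * (N / L) ≤ ε / 2 * N := by
    have : 4 * (1 + c) ^ 2 * (2 / ε) ≤ L := le_max_right _ _
    have h2 : 4 * (1 + c) ^ 2 ≤ ε / 2 * L := by
      calc 4 * (1 + c) ^ 2 = ε / 2 * (4 * (1 + c) ^ 2 * (2 / ε)) := by field_simp
        _ ≤ _ := mul_le_mul_of_nonneg_left this (by positivity)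
    calc 4 * (1 + c) ^ 2 * (N / L) ≤ ε / 2 * L * (N / L) :=
          mul_le_mul_of_nonneg_right h2 (by positivity)
      _ = ε / 2 * N := by field_simp
  have e2 : K * √N ≤ ε / 2 * N := by
    have : K ≤ ε / 2 * √N := by
      calc K = ε / 2 * (K * (2 / ε)) := by field_simp
        _ ≤ _ := mul_le_mul_of_nonneg_left hN (by positivity)
    calc K * √N ≤ ε / 2 * √N * √N := mul_le_mul_of_nonneg_right this (Real.sqrt_nonneg _)
      _ = ε / 2 * N := by rw [mul_assoc, hs]
  rw [e]; linarith

end Comparison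

-- Variance bound from bounded differences.

section BoundedDifferences

variable {E : Type*} [MeasurableSpace E]

theorem integral_pi_cons (μ : Measure E) [IsProbabilityMeasure μ] (n : ℕ)
    {F : (Fin (n + 1) → E) → ℝ} (hF : Integrable F (Measure.pi fun _ => μ)) :
    Integrable (fun w : E × (Fin n → E) => F (Fin.cons w.1 w.2))
      (μ.prod (Measure.pi fun _ => μ)) ∧
    ∫ x, F x ∂Measure.pi (fun _ : Fin (n + 1) => μ)
      = ∫ x, ∫ a, F (Fin.cons a x) ∂μ ∂Measure.pi (fun _ : Fin n => μ) := by
  have h := (measurePreserving_piFinSuccAbove (fun _ : Fin (n + 1) => μ) 0).symm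
  have e : ∀ w : E × (Fin n → E),
      (MeasurableEquiv.piFinSuccAbove (fun _ : Fin (n + 1) => E) 0).symm w = Fin.cons w.1 w.2 := by
    intro w
    exact Fin.insertNth_zero' w.1 w.2
  have h1 := h.integrable_comp_of_integrable hF
  have h2 := h.integral_comp' F
  simp only [Function.comp_def, e] at h1 h2
  refine ⟨h1, ?_⟩
  rw [← h2]
  exact integral_prod_symm _ h1

/-- A function of i.i.d. variables with bounded differences has small variance. -/
theorem integral_sub_sq_le_of_bounded_diff (μ : Measure E) [IsProbabilityMeasure μ] {b c : ℝ}
    (n : ℕ) {f : (Fin n → E) → ℝ} (hf : Measurable f) (hb : ∀ x, |f x| ≤ b)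
    (hd : ∀ x i y, |f (Function.update x i y) - f x| ≤ c) :
    ∫ x, (f x - ∫ x', f x' ∂Measure.pi (fun _ : Fin n => μ)) ^ 2
      ∂Measure.pi (fun _ : Fin n => μ) ≤ n * c ^ 2 := by
  induction n with
  | zero =>
    have : ∀ x, f x = f (fun i => i.elim0) := fun x => by congr 1; ext i; exact i.elim0
    simp [this]
  | succ n ih =>
    set P := Measure.pi fun _ : Fin n => μ with hP
    set P' := Measure.pi fun _ : Fin (n + 1) => μ with hP'
    set g : (Fin n → E) → ℝ := fun x => ∫ a, f (Fin.cons a x) ∂μ with hg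
    have hcons : Measurable fun w : E × (Fin n → E) => (Fin.cons w.1 w.2 : Fin (n + 1) → E) := by
      rw [measurable_pi_iff]
      intro i
      refine Fin.cases ?_ (fun j => ?_) i
      · simpa using measurable_fst
      · simp only [Fin.cons_succ]; fun_prop
    have hfc : Measurable fun w : E × (Fin n → E) => f (Fin.cons w.1 w.2) := hf.comp hcons
    have hfx : ∀ x : Fin n → E, Measurable fun a : E => f (Fin.cons a x) := fun x =>
      hfc.comp measurable_prodMk_right
    have hfi : ∀ x, Integrable (fun a : E => f (Fin.cons a x)) μ := fun x =>
      integrable_of_bounded (hfx x) fun a => hb _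
    have hgm : Measurable g := by
      have : StronglyMeasurable fun w : (Fin n → E) × E => f (Fin.cons w.2 w.1) :=
        (hfc.comp measurable_swap).stronglyMeasurable
      exact this.integral_prod_right'.measurable
    have hgb : ∀ x, |g x| ≤ b := fun x => by
      refine abs_integral_le_integral_abs.trans ?_
      calc ∫ a, |f (Fin.cons a x)| ∂μ ≤ ∫ _a, b ∂μ :=
            integral_mono (hfi x).abs (integrable_const b) fun a => hb _
        _ = b := by simp
    have hgd : ∀ x i y, |g (Function.update x i y) - g x| ≤ c := by
      intro x i y
      simp only [hg]
      rw [← integral_sub (hfi _) (hfi _)]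
      refine abs_integral_le_integral_abs.trans ?_
      calc _ ≤ ∫ _a, c ∂μ := by
            refine integral_mono ((hfi _).sub (hfi _)).abs (integrable_const c) fun a => ?_
            show |f (Fin.cons a (Function.update x i y)) - f (Fin.cons a x)| ≤ c
            rw [Fin.cons_update]
            exact hd _ _ _
        _ = c := by simp
    have hmean : ∫ x, f x ∂P' = ∫ x, g x ∂P :=
      (integral_pi_cons μ n (integrable_of_bounded hf hb)).2
    have hih := ih hgm hgb hgd
    set e := ∫ x, g x ∂P with he
    rw [hmean]
    have hb0 : ∀ {α : Type _} (F : α → ℝ) (r : ℝ), (∀ x, |F x| ≤ b) → ∀ x,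
        |(F x - r) ^ 2| ≤ (b + |r|) ^ 2 := by
      intro α F r hF x
      rw [abs_pow]
      exact pow_le_pow_left₀ (abs_nonneg _)
        ((abs_sub _ _).trans (add_le_add (hF x) le_rfl)) 2
    have i1 : Integrable (fun x => (f x - e) ^ 2) P' :=
      integrable_of_bounded ((hf.sub_const e).pow_const 2) (hb0 f e hb)
    have i3 : Integrable (fun x => (g x - e) ^ 2) P :=
      integrable_of_bounded ((hgm.sub_const e).pow_const 2) (hb0 g e hgb)
    obtain ⟨i2, h2⟩ := integral_pi_cons μ n i1
    rw [h2]
    -- Variance decomposition over the first coordinate: the cross term vanishes because `g x` is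
    -- the conditional mean, and the conditional deviation is at most `c`.
    have hin : ∀ x, ∫ a, (f (Fin.cons a x) - e) ^ 2 ∂μ ≤ c ^ 2 + (g x - e) ^ 2 := by
      intro x
      have hdev : ∀ a, |f (Fin.cons a x) - g x| ≤ c := by
        intro a
        have : f (Fin.cons a x) - g x = ∫ a', (f (Fin.cons a x) - f (Fin.cons a' x)) ∂μ := by
          rw [integral_sub (integrable_const _) (hfi x)]; simp [hg]
        rw [this]
        refine abs_integral_le_integral_abs.trans ?_
        calc _ ≤ ∫ _a, c ∂μ := by
              refine integral_mono ((integrable_const _).sub (hfi x)).abs (integrable_const c)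
                fun a' => ?_
              show |f (Fin.cons a x) - f (Fin.cons a' x)| ≤ c
              have h3 := hd (Fin.cons a' x) 0 a
              rwa [Fin.update_cons_zero] at h3
          _ = c := by simp
      have hsq : ∀ a, (f (Fin.cons a x) - e) ^ 2
          = (f (Fin.cons a x) - g x) ^ 2 + (2 * (g x - e) * (f (Fin.cons a x) - g x)
            + (g x - e) ^ 2) := fun a => by ring
      have j1 : Integrable (fun a => (f (Fin.cons a x) - g x) ^ 2) μ :=
        integrable_of_bounded (((hfx x).sub_const _).pow_const 2) (hb0 _ _ fun a => hb _)
      have j2 : Integrable (fun a => 2 * (g x - e) * (f (Fin.cons a x) - g x)) μ :=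
        ((hfi x).sub (integrable_const _)).const_mul _
      simp only [hsq]
      have j5 : Integrable (fun a => 2 * (g x - e) * (f (Fin.cons a x) - g x)
        + (g x - e) ^ 2) μ := j2.add (integrable_const _)
      rw [integral_add j1 j5, integral_add j2 (integrable_const _),
        integral_const_mul, integral_sub (hfi x) (integrable_const _)]
      have j3 : ∫ a, (f (Fin.cons a x) - g x) ^ 2 ∂μ ≤ c ^ 2 := by
        calc _ ≤ ∫ _a, c ^ 2 ∂μ := integral_mono j1 (integrable_const _) fun a => by
              show (f (Fin.cons a x) - g x) ^ 2 ≤ c ^ 2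
              rw [← sq_abs]; exact pow_le_pow_left₀ (abs_nonneg _) (hdev a) 2
          _ = c ^ 2 := by simp
      have j4 : ∫ a, f (Fin.cons a x) ∂μ = g x := rfl
      simp only [integral_const, probReal_univ, one_smul, j4, sub_self, mul_zero, zero_add]
      linarith
    calc _ ≤ ∫ x, (c ^ 2 + (g x - e) ^ 2) ∂P :=
          integral_mono i2.integral_prod_right ((integrable_const _).add i3) hin
      _ = c ^ 2 + ∫ x, (g x - e) ^ 2 ∂P := by
          rw [integral_add (integrable_const _) i3]; simp
      _ ≤ _ := by push_cast; linarith

end BoundedDifferences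

-- Second moments of linear and quadratic forms.

section QuadraticForms

variable {ι κ : Type*} [Fintype ι] [DecidableEq ι] [Fintype κ] [DecidableEq κ]

/-- Laws with mean zero, second moment `w` and fourth moment at most `K w²`. -/
structure IsCenteredFourth (ν : Measure ℝ) (w K : ℝ) : Prop where
  prob : IsProbabilityMeasure ν
  integrable_four : Integrable (fun z : ℝ => z ^ 4) ν
  mean : ∫ z, z ∂ν = 0
  var : ∫ z, z ^ 2 ∂ν = w
  fourth : ∫ z, z ^ 4 ∂ν ≤ K * w ^ 2

namespace IsCenteredFourth

variable {ν : Measure ℝ} {w K : ℝ}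

theorem integrable_sq (h : IsCenteredFourth ν w K) : Integrable (fun z : ℝ => z ^ 2) ν := by
  have := h.prob
  refine ((integrable_const (1 : ℝ)).add h.integrable_four).mono'
    (by fun_prop) (Eventually.of_forall fun z => ?_)
  show ‖z ^ 2‖ ≤ 1 + z ^ 4
  rw [Real.norm_eq_abs, abs_of_nonneg (sq_nonneg z)]
  nlinarith [sq_nonneg (z ^ 2 - 1), sq_nonneg (z ^ 2)]

theorem integrable_id (h : IsCenteredFourth ν w K) : Integrable (fun z : ℝ => z) ν := by
  have := h.prob
  refine ((integrable_const (1 : ℝ)).add h.integrable_sq).mono'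
    (by fun_prop) (Eventually.of_forall fun z => ?_)
  show ‖z‖ ≤ 1 + z ^ 2
  rw [Real.norm_eq_abs]
  nlinarith [sq_nonneg (|z| - 1), sq_abs z, abs_nonneg z]

theorem nonneg (h : IsCenteredFourth ν w K) : 0 ≤ w := by
  rw [← h.var]; exact integral_nonneg fun z => sq_nonneg z

theorem integrable_eval_four (h : IsCenteredFourth ν w K) (a : ι) :
    Integrable (fun x : ι → ℝ => x a ^ 4) (Measure.pi fun _ => ν) :=
  have := h.prob
  (measurePreserving_eval (fun _ : ι => ν) a).integrable_comp_of_integrable h.integrable_four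

theorem integrable_eval_sq (h : IsCenteredFourth ν w K) (a : ι) :
    Integrable (fun x : ι → ℝ => x a ^ 2) (Measure.pi fun _ => ν) :=
  have := h.prob
  (measurePreserving_eval (fun _ : ι => ν) a).integrable_comp_of_integrable h.integrable_sq

theorem memLp_mul_eval (h : IsCenteredFourth ν w K) (a b : ι) :
    MemLp (fun x : ι → ℝ => x a * x b) 2 (Measure.pi fun _ => ν) := by
  have := h.prob
  rw [memLp_two_iff_integrable_sq (by fun_prop)]
  refine ((h.integrable_eval_four a).add (h.integrable_eval_four b)).mono'
    (by fun_prop) (Eventually.of_forall fun x => ?_)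
  show ‖(x a * x b) ^ 2‖ ≤ x a ^ 4 + x b ^ 4
  rw [Real.norm_eq_abs, abs_of_nonneg (sq_nonneg _)]
  nlinarith [sq_nonneg (x a ^ 2 - x b ^ 2), sq_nonneg (x a ^ 2), sq_nonneg (x b ^ 2)]

theorem memLp_eval (h : IsCenteredFourth ν w K) (a : ι) :
    MemLp (fun x : ι → ℝ => x a) 2 (Measure.pi fun _ => ν) := by
  rw [memLp_two_iff_integrable_sq (measurable_pi_apply a).aestronglyMeasurable]
  exact h.integrable_eval_sq a

theorem memLp_linear (h : IsCenteredFourth ν w K) (l : ι → ℝ) (s : Finset ι) :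
    MemLp (fun x : ι → ℝ => ∑ a ∈ s, l a * x a) 2 (Measure.pi fun _ => ν) :=
  memLp_finsetSum s fun a _ => (h.memLp_eval a).const_mul (l a)

theorem memLp_quadratic (h : IsCenteredFourth ν w K) (Q : Matrix ι ι ℝ) (s : Finset ι) (c : ℝ) :
    MemLp (fun x : ι → ℝ => (∑ a ∈ s, ∑ b ∈ s, Q a b * (x a * x b)) - c) 2
      (Measure.pi fun _ => ν) :=
  have := h.prob
  (memLp_finsetSum s fun a _ => memLp_finsetSum s fun b _ =>
    (h.memLp_mul_eval a b).const_mul (Q a b)).sub (memLp_const c)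

theorem integral_linear_sq (h : IsCenteredFourth ν w K) (l : ι → ℝ) (s : Finset ι) :
    ∫ x, (∑ a ∈ s, l a * x a) ^ 2 ∂Measure.pi (fun _ : ι => ν) = w * ∑ a ∈ s, l a ^ 2 := by
  have := h.prob
  induction s using Finset.induction_on with
  | empty => simp
  | insert a s ha ih =>
    have hi := (h.memLp_linear l (insert a s)).integrable_sq
    have hupd : Function.update (fun _ : ι => ν) a ν = fun _ => ν := Function.update_eq_self a _
    rw [← hupd] at hi
    have e := integral_pi_update (fun _ : ι => ν) a ν hi
    rw [hupd] at e
    rw [e]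
    have hin : ∀ x : ι → ℝ, ∫ z, (∑ b ∈ insert a s, l b * Function.update x a z b) ^ 2 ∂ν
        = l a ^ 2 * w + (∑ b ∈ s, l b * x b) ^ 2 := by
      intro x
      have e1 : ∀ z, (∑ b ∈ insert a s, l b * Function.update x a z b) ^ 2
          = l a ^ 2 * z ^ 2 + (2 * l a * (∑ b ∈ s, l b * x b)) * z
            + (∑ b ∈ s, l b * x b) ^ 2 := by
        intro z
        rw [Finset.sum_insert ha, Function.update_self]
        have : ∑ b ∈ s, l b * Function.update x a z b = ∑ b ∈ s, l b * x b :=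
          Finset.sum_congr rfl fun b hb => by
            rw [Function.update_of_ne (by rintro rfl; exact ha hb)]
        rw [this]; ring
      simp only [e1]
      have j1 : Integrable (fun z : ℝ => l a ^ 2 * z ^ 2) ν := h.integrable_sq.const_mul _
      have j2 : Integrable (fun z : ℝ => (2 * l a * (∑ b ∈ s, l b * x b)) * z) ν :=
        h.integrable_id.const_mul _
      have j3 : Integrable (fun z : ℝ => l a ^ 2 * z ^ 2
        + (2 * l a * (∑ b ∈ s, l b * x b)) * z) ν := j1.add j2
      rw [integral_add j3 (integrable_const _), integral_add j1 j2, integral_const_mul,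
        integral_const_mul, h.mean, h.var]
      simp
    simp only [hin]
    rw [integral_add (integrable_const _) (h.memLp_linear l s).integrable_sq, ih,
      Finset.sum_insert ha]
    simp; ring

/-- Variance bound for a quadratic form in i.i.d. variables. -/
theorem integral_quadratic_sub_sq_le (h : IsCenteredFourth ν w K) {Q : Matrix ι ι ℝ}
    (hQ : Qᵀ = Q) (hK : 0 ≤ K) (s : Finset ι) :
    ∫ x, ((∑ a ∈ s, ∑ b ∈ s, Q a b * (x a * x b)) - w * ∑ a ∈ s, Q a a) ^ 2
      ∂Measure.pi (fun _ : ι => ν)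
      ≤ (2 * K + 4) * w ^ 2 * ∑ a ∈ s, ∑ b ∈ s, Q a b ^ 2 := by
  have := h.prob
  have hw := h.nonneg
  have hsymm : ∀ a b, Q a b = Q b a := fun a b => by
    conv_lhs => rw [← hQ]
    rfl
  induction s using Finset.induction_on with
  | empty => simp
  | insert a s ha ih =>
    have hi := (h.memLp_quadratic Q (insert a s) (w * ∑ a ∈ insert a s, Q a a)).integrable_sq
    have hupd : Function.update (fun _ : ι => ν) a ν = fun _ => ν := Function.update_eq_self a _
    rw [← hupd] at hi
    have e := integral_pi_update (fun _ : ι => ν) a ν hi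
    have hi2 := hi
    rw [← map_update_pi] at hi2
    have hi3 := (hi2.comp_measurable (measurable_update_pair a)).integral_prod_left
    rw [hupd] at e
    rw [e]
    set q : (ι → ℝ) → ℝ := fun x => (∑ a ∈ s, ∑ b ∈ s, Q a b * (x a * x b)) - w * ∑ a ∈ s, Q a a
      with hq
    set l : (ι → ℝ) → ℝ := fun x => ∑ b ∈ s, Q a b * x b with hl
    have hin : ∀ x : ι → ℝ, ∫ z, ((∑ c ∈ insert a s, ∑ b ∈ insert a s,
        Q c b * (Function.update x a z c * Function.update x a z b))
          - w * ∑ c ∈ insert a s, Q c c) ^ 2 ∂ν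
        ≤ q x ^ 2 + (2 * K * w ^ 2 * Q a a ^ 2 + 8 * w * l x ^ 2) := by
      intro x
      have hne : ∀ b ∈ s, b ≠ a := fun b hb => by rintro rfl; exact ha hb
      have e1 : ∀ z, (∑ c ∈ insert a s, ∑ b ∈ insert a s,
          Q c b * (Function.update x a z c * Function.update x a z b))
          - w * ∑ c ∈ insert a s, Q c c = q x + (Q a a * (z ^ 2 - w) + 2 * l x * z) := by
        intro z
        have t1 : ∑ b ∈ s, Q a b * (Function.update x a z a * Function.update x a z b)
            = l x * z := by
          rw [hl, Finset.sum_mul]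
          refine Finset.sum_congr rfl fun b hb => ?_
          rw [Function.update_self, Function.update_of_ne (hne b hb)]; ring
        have t2 : ∑ c ∈ s, ∑ b ∈ insert a s,
            Q c b * (Function.update x a z c * Function.update x a z b)
            = l x * z + ∑ c ∈ s, ∑ b ∈ s, Q c b * (x c * x b) := by
          rw [hl, Finset.sum_mul, ← Finset.sum_add_distrib]
          refine Finset.sum_congr rfl fun c hc => ?_
          rw [Finset.sum_insert ha, Function.update_self, Function.update_of_ne (hne c hc),
            hsymm c a]
          congr 1
          · ring
          · refine Finset.sum_congr rfl fun b hb => ?_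
            rw [Function.update_of_ne (hne b hb)]
        rw [Finset.sum_insert ha, Finset.sum_insert ha, t1, t2, Finset.sum_insert ha,
          Function.update_self, hq]
        ring
      -- Only the square of the new increment is split, by (a + b)² ≤ 2a² + 2b². Its cross term with
      -- `q x` is kept exact, since it has mean zero.
      have e2 : ∀ z : ℝ, (q x + (Q a a * (z ^ 2 - w) + 2 * l x * z)) ^ 2
          ≤ q x ^ 2 + (2 * q x * Q a a * z ^ 2 + 4 * q x * l x * z - 2 * q x * Q a a * w
            + 2 * Q a a ^ 2 * (z ^ 4 - 2 * w * z ^ 2 + w ^ 2) + 8 * l x ^ 2 * z ^ 2) := by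
        intro z
        nlinarith [sq_nonneg (Q a a * (z ^ 2 - w) - 2 * l x * z)]
      have j2 := h.integrable_sq
      have j1 := h.integrable_id
      have j4 := h.integrable_four
      have hR : Integrable (fun z : ℝ => q x ^ 2 + (2 * q x * Q a a * z ^ 2 + 4 * q x * l x * z
          - 2 * q x * Q a a * w + 2 * Q a a ^ 2 * (z ^ 4 - 2 * w * z ^ 2 + w ^ 2)
          + 8 * l x ^ 2 * z ^ 2)) ν :=
        (integrable_const _).add (((((j2.const_mul _).add (j1.const_mul _)).sub
          (integrable_const _)).add (((j4.sub (j2.const_mul _)).add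
          (integrable_const _)).const_mul _)).add (j2.const_mul _))
      have hRe : ∫ z : ℝ, (q x ^ 2 + (2 * q x * Q a a * z ^ 2 + 4 * q x * l x * z
          - 2 * q x * Q a a * w + 2 * Q a a ^ 2 * (z ^ 4 - 2 * w * z ^ 2 + w ^ 2)
          + 8 * l x ^ 2 * z ^ 2)) ∂ν
          = q x ^ 2 + (2 * Q a a ^ 2 * (∫ z, z ^ 4 ∂ν - w ^ 2) + 8 * l x ^ 2 * w) := by
        have : ∀ z : ℝ, q x ^ 2 + (2 * q x * Q a a * z ^ 2 + 4 * q x * l x * z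
          - 2 * q x * Q a a * w + 2 * Q a a ^ 2 * (z ^ 4 - 2 * w * z ^ 2 + w ^ 2)
          + 8 * l x ^ 2 * z ^ 2) = (2 * Q a a ^ 2) * z ^ 4
            + ((2 * q x * Q a a - 4 * w * Q a a ^ 2 + 8 * l x ^ 2) * z ^ 2
            + ((4 * q x * l x) * z
            + (q x ^ 2 - 2 * q x * Q a a * w + 2 * Q a a ^ 2 * w ^ 2))) := fun z => by ring
        simp only [this]
        have k1 : Integrable (fun z : ℝ => (4 * q x * l x) * z
            + (q x ^ 2 - 2 * q x * Q a a * w + 2 * Q a a ^ 2 * w ^ 2)) ν :=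
          (j1.const_mul _).add (integrable_const _)
        have k2 : Integrable (fun z : ℝ => (2 * q x * Q a a - 4 * w * Q a a ^ 2 + 8 * l x ^ 2)
            * z ^ 2 + ((4 * q x * l x) * z
            + (q x ^ 2 - 2 * q x * Q a a * w + 2 * Q a a ^ 2 * w ^ 2))) ν :=
          (j2.const_mul _).add k1
        rw [integral_add (j4.const_mul _) k2, integral_add (j2.const_mul _) k1,
          integral_add (j1.const_mul _) (integrable_const _), integral_const_mul,
          integral_const_mul, integral_const_mul, h.mean, h.var]
        simp only [integral_const, probReal_univ, one_smul]
        ring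
      simp only [e1]
      calc _ ≤ ∫ z : ℝ, (q x ^ 2 + (2 * q x * Q a a * z ^ 2 + 4 * q x * l x * z
          - 2 * q x * Q a a * w + 2 * Q a a ^ 2 * (z ^ 4 - 2 * w * z ^ 2 + w ^ 2)
          + 8 * l x ^ 2 * z ^ 2)) ∂ν :=
            integral_mono_of_nonneg (Eventually.of_forall fun z => sq_nonneg _) hR
              (Eventually.of_forall e2)
        _ ≤ _ := by
            rw [hRe]
            have a1 := h.fourth
            have a2 : 2 * Q a a ^ 2 * (∫ z, z ^ 4 ∂ν - w ^ 2) ≤ 2 * Q a a ^ 2 * (K * w ^ 2) :=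
              mul_le_mul_of_nonneg_left (by linarith [sq_nonneg w]) (by positivity)
            linarith
    have hli := (h.memLp_linear (fun b => Q a b) s).integrable_sq
    have hqi := (h.memLp_quadratic Q s (w * ∑ a ∈ s, Q a a)).integrable_sq
    have hri : Integrable (fun x => 2 * K * w ^ 2 * Q a a ^ 2 + 8 * w * l x ^ 2)
        (Measure.pi fun _ : ι => ν) := (integrable_const _).add (hli.const_mul _)
    calc _ ≤ ∫ x, (q x ^ 2 + (2 * K * w ^ 2 * Q a a ^ 2 + 8 * w * l x ^ 2))
          ∂Measure.pi (fun _ : ι => ν) := integral_mono hi3 (hqi.add hri) hin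
      _ = ∫ x, q x ^ 2 ∂Measure.pi (fun _ : ι => ν)
          + (2 * K * w ^ 2 * Q a a ^ 2 + 8 * w * (w * ∑ b ∈ s, Q a b ^ 2)) := by
          have hk : ∀ k : ℝ, ∫ x, (k + 8 * w * l x ^ 2) ∂Measure.pi (fun _ : ι => ν)
              = k + 8 * w * (w * ∑ b ∈ s, Q a b ^ 2) := by
            intro k
            rw [integral_add (integrable_const _) (hli.const_mul _), integral_const_mul,
              ← h.integral_linear_sq]
            simp
          rw [integral_add hqi hri, hk]
      _ ≤ _ := by
          have t1 : ∑ c ∈ insert a s, ∑ b ∈ insert a s, Q c b ^ 2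
              = Q a a ^ 2 + 2 * ∑ b ∈ s, Q a b ^ 2 + ∑ c ∈ s, ∑ b ∈ s, Q c b ^ 2 := by
            have : ∑ c ∈ s, ∑ b ∈ insert a s, Q c b ^ 2
                = ∑ b ∈ s, Q a b ^ 2 + ∑ c ∈ s, ∑ b ∈ s, Q c b ^ 2 := by
              rw [← Finset.sum_add_distrib]
              refine Finset.sum_congr rfl fun c _ => ?_
              rw [Finset.sum_insert ha, hsymm c a]
            rw [Finset.sum_insert ha, this, Finset.sum_insert ha]; ring
          -- Each off-diagonal square appears twice in the full sum, so the coefficient 8 is covered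
          -- by twice the 4 in `2 * K + 4`.
          rw [t1]
          have p1 : 0 ≤ w ^ 2 * Q a a ^ 2 := by positivity
          have p2 : 0 ≤ K * w ^ 2 * ∑ b ∈ s, Q a b ^ 2 :=
            mul_nonneg (by positivity) (Finset.sum_nonneg fun b _ => sq_nonneg _)
          nlinarith [ih]

end IsCenteredFourth

end QuadraticForms

-- The ridge error as a quadratic form, and the derivative of the resolvent trace.

section RidgeForm

variable {ι κ : Type*} [Fintype ι] [DecidableEq ι] [Fintype κ] [DecidableEq κ]

theorem memLp_bilinear {ν1 ν2 : Measure ℝ} {w1 w2 K : ℝ} (h1 : IsCenteredFourth ν1 w1 K)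
    (h2 : IsCenteredFourth ν2 w2 K) (C : Matrix ι κ ℝ) :
    MemLp (fun w : (ι → ℝ) × (κ → ℝ) => ∑ a, ∑ b, C a b * (w.1 a * w.2 b)) 2
      ((Measure.pi fun _ => ν1).prod (Measure.pi fun _ => ν2)) := by
  have := h1.prob
  have := h2.prob
  refine memLp_finsetSum _ fun a _ => memLp_finsetSum _ fun b _ => MemLp.const_mul ?_ _
  rw [memLp_two_iff_integrable_sq (by fun_prop)]
  simp only [mul_pow]
  exact (h1.integrable_eval_sq a).mul_prod (h2.integrable_eval_sq b)

theorem integral_bilinear_sq {ν1 ν2 : Measure ℝ} {w1 w2 K : ℝ} (h1 : IsCenteredFourth ν1 w1 K)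
    (h2 : IsCenteredFourth ν2 w2 K) (C : Matrix ι κ ℝ) :
    ∫ w : (ι → ℝ) × (κ → ℝ), (∑ a, ∑ b, C a b * (w.1 a * w.2 b)) ^ 2
      ∂((Measure.pi fun _ => ν1).prod (Measure.pi fun _ => ν2))
      = w1 * w2 * ∑ b, ∑ a, C a b ^ 2 := by
  have := h1.prob
  have := h2.prob
  rw [integral_prod _ (memLp_bilinear h1 h2 C).integrable_sq]
  have e : ∀ x : ι → ℝ, ∫ y : κ → ℝ, (∑ a, ∑ b, C a b * (x a * y b)) ^ 2
      ∂(Measure.pi fun _ => ν2) = w2 * ∑ b, (∑ a, C a b * x a) ^ 2 := by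
    intro x
    rw [← h2.integral_linear_sq]
    congr 1
    ext y
    congr 1
    rw [Finset.sum_comm]
    refine Finset.sum_congr rfl fun b _ => ?_
    rw [Finset.sum_mul]
    exact Finset.sum_congr rfl fun a _ => by ring
  simp only [e]
  rw [integral_const_mul, integral_finsetSum _ fun b _ =>
    (h1.memLp_linear (fun a => C a b) Finset.univ).integrable_sq]
  simp only [h1.integral_linear_sq]
  rw [← Finset.mul_sum]; ring

/-- Second moment of a centred quadratic form in two independent i.i.d. families. -/
theorem integral_form_sub_sq_le {ν1 ν2 : Measure ℝ} {w1 w2 K : ℝ}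
    (h1 : IsCenteredFourth ν1 w1 K) (h2 : IsCenteredFourth ν2 w2 K) (hK : 0 ≤ K)
    {S : Matrix ι ι ℝ} {T : Matrix κ κ ℝ} (hS : Sᵀ = S) (hT : Tᵀ = T) (C : Matrix ι κ ℝ) :
    Integrable (fun w : (ι → ℝ) × (κ → ℝ) => ((∑ a, ∑ b, S a b * (w.1 a * w.1 b))
        + (∑ a, ∑ b, T a b * (w.2 a * w.2 b)) + (∑ a, ∑ b, C a b * (w.1 a * w.2 b))
        - (w1 * S.trace + w2 * T.trace)) ^ 2)
      ((Measure.pi fun _ => ν1).prod (Measure.pi fun _ => ν2)) ∧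
    ∫ w : (ι → ℝ) × (κ → ℝ), ((∑ a, ∑ b, S a b * (w.1 a * w.1 b))
        + (∑ a, ∑ b, T a b * (w.2 a * w.2 b)) + (∑ a, ∑ b, C a b * (w.1 a * w.2 b))
        - (w1 * S.trace + w2 * T.trace)) ^ 2
      ∂((Measure.pi fun _ => ν1).prod (Measure.pi fun _ => ν2))
      ≤ 3 * ((2 * K + 4) * w1 ^ 2 * (∑ a, ∑ b, S a b ^ 2)
        + (2 * K + 4) * w2 ^ 2 * (∑ a, ∑ b, T a b ^ 2) + w1 * w2 * ∑ b, ∑ a, C a b ^ 2) := by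
  have := h1.prob
  have := h2.prob
  set P1 := Measure.pi fun _ : ι => ν1 with hP1
  set P2 := Measure.pi fun _ : κ => ν2 with hP2
  set q1 : (ι → ℝ) → ℝ := fun x => (∑ a, ∑ b, S a b * (x a * x b)) - w1 * ∑ a, S a a with hq1
  set q2 : (κ → ℝ) → ℝ := fun x => (∑ a, ∑ b, T a b * (x a * x b)) - w2 * ∑ a, T a a with hq2
  have m1 : MemLp q1 2 P1 := h1.memLp_quadratic S Finset.univ _
  have m2 : MemLp q2 2 P2 := h2.memLp_quadratic T Finset.univ _
  have f1 : MeasurePreserving (Prod.fst : (ι → ℝ) × (κ → ℝ) → ι → ℝ) (P1.prod P2) P1 :=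
    measurePreserving_fst
  have f2 : MeasurePreserving (Prod.snd : (ι → ℝ) × (κ → ℝ) → κ → ℝ) (P1.prod P2) P2 :=
    measurePreserving_snd
  have M1 : MemLp (fun w : (ι → ℝ) × (κ → ℝ) => q1 w.1) 2 (P1.prod P2) :=
    m1.comp_measurePreserving f1
  have M2 : MemLp (fun w : (ι → ℝ) × (κ → ℝ) => q2 w.2) 2 (P1.prod P2) :=
    m2.comp_measurePreserving f2
  have M3 := memLp_bilinear h1 h2 C
  have i1 : ∫ w : (ι → ℝ) × (κ → ℝ), q1 w.1 ^ 2 ∂(P1.prod P2) = ∫ x, q1 x ^ 2 ∂P1 := by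
    have h := integral_map (μ := P1.prod P2) f1.measurable.aemeasurable
      (f := fun x => q1 x ^ 2) (by rw [f1.map_eq]; exact m1.integrable_sq.1)
    rw [f1.map_eq] at h
    exact h.symm
  have i2 : ∫ w : (ι → ℝ) × (κ → ℝ), q2 w.2 ^ 2 ∂(P1.prod P2) = ∫ x, q2 x ^ 2 ∂P2 := by
    have h := integral_map (μ := P1.prod P2) f2.measurable.aemeasurable
      (f := fun x => q2 x ^ 2) (by rw [f2.map_eq]; exact m2.integrable_sq.1)
    rw [f2.map_eq] at h
    exact h.symm
  have e : ∀ w : (ι → ℝ) × (κ → ℝ), (∑ a, ∑ b, S a b * (w.1 a * w.1 b))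
        + (∑ a, ∑ b, T a b * (w.2 a * w.2 b)) + (∑ a, ∑ b, C a b * (w.1 a * w.2 b))
        - (w1 * S.trace + w2 * T.trace)
      = q1 w.1 + q2 w.2 + ∑ a, ∑ b, C a b * (w.1 a * w.2 b) := by
    intro w
    simp only [hq1, hq2, Matrix.trace, Matrix.diag]; ring
  simp only [e]
  have hI := ((M1.add M2).add M3).integrable_sq
  refine ⟨hI, ?_⟩
  have j1 := M1.integrable_sq
  have j2 := M2.integrable_sq
  have j3 := M3.integrable_sq
  calc _ ≤ ∫ w : (ι → ℝ) × (κ → ℝ), 3 * ((q1 w.1 ^ 2 + q2 w.2 ^ 2)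
        + (∑ a, ∑ b, C a b * (w.1 a * w.2 b)) ^ 2) ∂(P1.prod P2) := by
        refine integral_mono hI (((j1.add j2).add j3).const_mul 3) fun w => ?_
        show (q1 w.1 + q2 w.2 + ∑ a, ∑ b, C a b * (w.1 a * w.2 b)) ^ 2 ≤ _
        set z := ∑ a, ∑ b, C a b * (w.1 a * w.2 b)
        show _ ≤ 3 * ((q1 w.1 ^ 2 + q2 w.2 ^ 2) + z ^ 2)
        nlinarith [sq_nonneg (q1 w.1 - q2 w.2), sq_nonneg (q1 w.1 - z), sq_nonneg (q2 w.2 - z)]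
    _ ≤ _ := by
        have j12 : Integrable (fun w : (ι → ℝ) × (κ → ℝ) => q1 w.1 ^ 2 + q2 w.2 ^ 2)
          (P1.prod P2) := j1.add j2
        rw [integral_const_mul, integral_add j12 j3, integral_add j1 j2, i1, i2,
          integral_bilinear_sq h1 h2 C]
        have a1 := h1.integral_quadratic_sub_sq_le hS hK Finset.univ
        have a2 := h2.integral_quadratic_sub_sq_le hT hK Finset.univ
        simp only [hq1, hq2]
        linarith

variable {m p : Type*} [Fintype m] [Fintype p] [DecidableEq m] [DecidableEq p]

theorem gram_mul_gramRes (Y : Matrix m p ℝ) : Yᵀ * Y * gramRes Y = 1 - gramRes Y := by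
  have := mul_gramRes Y
  rw [Matrix.add_mul, Matrix.one_mul] at this
  rw [eq_sub_iff_add_eq, add_comm]; exact this

theorem gramRes_mul_gram (Y : Matrix m p ℝ) : gramRes Y * (Yᵀ * Y) = 1 - gramRes Y := by
  have := gramRes_mul Y
  rw [Matrix.mul_add, Matrix.mul_one] at this
  rw [eq_sub_iff_add_eq, add_comm]; exact this

/-- Expresses the noise part of the conditional mean through the same two traces as the signal part.
-/
theorem trace_gram_mul_sq (Y : Matrix m p ℝ) :
    (Y * (gramRes Y * gramRes Y) * Yᵀ).trace
      = (gramRes Y).trace - (gramRes Y * gramRes Y).trace := by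
  rw [Matrix.trace_mul_comm, ← Matrix.mul_assoc, ← Matrix.mul_assoc, gram_mul_gramRes,
    Matrix.sub_mul, Matrix.one_mul, Matrix.trace_sub]

section

open scoped Matrix.Norms.L2Operator

/-- This product is an off-diagonal block of the contraction `linRes Y`, so it is bounded however
large `Y` is. -/
theorem norm_gramRes_mul_transpose_le (Y : Matrix m p ℝ) : ‖gramRes Y * Yᵀ‖ ≤ 1 := by
  have h := gramRes_push Yᵀ
  rw [Matrix.transpose_transpose] at h
  rw [← h, ← inrMat_linRes_inlMat]
  have hr : ‖(inrMat m p)ᵀ‖ ≤ 1 := by rw [l2_opNorm_transpose]; exact norm_inrMat_le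
  simpa using l2_opNorm_mul_le (l2_opNorm_mul_le hr (norm_linRes_le Y)) norm_inlMat_le

theorem sum_sum_sq_le (X : Matrix m p ℝ) {c : ℝ} (h : ‖X‖ ≤ c) :
    ∑ b, ∑ a, X a b ^ 2 ≤ Fintype.card p * c ^ 2 := by
  calc _ ≤ ∑ _b : p, c ^ 2 := Finset.sum_le_sum fun b _ =>
        (sum_sq_col_le X b).trans (pow_le_pow_left₀ (norm_nonneg _) h 2)
    _ = _ := by simp

theorem abs_trace_le (X : Matrix p p ℝ) {c : ℝ} (h : ‖X‖ ≤ c) :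
    |X.trace| ≤ Fintype.card p * c := by
  calc |X.trace| ≤ ∑ i, |X i i| := Finset.abs_sum_le_sum_abs _ _
    _ ≤ ∑ _i : p, c := Finset.sum_le_sum fun i _ => (abs_apply_le_norm X i i).trans h
    _ = _ := by simp

/-- The derivative of the resolvent trace in the ridge parameter, by a finite difference. -/
theorem abs_trace_gramRes_diff_le (Y : Matrix m p ℝ) {t : ℝ} (ht : 0 ≤ t) :
    |(gramRes Y).trace - (gramRes (√(1 + t) • Y)).trace
      - t * ((gramRes Y).trace - (gramRes Y * gramRes Y).trace)|
      ≤ 4 * t ^ 2 * Fintype.card p := by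
  set Q := gramRes Y with hQ
  set Q' := gramRes (√(1 + t) • Y) with hQ'
  set G := Yᵀ * Y with hG
  have hs : √(1 + t) * √(1 + t) = 1 + t := Real.mul_self_sqrt (by linarith)
  have hQG : Q * G = 1 - Q := gramRes_mul_gram Y
  have hQ1 : Q * (1 + G) = 1 := gramRes_mul Y
  have hQ2 : (1 + (1 + t) • G) * Q' = 1 := by
    have := mul_gramRes (√(1 + t) • Y)
    rwa [Matrix.transpose_smul, Matrix.smul_mul, Matrix.mul_smul, smul_smul, hs] at this
  -- The scale √(1 + t) multiplies the Gram matrix by 1 + t. Using the resolvent identity twice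
  -- leaves the remainder t² (1 - Q)² Q', whose norm is at most 4 t².
  have hd : Q - Q' = t • (Q * G * Q') := by
    calc Q - Q' = Q * ((1 + (1 + t) • G) * Q') - (Q * (1 + G)) * Q' := by
          rw [hQ1, hQ2, Matrix.mul_one, Matrix.one_mul]
      _ = _ := by
          rw [add_smul, one_smul]
          simp only [Matrix.mul_add, Matrix.add_mul, Matrix.smul_mul, Matrix.mul_smul,
            Matrix.mul_assoc, Matrix.mul_one, Matrix.one_mul]
          abel
  have hd2 : Q - Q' - t • (Q - Q * Q) = -(t ^ 2 • ((1 - Q) * (1 - Q) * Q')) := by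
    have e1 : Q - Q * Q = (1 - Q) * Q := by rw [Matrix.sub_mul, Matrix.one_mul]
    have e2 : (1 - Q) * Q' - (1 - Q) * Q = -(t • ((1 - Q) * (1 - Q) * Q')) := by
      rw [← Matrix.mul_sub, ← neg_sub Q Q', hd, hQG, Matrix.mul_neg, Matrix.mul_smul,
        Matrix.mul_assoc]
    calc Q - Q' - t • (Q - Q * Q) = t • ((1 - Q) * Q' - (1 - Q) * Q) := by
          rw [hd, hQG, e1, smul_sub]
      _ = _ := by rw [e2, smul_neg, smul_smul, sq]
  have hn1 : ‖1 - Q‖ ≤ 2 := by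
    have : ‖(1 : Matrix p p ℝ)‖ ≤ 1 := l2_opNorm_le_one_of_transpose_mul_self (by simp)
    exact (norm_sub_le _ _).trans (by linarith [norm_gramRes_le Y])
  have hn : ‖Q - Q' - t • (Q - Q * Q)‖ ≤ 4 * t ^ 2 := by
    rw [hd2, norm_neg, norm_smul, Real.norm_eq_abs, abs_of_nonneg (sq_nonneg t)]
    have := l2_opNorm_mul_le (l2_opNorm_mul_le hn1 hn1) (norm_gramRes_le (√(1 + t) • Y))
    nlinarith [sq_nonneg t]
  have key := abs_trace_le _ hn
  rw [Matrix.trace_sub, Matrix.trace_sub, Matrix.trace_smul, Matrix.trace_sub, smul_eq_mul] at key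
  linarith

end

/-- The ridge estimation error as a quadratic form in the coefficients and the noise. -/
theorem estimationError_ridge {n d : ℕ} {lam : ℝ} (hlam : 0 < lam) (hn : 0 < n)
    (X : Matrix (Fin n) (Fin d) ℝ) (β : Fin d → ℝ) (ε : Fin n → ℝ)
    {r : ℝ} (hr : r = 1 / √(lam * n)) {Q : Matrix (Fin d) (Fin d) ℝ}
    (hQ : Q = gramRes (r • X)) :
    estimationError (ridge lam X (X *ᵥ β + ε)) β
      = (∑ a, ∑ b, (Q * Q) a b * (β a * β b))
        + (∑ a, ∑ b, (r ^ 2 • ((r • X) * (Q * Q) * (r • X)ᵀ)) a b * (ε a * ε b))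
        + (∑ a, ∑ b, ((-2 * r) • (Q * (Q * (r • X)ᵀ))) a b * (β a * ε b)) := by
  have hn' : (0 : ℝ) < n := by exact_mod_cast hn
  have hln : 0 < lam * n := by positivity
  have hs : √(lam * n) * √(lam * n) = lam * n := Real.mul_self_sqrt hln.le
  have hs0 : 0 < √(lam * n) := Real.sqrt_pos.mpr hln
  have hr0 : 0 < r := by rw [hr]; positivity
  have hrr : r * r * (lam * n) = 1 := by
    rw [hr, div_mul_div_comm, one_mul, hs, one_div, inv_mul_cancel₀ hln.ne']
  set Y := r • X with hY
  have hQs : Qᵀ = Q := by rw [hQ, gramRes_transpose]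
  have hinv : (Xᵀ * X + (lam * (n : ℝ)) • (1 : Matrix (Fin d) (Fin d) ℝ))⁻¹ = (r * r) • Q := by
    refine Matrix.inv_eq_right_inv ?_
    have h1 := mul_gramRes Y
    rw [← hQ] at h1
    have h2 : Xᵀ * X + (lam * (n : ℝ)) • (1 : Matrix (Fin d) (Fin d) ℝ)
        = (lam * n) • (1 + Yᵀ * Y) := by
      rw [hY, Matrix.transpose_smul, Matrix.smul_mul, Matrix.mul_smul, smul_smul, smul_add,
        smul_smul, mul_comm (lam * n) (r * r), hrr, one_smul, add_comm]
    rw [h2, Matrix.smul_mul, Matrix.mul_smul, smul_smul, h1, mul_comm, hrr, one_smul]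
  -- The shrinkage bias is -Qβ, because Q YᵀY = 1 - Q.
  have hvec : ridge lam X (X *ᵥ β + ε) - β = -(Q *ᵥ β) + r • ((Q * Yᵀ) *ᵥ ε) := by
    have h3 : Q * (Yᵀ * Y) = 1 - Q := by rw [hQ]; exact gramRes_mul_gram Y
    have h4 : (r * r) • (Q * (Xᵀ * X)) = 1 - Q := by
      rw [← h3, hY]
      simp only [Matrix.transpose_smul, Matrix.smul_mul, Matrix.mul_smul, smul_smul]
    have h5 : r • (Q * Yᵀ) = (r * r) • (Q * Xᵀ) := by
      rw [hY, Matrix.transpose_smul, Matrix.mul_smul, smul_smul]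
    rw [ridge, hinv, Matrix.mulVec_add, Matrix.mulVec_add, Matrix.mulVec_mulVec,
      Matrix.mulVec_mulVec, Matrix.mulVec_mulVec, Matrix.smul_mul, Matrix.smul_mul,
      Matrix.mul_assoc, h4, ← h5,
      Matrix.sub_mulVec, Matrix.one_mulVec, Matrix.smul_mulVec]
    abel
  have hquad : ∀ {k l : ℕ} (M : Matrix (Fin k) (Fin l) ℝ) (x : Fin k → ℝ) (y : Fin l → ℝ),
      ∑ a, ∑ b, M a b * (x a * y b) = x ⬝ᵥ (M *ᵥ y) := by
    intro k l M x y
    simp only [dotProduct, Matrix.mulVec, Finset.mul_sum]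
    exact Finset.sum_congr rfl fun a _ => Finset.sum_congr rfl fun b _ => by ring
  have hmv : ∀ {k l j : ℕ} (M : Matrix (Fin k) (Fin l) ℝ) (N : Matrix (Fin k) (Fin j) ℝ)
      (x : Fin l → ℝ) (y : Fin j → ℝ), (M *ᵥ x) ⬝ᵥ (N *ᵥ y) = x ⬝ᵥ ((Mᵀ * N) *ᵥ y) := by
    intro k l j M N x y
    rw [← Matrix.mulVec_mulVec, Matrix.dotProduct_mulVec x, Matrix.vecMul_transpose]
  have hQY : (Q * Yᵀ)ᵀ = Y * Q := by rw [Matrix.transpose_mul, hQs, Matrix.transpose_transpose]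
  rw [estimationError, norm_toLp_sq, hvec, hquad, hquad, hquad]
  have e1 : β ⬝ᵥ ((Q * Q) *ᵥ β) = (Q *ᵥ β) ⬝ᵥ (Q *ᵥ β) := by rw [hmv, hQs]
  have e2 : ε ⬝ᵥ ((r ^ 2 • (Y * (Q * Q) * Yᵀ)) *ᵥ ε)
      = r ^ 2 * (((Q * Yᵀ) *ᵥ ε) ⬝ᵥ ((Q * Yᵀ) *ᵥ ε)) := by
    rw [hmv, hQY, Matrix.smul_mulVec, dotProduct_smul, smul_eq_mul]
    simp only [Matrix.mul_assoc]
  have e3 : β ⬝ᵥ (((-2 * r) • (Q * (Q * Yᵀ))) *ᵥ ε)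
      = -2 * r * ((Q *ᵥ β) ⬝ᵥ ((Q * Yᵀ) *ᵥ ε)) := by
    rw [hmv, hQs, Matrix.smul_mulVec, dotProduct_smul, smul_eq_mul]
  rw [e1, e2, e3]
  simp only [add_dotProduct, dotProduct_add, neg_dotProduct, dotProduct_neg, smul_dotProduct,
    dotProduct_smul, smul_eq_mul]
  rw [dotProduct_comm ((Q * Yᵀ) *ᵥ ε) (Q *ᵥ β)]
  ring

end RidgeForm

-- From general entry laws to standardized ones.

section LawReduction

theorem IsStandardized.mono {ν : Measure ℝ} {M M' : ℝ} (h : IsStandardized ν M) (hM : M ≤ M') :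
    IsStandardized ν M' where
  prob := h.prob
  memLp := h.memLp
  mean := h.mean
  var := h.var
  third := h.third.trans hM

theorem exists_isStandardized {D : Measure ℝ} [IsProbabilityMeasure D]
    (h : MemLp (fun z : ℝ => z) 3 D) {s : ℝ} (hs : 0 < s)
    (hv : variance (fun z : ℝ => z) D = s ^ 2) :
    ∃ M, IsStandardized (D.map fun z => (z - ∫ x, x ∂D) / s) M := by
  set μ := ∫ x, x ∂D with hμ
  have hm : Measurable fun z : ℝ => (z - μ) / s := by fun_prop
  have hi : Integrable (fun z : ℝ => z) D :=
    memLp_one_iff_integrable.mp (h.mono_exponent (by norm_num))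
  have hprob : IsProbabilityMeasure (D.map fun z => (z - μ) / s) :=
    Measure.isProbabilityMeasure_map hm.aemeasurable
  -- `le_rfl` makes `M` the third absolute moment itself.
  refine ⟨_, hprob, ?_, ?_, ?_, le_rfl⟩
  · rw [memLp_map_measure_iff (by fun_prop) hm.aemeasurable]
    have := (h.sub (memLp_const μ)).const_mul s⁻¹
    refine this.congr_norm (by fun_prop) (Eventually.of_forall fun z => ?_)
    simp [Function.comp, div_eq_inv_mul]
  · rw [integral_map hm.aemeasurable (by fun_prop), integral_div,
      integral_sub hi (integrable_const _)]
    simp [hμ]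
  · rw [integral_map hm.aemeasurable (by fun_prop)]
    simp only [div_pow]
    rw [integral_div]
    have := variance_eq_integral (μ := D) (X := fun z : ℝ => z) hi.aemeasurable
    rw [← hμ] at this
    rw [← this, hv, div_self (by positivity)]

theorem measurePreserving_standardize {D : Measure ℝ} [IsProbabilityMeasure D] (n d : ℕ)
    (μ s : ℝ) : MeasurePreserving
      (fun (W : Fin n → Fin d → ℝ) (p : Fin n × Fin d) => (W p.1 p.2 - μ) / s)
      (iidMatrixLaw D n d) (Measure.pi fun _ => D.map fun z => (z - μ) / s) := by
  have hm : Measurable fun z : ℝ => (z - μ) / s := by fun_prop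
  have hprob : IsProbabilityMeasure (D.map fun z => (z - μ) / s) :=
    Measure.isProbabilityMeasure_map hm.aemeasurable
  have h1 : MeasurePreserving (MeasurableEquiv.curry (Fin n) (Fin d) ℝ).symm
      (iidMatrixLaw D n d) (Measure.pi fun _ => D) := by
    refine ⟨MeasurableEquiv.measurable _, ?_⟩
    have := Measure.infinitePi_map_curry_symm (fun (_ : Fin n) (_ : Fin d) => D)
    simpa only [Measure.infinitePi_eq_pi, iidMatrixLaw] using this
  have h2 : MeasurePreserving (fun (x : Fin n × Fin d → ℝ) p => (x p - μ) / s)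
      (Measure.pi fun _ => D) (Measure.pi fun _ => D.map fun z => (z - μ) / s) :=
    measurePreserving_pi (fun _ => D) (fun _ => D.map fun z => (z - μ) / s)
      fun _ => ⟨hm, rfl⟩
  exact h2.comp h1

instance (D : Measure ℝ) [IsProbabilityMeasure D] (n d : ℕ) :
    IsProbabilityMeasure (iidMatrixLaw D n d) := by
  unfold iidMatrixLaw; infer_instance

theorem continuous_product {n d : ℕ} (A : Matrix (Fin n) (Fin n) ℝ)
    (B : Matrix (Fin d) (Fin d) ℝ) :
    Continuous fun W : Fin n → Fin d → ℝ => A * Matrix.of W * B := by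
  have h : Continuous fun W : Fin n → Fin d → ℝ => (Matrix.of W : Matrix (Fin n) (Fin d) ℝ) :=
    continuous_matrix fun i j => (continuous_apply j).comp (continuous_apply i)
  exact (continuous_const.matrix_mul h).matrix_mul continuous_const

theorem continuous_trace_gramRes_product {n d : ℕ} (A : Matrix (Fin n) (Fin n) ℝ)
    (B : Matrix (Fin d) (Fin d) ℝ) :
    Continuous fun W : Fin n → Fin d → ℝ => (gramRes (A * Matrix.of W * B)).trace :=
  (continuous_gramRes.comp (continuous_product A B)).matrix_trace

theorem abs_trace_gramRes_le {n d : ℕ} (X : Matrix (Fin n) (Fin d) ℝ) :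
    |(gramRes X).trace| ≤ d := by
  rw [abs_of_nonneg (trace_gramRes_nonneg _)]
  simpa using trace_gramRes_le X

/-- Centring the entries is a rank-one change of the matrix. -/
theorem abs_integral_standardize_le {D : Measure ℝ} [IsProbabilityMeasure D] {n d : ℕ}
    (hn : 0 < n) (A : Matrix (Fin n) (Fin n) ℝ) (B : Matrix (Fin d) (Fin d) ℝ) (μ : ℝ) {s : ℝ}
    (hs : 0 < s) :
    |∫ W, (gramRes (A * Matrix.of W * B)).trace ∂iidMatrixLaw D n d
      - ∫ x, (gramRes (sandwich (1 / √(n : ℝ)) ((√(n : ℝ) * s) • A) B x)).trace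
        ∂Measure.pi (fun _ : Fin n × Fin d => D.map fun z => (z - μ) / s)| ≤ 1 := by
  have hn' : 0 < √(n : ℝ) := Real.sqrt_pos.mpr (by exact_mod_cast hn)
  have hmp := measurePreserving_standardize (D := D) n d μ s
  have hc : Continuous fun x : Fin n × Fin d → ℝ =>
      (gramRes (sandwich (1 / √(n : ℝ)) ((√(n : ℝ) * s) • A) B x)).trace :=
    (continuous_gramRes.comp (continuous_sandwich _ _ _)).matrix_trace
  have h1 := integral_map (μ := iidMatrixLaw D n d) hmp.measurable.aemeasurable
    (f := fun x => (gramRes (sandwich (1 / √(n : ℝ)) ((√(n : ℝ) * s) • A) B x)).trace)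
    hc.measurable.aestronglyMeasurable
  rw [hmp.map_eq] at h1
  have hi1 : Integrable (fun W => (gramRes (A * Matrix.of W * B)).trace) (iidMatrixLaw D n d) :=
    integrable_of_bounded (continuous_trace_gramRes_product A B).measurable
      fun W => abs_trace_gramRes_le _
  have hi2 : Integrable (fun W : Fin n → Fin d → ℝ => (gramRes (sandwich (1 / √(n : ℝ))
      ((√(n : ℝ) * s) • A) B fun p => (W p.1 p.2 - μ) / s)).trace) (iidMatrixLaw D n d) :=
    integrable_of_bounded (hc.measurable.comp hmp.measurable) fun W => abs_trace_gramRes_le _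
  rw [h1, ← integral_sub hi1 hi2]
  refine abs_integral_le_integral_abs.trans ?_
  have hpt : ∀ W : Fin n → Fin d → ℝ, |(gramRes (A * Matrix.of W * B)).trace
      - (gramRes (sandwich (1 / √(n : ℝ)) ((√(n : ℝ) * s) • A) B
        fun p => (W p.1 p.2 - μ) / s)).trace| ≤ 1 := by
    intro W
    -- The factor `√n * s` on `A` undoes the normalization of `sandwich` and of the entries; the
    -- constant mean contributes the rank-one term.
    have e : A * Matrix.of W * B = sandwich (1 / √(n : ℝ)) ((√(n : ℝ) * s) • A) B
        (fun p => (W p.1 p.2 - μ) / s)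
        + Matrix.vecMulVec (A *ᵥ fun _ => μ) ((fun _ => 1) ᵥ* B) := by
      have e1 : (Matrix.of fun i j => (W i j - μ) / s : Matrix (Fin n) (Fin d) ℝ)
          = s⁻¹ • (Matrix.of W - Matrix.vecMulVec (fun _ => μ) (fun _ => 1)) := by
        ext i j
        simp [Matrix.vecMulVec_apply, div_eq_inv_mul]
      have e2 : Matrix.vecMulVec (A *ᵥ fun _ => μ) ((fun _ => 1) ᵥ* B)
          = A * (Matrix.vecMulVec (fun _ => μ) (fun _ => 1) : Matrix (Fin n) (Fin d) ℝ) * B := by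
        rw [Matrix.mul_vecMulVec, Matrix.vecMulVec_mul]
      rw [e2, sandwich, e1]
      have hk : 1 / √(n : ℝ) * (s⁻¹ * (√(n : ℝ) * s)) = 1 := by field_simp
      simp only [Matrix.smul_mul, Matrix.mul_smul, smul_smul, Matrix.mul_sub, Matrix.sub_mul, smul_sub,
        hk, one_smul]
      abel
    rw [e]
    exact abs_trace_gramRes_add_vecMulVec _ _ _
  calc _ ≤ ∫ _W, (1 : ℝ) ∂iidMatrixLaw D n d := by
        exact integral_mono (hi1.sub hi2).abs (integrable_const _) hpt
    _ = 1 := by simp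

/-- Comparison of resolvent traces for two entry laws with the same mean and variance. -/
theorem abs_integral_trace_iid_sub_le {D1 D2 : Measure ℝ} [IsProbabilityMeasure D1]
    [IsProbabilityMeasure D2] {μ s M L c : ℝ} (hs : 0 < s)
    (h1 : IsStandardized (D1.map fun z => (z - μ) / s) M)
    (h2 : IsStandardized (D2.map fun z => (z - μ) / s) M) {n d : ℕ} (hn : 0 < n)
    (hL : 1 ≤ L) (hc : 1 ≤ c) (hd : (d : ℝ) ≤ c * n)
    (A : Matrix (Fin n) (Fin n) ℝ) (B : Matrix (Fin d) (Fin d) ℝ) :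
    |∫ W, (gramRes (A * Matrix.of W * B)).trace ∂iidMatrixLaw D1 n d
      - ∫ W, (gramRes (A * Matrix.of W * B)).trace ∂iidMatrixLaw D2 n d|
      ≤ comparisonError c M L n + 2 := by
  have hn1 : (1 : ℝ) ≤ n := by exact_mod_cast hn
  have a1 := abs_le.mp (abs_integral_standardize_le (D := D1) hn A B μ hs)
  have a2 := abs_le.mp (abs_integral_standardize_le (D := D2) hn A B μ hs)
  have a3 := abs_le.mp (abs_integral_trace_sub_le h1 h2 ((√(n : ℝ) * s) • A) B hL hn1
    (c := c) (by linarith) (by simp; nlinarith) (by simpa using hd))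
  rw [abs_le]
  constructor <;> linarith

/-- Sub-Gaussianity enters the trace comparison only through this finite third moment. -/
theorem IsSubGaussianLaw.memLp {D : Measure ℝ} [IsProbabilityMeasure D]
    (h : IsSubGaussianLaw D) : MemLp (fun z : ℝ => z) 3 D := by
  obtain ⟨c, hc⟩ := h
  have := (hc.memLp 3).add (memLp_const (∫ x, x ∂D))
  refine this.congr_norm (by fun_prop) (Eventually.of_forall fun z => ?_)
  simp

/-- The expected resolvent traces of a sub-Gaussian matrix and of its Gaussian counterpart
differ by a vanishing fraction of the dimension. -/
theorem exists_trace_comparison {D : Measure ℝ} [IsProbabilityMeasure D]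
    (hD : IsSubGaussianLaw D) {c ε : ℝ} (hc : 1 ≤ c) (hε : 0 < ε) :
    ∃ N : ℕ, ∀ n d : ℕ, N ≤ n → (d : ℝ) ≤ c * n →
      ∀ (A : Matrix (Fin n) (Fin n) ℝ) (B : Matrix (Fin d) (Fin d) ℝ),
      |∫ W, (gramRes (A * Matrix.of W * B)).trace ∂iidMatrixLaw D n d
        - ∫ W, (gramRes (A * Matrix.of W * B)).trace ∂iidMatrixLaw (matchingGaussian D) n d|
        ≤ ε * n := by
  set v := variance (fun z : ℝ => z) D with hv
  have hv0 : 0 ≤ v := variance_nonneg _ _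
  have hL3 := hD.memLp
  have hgp : IsProbabilityMeasure (matchingGaussian D) := by
    unfold matchingGaussian; infer_instance
  rcases hv0.eq_or_lt with h0 | hpos
  -- With zero variance no standardization is possible, but `D` is then a point mass and coincides
  -- with its matching Gaussian.
  · have hae : (fun z : ℝ => z) =ᵐ[D] fun _ => ∫ x, x ∂D := by
      have h2 : MemLp (fun z : ℝ => z) 2 D := hL3.mono_exponent (by norm_num)
      exact ae_eq_integral_of_variance_eq_zero h2 h0.symm
    have hDd : D = Measure.dirac (∫ x, x ∂D) := by
      have h1 : D.map (fun z : ℝ => z) = D := Measure.map_id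
      rw [Measure.map_congr hae, Measure.map_const] at h1
      simpa using h1.symm
    have hG : matchingGaussian D = D := by
      rw [matchingGaussian, ← hv, ← h0, Real.toNNReal_zero, gaussianReal_zero_var]
      exact hDd.symm
    refine ⟨0, fun n d _ _ A B => ?_⟩
    rw [hG, sub_self, abs_zero]
    positivity
  · set s := √v with hs
    have hs0 : 0 < s := Real.sqrt_pos.mpr hpos
    have hsv : s ^ 2 = v := Real.sq_sqrt hv0
    obtain ⟨M1, hM1⟩ := exists_isStandardized hL3 hs0 (hsv ▸ hv.symm)
    have hgm : ∫ x, x ∂matchingGaussian D = ∫ x, x ∂D := integral_id_gaussianReal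
    have hgv : variance (fun z : ℝ => z) (matchingGaussian D) = s ^ 2 := by
      rw [matchingGaussian, variance_fun_id_gaussianReal, ← hv, hsv, Real.coe_toNNReal _ hv0]
    have hgL : MemLp (fun z : ℝ => z) 3 (matchingGaussian D) :=
      memLp_id_gaussianReal' 3 (by norm_num)
    obtain ⟨M2, hM2⟩ := exists_isStandardized hgL hs0 hgv
    rw [hgm] at hM2
    obtain ⟨L, hL, hlim⟩ := tendsto_comparisonError c (max M1 M2) (by linarith : (0 : ℝ) ≤ c)
      (half_pos hε)
    have h2 : ∀ᶠ n : ℕ in atTop, comparisonError c (max M1 M2) L n ≤ ε / 2 * n :=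
      tendsto_natCast_atTop_atTop.eventually hlim
    -- Absorbs the additive 2 left by centring under the two laws.
    have h3 : ∀ᶠ n : ℕ in atTop, 4 / ε ≤ (n : ℝ) :=
      tendsto_natCast_atTop_atTop.eventually (eventually_ge_atTop _)
    obtain ⟨N, hN⟩ := eventually_atTop.mp ((h2.and h3).and (eventually_gt_atTop 0))
    refine ⟨N, fun n d hn hd A B => ?_⟩
    obtain ⟨⟨b1, b2⟩, b3⟩ := hN n hn
    have := abs_integral_trace_iid_sub_le hs0 (hM1.mono (le_max_left _ M2))
      (hM2.mono (le_max_right M1 _)) b3 hL hc hd A B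
    rw [div_le_iff₀ hε] at b2
    linarith

end LawReduction

-- Concentration of the conditional risk and of the ridge error.

section Concentration

/-- The fourth moment of a standard Gaussian variable. -/
noncomputable def gaussianFourth : ℝ := ∫ z, z ^ 4 ∂gaussianReal 0 1

theorem gaussianFourth_nonneg : 0 ≤ gaussianFourth := integral_nonneg fun z => by positivity

theorem isCenteredFourth_gaussianReal {w : ℝ} (hw : 0 ≤ w) :
    IsCenteredFourth (gaussianReal 0 (Real.toNNReal w)) w gaussianFourth where
  prob := inferInstance
  integrable_four := by
    have : MemLp (fun z : ℝ => z) 4 (gaussianReal 0 (Real.toNNReal w)) :=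
      memLp_id_gaussianReal' 4 (by norm_num)
    have h := this.integrable_norm_rpow (by norm_num) (by norm_num)
    refine h.congr (Eventually.of_forall fun z => ?_)
    have : (ENNReal.toReal 4) = ((4 : ℕ) : ℝ) := by simp
    simp only [this, Real.rpow_natCast, Real.norm_eq_abs]
    exact (by decide : Even 4).pow_abs z
  mean := integral_id_gaussianReal
  var := by
    have h1 : variance (fun z : ℝ => z) (gaussianReal 0 (Real.toNNReal w)) = _ :=
      variance_fun_id_gaussianReal
    have h2 := variance_eq_integral (μ := gaussianReal 0 (Real.toNNReal w))
      (X := fun z : ℝ => z) (by fun_prop)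
    rw [h1, integral_id_gaussianReal, Real.coe_toNNReal _ hw] at h2
    simpa using h2.symm
  fourth := by
    have h := gaussianReal_map_const_mul (μ := 0) (v := 1) (√w)
    have e : NNReal.mk ((√w) ^ 2) (sq_nonneg _) * 1 = Real.toNNReal w := by
      rw [mul_one]; ext; simp [Real.sq_sqrt hw, hw]
    rw [mul_zero] at h
    rw [← e, ← h, integral_map (by fun_prop) (by fun_prop)]
    simp only [mul_pow]
    rw [integral_const_mul, ← gaussianFourth, show (√w) ^ 4 = ((√w) ^ 2) ^ 2 by ring,
      Real.sq_sqrt hw]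
    linarith

/-- Replacing a whole row is one rank-one change. Treating the rows as the independent variables
gives `n` differences instead of `n * d`. -/
theorem abs_trace_gramRes_update_le {n d : ℕ} (A : Matrix (Fin n) (Fin n) ℝ)
    (B : Matrix (Fin d) (Fin d) ℝ) (W : Fin n → Fin d → ℝ) (i : Fin n) (y : Fin d → ℝ) :
    |(gramRes (A * Matrix.of (Function.update W i y) * B)).trace
      - (gramRes (A * Matrix.of W * B)).trace| ≤ 1 := by
  have e1 : (Matrix.of (Function.update W i y) : Matrix (Fin n) (Fin d) ℝ)
      = Matrix.of W + Matrix.vecMulVec (Pi.single i 1) (y - W i) := by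
    ext a b
    by_cases h : a = i
    · subst h; simp [Matrix.vecMulVec_apply]
    · simp [Matrix.vecMulVec_apply, h]
  have e : A * Matrix.of (Function.update W i y) * B = A * Matrix.of W * B
      + Matrix.vecMulVec (A *ᵥ Pi.single i 1) ((y - W i) ᵥ* B) := by
    rw [e1, Matrix.mul_add, Matrix.add_mul, Matrix.mul_vecMulVec, Matrix.vecMulVec_mul]
  rw [e]
  exact abs_trace_gramRes_add_vecMulVec _ _ _

/-- A linear combination of two resolvent traces concentrates. -/
theorem integral_trace_combination_sub_sq_le (D : Measure ℝ) [IsProbabilityMeasure D] {n d : ℕ}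
    (A A' : Matrix (Fin n) (Fin n) ℝ) (B : Matrix (Fin d) (Fin d) ℝ) (c c' : ℝ)
    {f : (Fin n → Fin d → ℝ) → ℝ}
    (hf : ∀ W, f W = c * (gramRes (A * Matrix.of W * B)).trace
      + c' * (gramRes (A' * Matrix.of W * B)).trace) :
    Measurable f ∧ (∀ W, |f W| ≤ (|c| + |c'|) * d) ∧
    ∫ W, (f W - ∫ W', f W' ∂iidMatrixLaw D n d) ^ 2 ∂iidMatrixLaw D n d
      ≤ n * (|c| + |c'|) ^ 2 := by
  have hfe : f = fun W => c * (gramRes (A * Matrix.of W * B)).trace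
      + c' * (gramRes (A' * Matrix.of W * B)).trace := funext hf
  have hm : Measurable f := by
    rw [hfe]
    exact (((continuous_trace_gramRes_product A B).const_mul c).add
      ((continuous_trace_gramRes_product A' B).const_mul c')).measurable
  have hb : ∀ W, |f W| ≤ (|c| + |c'|) * d := by
    intro W
    rw [hf W]
    refine (abs_add_le _ _).trans ?_
    rw [abs_mul, abs_mul, add_mul]
    exact add_le_add (mul_le_mul_of_nonneg_left (abs_trace_gramRes_le _) (abs_nonneg _))
      (mul_le_mul_of_nonneg_left (abs_trace_gramRes_le _) (abs_nonneg _))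
  refine ⟨hm, hb, integral_sub_sq_le_of_bounded_diff (Measure.pi fun _ : Fin d => D) n hm hb ?_⟩
  intro W i y
  rw [hf, hf]
  have h1 := mul_le_mul_of_nonneg_left (abs_trace_gramRes_update_le A B W i y) (abs_nonneg c)
  have h2 := mul_le_mul_of_nonneg_left (abs_trace_gramRes_update_le A' B W i y) (abs_nonneg c')
  rw [← abs_mul] at h1 h2
  calc _ = |c * ((gramRes (A * Matrix.of (Function.update W i y) * B)).trace
      - (gramRes (A * Matrix.of W * B)).trace)
      + c' * ((gramRes (A' * Matrix.of (Function.update W i y) * B)).trace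
      - (gramRes (A' * Matrix.of W * B)).trace)| := by congr 1; ring
    _ ≤ _ := by
      refine (abs_add_le _ _).trans ?_
      linarith

/-- The conditional mean of the ridge estimation error given the scaled covariates `Y`. -/
noncomputable def conditionalRisk {n d : ℕ} (w w' : ℝ) (Y : Matrix (Fin n) (Fin d) ℝ) : ℝ :=
  w * (gramRes Y * gramRes Y).trace
    + w' * ((gramRes Y).trace - (gramRes Y * gramRes Y).trace)

/-- A bound on the conditional variance of the ridge estimation error. -/
noncomputable def ridgeVariance (lam α σ : ℝ) (n d : ℕ) : ℝ :=
  3 * ((2 * gaussianFourth + 4) * (α ^ 2 / d) ^ 2 * d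
    + (2 * gaussianFourth + 4) * (σ ^ 2) ^ 2 * (n * (1 / (lam * n)) ^ 2)
    + α ^ 2 / d * σ ^ 2 * (n * (4 * (1 / (lam * n)))))

section

open scoped Matrix.Norms.L2Operator

theorem integral_ridgeError_sub_sq_le {lam : ℝ} (hlam : 0 < lam) (α σ : ℝ) {n d : ℕ} (hn : 0 < n)
    (A : Matrix (Fin n) (Fin n) ℝ) (B : Matrix (Fin d) (Fin d) ℝ) (W : Fin n → Fin d → ℝ) {ψ : ℝ}
    (hψ : ψ = conditionalRisk (α ^ 2 / d) (σ ^ 2 * (1 / (lam * n)))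
      ((1 / √(lam * n)) • (A * Matrix.of W * B))) :
    Integrable (fun w : (Fin d → ℝ) × (Fin n → ℝ) => (ridgeError lam A B W w.1 w.2 - ψ) ^ 2)
      ((coefficientLaw α d).prod (noiseLaw σ n)) ∧
    ∫ w, (ridgeError lam A B W w.1 w.2 - ψ) ^ 2 ∂(coefficientLaw α d).prod (noiseLaw σ n)
      ≤ ridgeVariance lam α σ n d := by
  set r := 1 / √(lam * n) with hr
  set Y := r • (A * Matrix.of W * B) with hY
  set Q := gramRes Y with hQ
  have hln : 0 < lam * n := mul_pos hlam (by exact_mod_cast hn)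
  have hr2 : r ^ 2 = 1 / (lam * n) := by rw [hr, div_pow, Real.sq_sqrt hln.le, one_pow]
  have hr0 : 0 ≤ r := by rw [hr]; positivity
  have hQs : Qᵀ = Q := gramRes_transpose Y
  have hQn : ‖Q‖ ≤ 1 := norm_gramRes_le Y
  have hQY : ‖Q * Yᵀ‖ ≤ 1 := norm_gramRes_mul_transpose_le Y
  have hYQ : ‖Y * Q‖ ≤ 1 := by
    have : Y * Q = (Q * Yᵀ)ᵀ := by rw [Matrix.transpose_mul, hQs, Matrix.transpose_transpose]
    rw [this, l2_opNorm_transpose]; exact hQY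
  have g1 := isCenteredFourth_gaussianReal (w := α ^ 2 / d) (by positivity)
  have g2 := isCenteredFourth_gaussianReal (w := σ ^ 2) (by positivity)
  set S := Q * Q with hS
  set T := r ^ 2 • (Y * (Q * Q) * Yᵀ) with hT
  set C := (-2 * r) • (Q * (Q * Yᵀ)) with hC
  have hSs : Sᵀ = S := by rw [hS, Matrix.transpose_mul, hQs]
  have hTs : Tᵀ = T := by
    rw [hT, Matrix.transpose_smul, Matrix.transpose_mul, Matrix.transpose_mul,
      Matrix.transpose_transpose, Matrix.transpose_mul, hQs,
      ← Matrix.mul_assoc Y]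
  obtain ⟨h1, h2⟩ := integral_form_sub_sq_le g1 g2 gaussianFourth_nonneg hSs hTs C
  have hψ' : ψ = α ^ 2 / d * S.trace + σ ^ 2 * T.trace := by
    rw [hψ, conditionalRisk, hT, Matrix.trace_smul, trace_gram_mul_sq, smul_eq_mul, hr2]; ring
  have he : ∀ w : (Fin d → ℝ) × (Fin n → ℝ), (ridgeError lam A B W w.1 w.2 - ψ)
      = ((∑ a, ∑ b, S a b * (w.1 a * w.1 b))
        + (∑ a, ∑ b, T a b * (w.2 a * w.2 b)) + (∑ a, ∑ b, C a b * (w.1 a * w.2 b))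
        - (α ^ 2 / d * S.trace + σ ^ 2 * T.trace)) := by
    intro w
    rw [hψ', ridgeError, estimationError_ridge hlam hn (A * Matrix.of W * B) w.1 w.2 hr hQ]
  simp only [he]
  refine ⟨h1, h2.trans ?_⟩
  have nS : ‖S‖ ≤ 1 := by simpa using l2_opNorm_mul_le hQn hQn
  have nT : ‖T‖ ≤ 1 / (lam * n) := by
    have : Y * (Q * Q) * Yᵀ = (Y * Q) * (Q * Yᵀ) := by simp only [Matrix.mul_assoc]
    rw [hT, norm_smul, Real.norm_eq_abs, abs_of_nonneg (sq_nonneg r), this, hr2]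
    have := l2_opNorm_mul_le hYQ hQY
    nlinarith [one_div_pos.mpr hln]
  have nC : ‖C‖ ≤ 2 * r := by
    rw [hC, norm_smul, Real.norm_eq_abs, abs_mul, abs_of_nonneg hr0]
    have := l2_opNorm_mul_le hQn hQY
    norm_num
    nlinarith
  -- Squared Frobenius norms are at most the dimension times the squared operator norm, which gives
  -- the three terms of `ridgeVariance`.
  have sS := sum_sum_sq_le S nS
  have sT := sum_sum_sq_le T nT
  have sC := sum_sum_sq_le C nC
  rw [Finset.sum_comm] at sS sT
  simp only [Fintype.card_fin] at sS sT sC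
  have hC2 : (2 * r) ^ 2 = 4 * (1 / (lam * n)) := by rw [mul_pow, hr2]; norm_num
  rw [hC2] at sC
  have hK := gaussianFourth_nonneg
  rw [ridgeVariance]
  gcongr
  linarith

end

/-- The risk is w tr Q + (w' - w)(tr Q - tr Q²), and the last bracket is a difference quotient of
step `h` up to 4 h d. -/
theorem abs_conditionalRisk_sub_le {n d : ℕ} {w w' h : ℝ} (hw : 0 ≤ w) (hw' : 0 ≤ w') (hh : 0 < h)
    (Y : Matrix (Fin n) (Fin d) ℝ) :
    |conditionalRisk w w' Y - ((w + (w' - w) / h) * (gramRes Y).trace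
      + -((w' - w) / h) * (gramRes (√(1 + h) • Y)).trace)| ≤ 4 * h * d * (w + w') := by
  have key := abs_trace_gramRes_diff_le Y hh.le
  rw [Fintype.card_fin] at key
  set t := (gramRes Y).trace
  set t2 := (gramRes Y * gramRes Y).trace with ht2
  set t' := (gramRes (√(1 + h) • Y)).trace
  have e : conditionalRisk w w' Y - ((w + (w' - w) / h) * t + -((w' - w) / h) * t')
      = -((w' - w) / h) * (t - t' - h * (t - t2)) := by
    rw [conditionalRisk]; field_simp; ring
  rw [e, abs_mul, abs_neg, abs_div, abs_of_pos hh]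
  have hww : |w' - w| ≤ w + w' := by rw [abs_le]; constructor <;> linarith
  calc |w' - w| / h * |t - t' - h * (t - t2)| ≤ (w + w') / h * (4 * h ^ 2 * d) := by gcongr
    _ = _ := by field_simp

theorem measurable_ridgeError {lam : ℝ} (hlam : 0 < lam) {n d : ℕ} (hn : 0 < n)
    (A : Matrix (Fin n) (Fin n) ℝ) (B : Matrix (Fin d) (Fin d) ℝ) :
    Measurable fun w : (Fin n → Fin d → ℝ) × (Fin d → ℝ) × (Fin n → ℝ) =>
      ridgeError lam A B w.1 w.2.1 w.2.2 := by
  have hY : Continuous fun w : (Fin n → Fin d → ℝ) × (Fin d → ℝ) × (Fin n → ℝ) =>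
      (1 / √(lam * n)) • (A * Matrix.of w.1 * B) :=
    ((continuous_product A B).const_smul (1 / √(lam * n))).comp continuous_fst
  have hQ := continuous_gramRes.comp hY
  have e : (fun w : (Fin n → Fin d → ℝ) × (Fin d → ℝ) × (Fin n → ℝ) =>
      ridgeError lam A B w.1 w.2.1 w.2.2) = fun w => _ :=
    funext fun w => estimationError_ridge hlam hn (A * Matrix.of w.1 * B) w.2.1 w.2.2 rfl rfl
  rw [e]
  refine Continuous.measurable (Continuous.add (Continuous.add ?_ ?_) ?_)
  all_goals refine continuous_finsetSum _ fun a _ => continuous_finsetSum _ fun b _ =>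
    Continuous.mul (Continuous.matrix_elem ?_ a b) (by fun_prop)
  · exact hQ.matrix_mul hQ
  · exact ((hY.matrix_mul (hQ.matrix_mul hQ)).matrix_mul
      hY.matrix_transpose).const_smul ((1 / √(lam * n)) ^ 2)
  · exact (hQ.matrix_mul (hQ.matrix_mul hY.matrix_transpose)).const_smul (-2 * (1 / √(lam * n)))

end Concentration

-- Assembling the universality statement.

section Universality

/-- The finite-difference surrogate for the conditional risk. -/
noncomputable def riskSurrogate {n d : ℕ} (w w' h lam : ℝ) (A : Matrix (Fin n) (Fin n) ℝ)
    (B : Matrix (Fin d) (Fin d) ℝ) (W : Fin n → Fin d → ℝ) : ℝ :=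
  (w + (w' - w) / h) * (gramRes (((1 / √(lam * n)) • A) * Matrix.of W * B)).trace
    + -((w' - w) / h)
      * (gramRes (((√(1 + h) * (1 / √(lam * n))) • A) * Matrix.of W * B)).trace

theorem abs_conditionalRisk_sub_riskSurrogate_le {n d : ℕ} {w w' h : ℝ} (lam : ℝ) (hw : 0 ≤ w)
    (hw' : 0 ≤ w') (hh : 0 < h) (A : Matrix (Fin n) (Fin n) ℝ)
    (B : Matrix (Fin d) (Fin d) ℝ) (W : Fin n → Fin d → ℝ) :
    |conditionalRisk w w' ((1 / √(lam * n)) • (A * Matrix.of W * B))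
      - riskSurrogate w w' h lam A B W| ≤ 4 * h * d * (w + w') := by
  have := abs_conditionalRisk_sub_le hw hw' hh ((1 / √(lam * n)) • (A * Matrix.of W * B))
  rw [smul_smul] at this
  simpa only [riskSurrogate, Matrix.smul_mul] using this

/-- Concentration of the ridge estimation error around the mean of the surrogate. -/
theorem modelLaw_deviation_le (D : Measure ℝ) [IsProbabilityMeasure D] {lam : ℝ} (hlam : 0 < lam)
    (α σ : ℝ) {n d : ℕ} (hn : 0 < n) (A : Matrix (Fin n) (Fin n) ℝ)
    (B : Matrix (Fin d) (Fin d) ℝ) {w w' h δ m : ℝ} (hw : w = α ^ 2 / d)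
    (hw' : w' = σ ^ 2 * (1 / (lam * n))) (hh : 0 < h) (hδ : 0 < δ)
    (hm : m = ∫ W, riskSurrogate w w' h lam A B W ∂iidMatrixLaw D n d) :
    modelLaw D α σ n d {x | δ ≤ |ridgeError lam A B x.1 x.2.1 x.2.2 - m|}
      ≤ ENNReal.ofReal ((2 * ridgeVariance lam α σ n d + 4 * (4 * h * d * (w + w')) ^ 2
        + 4 * (n * (|w + (w' - w) / h| + |-((w' - w) / h)|) ^ 2)) / δ ^ 2) := by
  have hw0 : 0 ≤ w := by rw [hw]; positivity
  have hw0' : 0 ≤ w' := by rw [hw']; positivity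
  obtain ⟨hfm, hfb, hvar⟩ := integral_trace_combination_sub_sq_le D ((1 / √(lam * n)) • A)
    ((√(1 + h) * (1 / √(lam * n))) • A) B (w + (w' - w) / h) (-((w' - w) / h))
    (f := riskSurrogate w w' h lam A B) (fun W => rfl)
  rw [← hm] at hvar
  set V := ridgeVariance lam α σ n d with hV
  set F := riskSurrogate w w' h lam A B with hF
  set e := 4 * h * d * (w + w') with he
  set k := |w + (w' - w) / h| + |-((w' - w) / h)| with hk
  have hRm : Measurable fun x : (Fin n → Fin d → ℝ) × (Fin d → ℝ) × (Fin n → ℝ) =>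
      ENNReal.ofReal ((ridgeError lam A B x.1 x.2.1 x.2.2 - m) ^ 2) :=
    (((measurable_ridgeError hlam hn A B).sub_const m).pow_const 2).ennreal_ofReal
  have hprob : IsProbabilityMeasure ((coefficientLaw α d).prod (noiseLaw σ n)) := by
    unfold coefficientLaw noiseLaw; infer_instance
  have hV0 : 0 ≤ V := by
    have := gaussianFourth_nonneg
    rw [hV, ridgeVariance]; positivity
  have hFi : Integrable (fun W => 2 * V + 4 * e ^ 2 + 4 * (F W - m) ^ 2) (iidMatrixLaw D n d) := by
    refine (integrable_const _).add (Integrable.const_mul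
      (integrable_of_bounded (C := (k * d + |m|) ^ 2) ((hfm.sub_const m).pow_const 2) ?_) 4)
    intro W
    rw [abs_pow]
    exact pow_le_pow_left₀ (abs_nonneg _) ((abs_sub _ _).trans (add_le_add (hfb W) le_rfl)) 2
  have hin : ∀ W : Fin n → Fin d → ℝ,
      ∫⁻ y, ENNReal.ofReal ((ridgeError lam A B W y.1 y.2 - m) ^ 2)
        ∂(coefficientLaw α d).prod (noiseLaw σ n)
      ≤ ENNReal.ofReal (2 * V + 4 * e ^ 2 + 4 * (F W - m) ^ 2) := by
    intro W
    set ψ := conditionalRisk w w' ((1 / √(lam * n)) • (A * Matrix.of W * B)) with hψ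
    obtain ⟨i1, i2⟩ := integral_ridgeError_sub_sq_le hlam α σ hn A B W (ψ := ψ)
      (by rw [hψ, hw, hw'])
    have hd1 : |ψ - F W| ≤ e := abs_conditionalRisk_sub_riskSurrogate_le lam hw0 hw0' hh A B W
    -- (a + b)² ≤ 2a² + 2b² is used twice, from `m` to `ψ` and from `ψ` to `F W`; hence the
    -- coefficients 2, 4, 4.
    have hd2 : (ψ - m) ^ 2 ≤ 2 * e ^ 2 + 2 * (F W - m) ^ 2 := by
      have : (ψ - F W) ^ 2 ≤ e ^ 2 := sq_le_sq' (abs_le.mp hd1).1 (abs_le.mp hd1).2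
      nlinarith [sq_nonneg ((ψ - F W) - (F W - m))]
    have i3 : Integrable (fun y : (Fin d → ℝ) × (Fin n → ℝ) =>
        2 * (ridgeError lam A B W y.1 y.2 - ψ) ^ 2 + 2 * (ψ - m) ^ 2)
        ((coefficientLaw α d).prod (noiseLaw σ n)) :=
      (i1.const_mul 2).add (integrable_const _)
    calc _ ≤ ∫⁻ y, ENNReal.ofReal (2 * (ridgeError lam A B W y.1 y.2 - ψ) ^ 2
          + 2 * (ψ - m) ^ 2) ∂(coefficientLaw α d).prod (noiseLaw σ n) := by
          refine lintegral_mono fun y => ENNReal.ofReal_le_ofReal ?_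
          nlinarith [sq_nonneg ((ridgeError lam A B W y.1 y.2 - ψ) - (ψ - m))]
      _ = ENNReal.ofReal (∫ y, (2 * (ridgeError lam A B W y.1 y.2 - ψ) ^ 2
          + 2 * (ψ - m) ^ 2) ∂(coefficientLaw α d).prod (noiseLaw σ n)) :=
          (ofReal_integral_eq_lintegral_ofReal i3
            (Eventually.of_forall fun y => by positivity)).symm
      _ ≤ _ := by
          refine ENNReal.ofReal_le_ofReal ?_
          rw [integral_add (i1.const_mul 2) (integrable_const _), integral_const_mul]
          simp only [integral_const, probReal_univ, one_smul]
          linarith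
  have hout : ∫⁻ x, ENNReal.ofReal ((ridgeError lam A B x.1 x.2.1 x.2.2 - m) ^ 2)
      ∂modelLaw D α σ n d ≤ ENNReal.ofReal (2 * V + 4 * e ^ 2 + 4 * (n * k ^ 2)) := by
    refine (lintegral_prod_le _).trans ((lintegral_mono hin).trans ?_)
    rw [← ofReal_integral_eq_lintegral_ofReal hFi
      (Eventually.of_forall fun W => by positivity)]
    refine ENNReal.ofReal_le_ofReal ?_
    have hFi2 : Integrable (fun W => 4 * (F W - m) ^ 2) (iidMatrixLaw D n d) := by
      have := hFi.sub (integrable_const (2 * V + 4 * e ^ 2))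
      refine this.congr (Eventually.of_forall fun W => ?_)
      show 2 * V + 4 * e ^ 2 + 4 * (F W - m) ^ 2 - (2 * V + 4 * e ^ 2) = _
      ring
    rw [integral_add (integrable_const _) hFi2, integral_const_mul]
    simp only [integral_const, probReal_univ, one_smul]
    linarith
  have hδ2 : (0 : ℝ) < δ ^ 2 := by positivity
  have hset : {x : (Fin n → Fin d → ℝ) × (Fin d → ℝ) × (Fin n → ℝ) |
      δ ≤ |ridgeError lam A B x.1 x.2.1 x.2.2 - m|}
      ⊆ {x | ENNReal.ofReal (δ ^ 2)
        ≤ ENNReal.ofReal ((ridgeError lam A B x.1 x.2.1 x.2.2 - m) ^ 2)} := by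
    intro x hx
    refine ENNReal.ofReal_le_ofReal ?_
    rw [← sq_abs (_ - m)]
    exact pow_le_pow_left₀ hδ.le hx 2
  -- Chebyshev's inequality at level δ².
  refine (measure_mono hset).trans ((meas_ge_le_lintegral_div hRm.aemeasurable
    (ENNReal.ofReal_pos.mpr hδ2).ne' ENNReal.ofReal_ne_top).trans ?_)
  rw [ENNReal.ofReal_div_of_pos hδ2]
  exact ENNReal.div_le_div_right hout _

/-- Since `n ≤ c * d`, the terms of order 1/d are also of order 1/n. -/
theorem ridgeVariance_le {lam α σ c : ℝ} (hlam : 0 < lam) {n d : ℕ} (hn : 0 < n) (hd : 0 < d)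
    (hnd : (n : ℝ) ≤ c * d) : ridgeVariance lam α σ n d
      ≤ 3 * ((2 * gaussianFourth + 4) * (α ^ 4 * c) + (2 * gaussianFourth + 4) * (σ ^ 4 / lam ^ 2)
        + 4 * α ^ 2 * σ ^ 2 * c / lam) / n := by
  have hn' : (0 : ℝ) < n := by exact_mod_cast hn
  have hd' : (0 : ℝ) < d := by exact_mod_cast hd
  have hK := gaussianFourth_nonneg
  have hinv : 1 / (d : ℝ) ≤ c / n := by rw [div_le_div_iff₀ hd' hn']; linarith
  have e : ridgeVariance lam α σ n d = 3 * ((2 * gaussianFourth + 4) * (α ^ 4 * (1 / d))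
      + (2 * gaussianFourth + 4) * (σ ^ 4 / lam ^ 2 / n)
      + 4 * α ^ 2 * σ ^ 2 / lam * (1 / d)) := by
    rw [ridgeVariance]; field_simp
  rw [e]
  calc _ ≤ 3 * ((2 * gaussianFourth + 4) * (α ^ 4 * (c / n))
      + (2 * gaussianFourth + 4) * (σ ^ 4 / lam ^ 2 / n)
      + 4 * α ^ 2 * σ ^ 2 / lam * (c / n)) := by gcongr
    _ = _ := by ring

/-- Universality of the ridge estimation error at a fixed accuracy and confidence. -/
theorem exists_universality {D : Measure ℝ} [IsProbabilityMeasure D] (hD : IsSubGaussianLaw D)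
    {lam : ℝ} (hlam : 0 < lam) (α σ : ℝ) {c η ε : ℝ} (hc : 1 ≤ c) (hη : 0 < η) (hε : 0 < ε) :
    ∃ N : ℕ, ∀ n d : ℕ, N ≤ n → 0 < d → (d : ℝ) ≤ c * n → (n : ℝ) ≤ c * d →
      ∀ (A : Matrix (Fin n) (Fin n) ℝ) (B : Matrix (Fin d) (Fin d) ℝ), ∃ m m' : ℝ,
        |m - m'| ≤ η ∧
        modelLaw D α σ n d {x | η ≤ |ridgeError lam A B x.1 x.2.1 x.2.2 - m|}
          ≤ ENNReal.ofReal ε ∧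
        modelLaw (matchingGaussian D) α σ n d
          {x | η ≤ |ridgeError lam A B x.1 x.2.1 x.2.2 - m'|} ≤ ENNReal.ofReal ε := by
  set C₀ := α ^ 2 * c + σ ^ 2 / lam with hC₀
  have hC₀0 : 0 ≤ C₀ := by positivity
  -- The added 1 keeps the constant positive, so it can be divided by even when α = σ = 0.
  set C₁ := C₀ + 1 with hC₁
  have hC₁0 : 0 < C₁ := by positivity
  -- the step of the finite difference
  obtain ⟨h, hh, hhe⟩ : ∃ h : ℝ, 0 < h ∧ 64 * h ^ 2 * (c * C₁) ^ 2 ≤ ε * η ^ 2 / 2 := by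
    refine ⟨√(ε * η ^ 2 / 2 / (64 * (c * C₁) ^ 2)), by positivity, ?_⟩
    rw [Real.sq_sqrt (by positivity)]
    exact le_of_eq (by field_simp)
  -- `k₁ / n` bounds the surrogate's coefficients. The step `h` is fixed before `n`, so `k₁` is a
  -- constant, and trace accuracy (η / k₁) n suffices.
  set k₁ := C₁ + C₁ / h + C₁ / h with hk₁
  have hk₁0 : 0 < k₁ := by positivity
  set V₁ := 3 * ((2 * gaussianFourth + 4) * (α ^ 4 * c)
    + (2 * gaussianFourth + 4) * (σ ^ 4 / lam ^ 2) + 4 * α ^ 2 * σ ^ 2 * c / lam) with hV₁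
  obtain ⟨N₁, hN₁⟩ := exists_trace_comparison hD hc (div_pos hη hk₁0)
  obtain ⟨N₂, hN₂⟩ := exists_nat_ge ((2 * V₁ + 4 * k₁ ^ 2) / (ε * η ^ 2 / 2))
  refine ⟨max (max N₁ N₂) 1, fun n d hn hd hdn hnd A B => ?_⟩
  have hn1 : N₁ ≤ n := (le_max_left _ _).trans ((le_max_left _ _).trans hn)
  have hn2 : (N₂ : ℝ) ≤ n := by
    exact_mod_cast (le_max_right _ _).trans ((le_max_left _ _).trans hn)
  have hn0 : 0 < n := (le_max_right _ _).trans hn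
  have hn' : (0 : ℝ) < n := by exact_mod_cast hn0
  have hd' : (0 : ℝ) < d := by exact_mod_cast hd
  set w := α ^ 2 / d with hw
  set w' := σ ^ 2 * (1 / (lam * n)) with hw'
  have hw0 : 0 ≤ w := by positivity
  have hw0' : 0 ≤ w' := by positivity
  have hww : w + w' ≤ C₁ / n := by
    have h1 : w ≤ α ^ 2 * c / n := by
      rw [hw, div_le_div_iff₀ hd' hn']
      nlinarith [sq_nonneg α]
    have h2 : w' = σ ^ 2 / lam / n := by rw [hw']; field_simp
    calc w + w' ≤ α ^ 2 * c / n + σ ^ 2 / lam / n := by linarith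
      _ = C₀ / n := by rw [hC₀]; ring
      _ ≤ _ := by gcongr; linarith
  have hdw : d * (w + w') ≤ c * C₁ := by
    calc d * (w + w') ≤ (c * n) * (C₁ / n) := by gcongr
      _ = _ := by field_simp
  have habs : |w' - w| ≤ C₁ / n := by
    refine le_trans ?_ hww
    rw [abs_le]; constructor <;> linarith
  have hq : |(w' - w) / h| ≤ C₁ / h / n := by
    rw [abs_div, abs_of_pos hh, div_right_comm]
    gcongr
  have hk : |w + (w' - w) / h| + |-((w' - w) / h)| ≤ k₁ / n := by
    have h1 : |w + (w' - w) / h| ≤ C₁ / n + C₁ / h / n := by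
      refine (abs_add_le _ _).trans (add_le_add ?_ hq)
      rw [abs_of_nonneg hw0]; linarith
    have h2 : k₁ / n = C₁ / n + C₁ / h / n + C₁ / h / n := by rw [hk₁]; ring
    rw [abs_neg, h2]
    linarith
  have hbound : (2 * ridgeVariance lam α σ n d + 4 * (4 * h * d * (w + w')) ^ 2
        + 4 * (n * (|w + (w' - w) / h| + |-((w' - w) / h)|) ^ 2)) / η ^ 2 ≤ ε := by
    rw [div_le_iff₀ (by positivity)]
    have b1 : ridgeVariance lam α σ n d ≤ V₁ / n := ridgeVariance_le hlam hn0 hd hnd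
    have b2 : 4 * (4 * h * d * (w + w')) ^ 2 ≤ 64 * h ^ 2 * (c * C₁) ^ 2 := by
      have : (d * (w + w')) ^ 2 ≤ (c * C₁) ^ 2 := pow_le_pow_left₀ (by positivity) hdw 2
      calc _ = 64 * h ^ 2 * (d * (w + w')) ^ 2 := by ring
        _ ≤ _ := by gcongr
    have b3 : n * (|w + (w' - w) / h| + |-((w' - w) / h)|) ^ 2 ≤ k₁ ^ 2 / n := by
      calc _ ≤ n * (k₁ / n) ^ 2 := by gcongr
        _ = _ := by field_simp
    have b4 : (2 * V₁ + 4 * k₁ ^ 2) / n ≤ ε * η ^ 2 / 2 := by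
      have := hN₂.trans hn2
      rw [div_le_iff₀ (by positivity)] at this
      rw [div_le_iff₀ hn']
      linarith
    have b5 : (2 * V₁ + 4 * k₁ ^ 2) / n = 2 * (V₁ / n) + 4 * (k₁ ^ 2 / n) := by ring
    linarith
  have hgp : IsProbabilityMeasure (matchingGaussian D) := by
    unfold matchingGaussian; infer_instance
  refine ⟨_, _, ?_, (modelLaw_deviation_le D hlam α σ hn0 A B hw hw' hh hη rfl).trans
    (ENNReal.ofReal_le_ofReal hbound), (modelLaw_deviation_le (matchingGaussian D) hlam α σ hn0 A
    B hw hw' hh hη rfl).trans (ENNReal.ofReal_le_ofReal hbound)⟩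
  have hint : ∀ (D' : Measure ℝ) [IsProbabilityMeasure D'] (A' : Matrix (Fin n) (Fin n) ℝ),
      Integrable (fun W => (gramRes (A' * Matrix.of W * B)).trace) (iidMatrixLaw D' n d) :=
    fun D' _ A' => integrable_of_bounded (continuous_trace_gramRes_product A' B).measurable
      fun W => abs_trace_gramRes_le _
  have t1 := hN₁ n d hn1 hdn ((1 / √(lam * n)) • A) B
  have t2 := hN₁ n d hn1 hdn ((√(1 + h) * (1 / √(lam * n))) • A) B
  simp only [riskSurrogate]
  rw [integral_add ((hint D _).const_mul _) ((hint D _).const_mul _),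
    integral_add ((hint (matchingGaussian D) _).const_mul _)
      ((hint (matchingGaussian D) _).const_mul _), integral_const_mul, integral_const_mul,
    integral_const_mul, integral_const_mul]
  set a := w + (w' - w) / h
  set b := -((w' - w) / h)
  set x₁ := ∫ W, (gramRes ((1 / √(lam * n)) • A * Matrix.of W * B)).trace ∂iidMatrixLaw D n d
  set x₂ := ∫ W, (gramRes ((√(1 + h) * (1 / √(lam * n))) • A * Matrix.of W * B)).trace
    ∂iidMatrixLaw D n d
  set y₁ := ∫ W, (gramRes ((1 / √(lam * n)) • A * Matrix.of W * B)).trace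
    ∂iidMatrixLaw (matchingGaussian D) n d
  set y₂ := ∫ W, (gramRes ((√(1 + h) * (1 / √(lam * n))) • A * Matrix.of W * B)).trace
    ∂iidMatrixLaw (matchingGaussian D) n d
  calc |a * x₁ + b * x₂ - (a * y₁ + b * y₂)| = |a * (x₁ - y₁) + b * (x₂ - y₂)| := by
        congr 1; ring
    _ ≤ |a| * |x₁ - y₁| + |b| * |x₂ - y₂| := by
        rw [← abs_mul, ← abs_mul]; exact abs_add_le _ _
    _ ≤ |a| * (η / k₁ * n) + |b| * (η / k₁ * n) := by gcongr
    _ = (|a| + |b|) * (η / k₁ * n) := by ring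
    _ ≤ k₁ / n * (η / k₁ * n) := by gcongr
    _ = η := by field_simp

end Universality

theorem theorem1
    -- law of the entries of `Z`
    (D : Measure ℝ) [IsProbabilityMeasure D] (hD : IsSubGaussianLaw D)
    -- ridge parameter, signal strength, noise level, limiting aspect ratio
    (lam α σ γ : ℝ) (hlam : 0 < lam) (hγ : 0 < γ)
    -- the proportional regime
    (n d : ℕ → ℕ) (hn : Tendsto n atTop atTop) (hd : Tendsto d atTop atTop)
    (hnd : Tendsto (fun k => (d k : ℝ) / (n k : ℝ)) atTop (𝓝 γ))
    -- deterministic dependency matrices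
    (A : ∀ k, Matrix (Fin (n k)) (Fin (n k)) ℝ) (B : ∀ k, Matrix (Fin (d k)) (Fin (d k)) ℝ)
    -- the random objects; the probability space may change with `k`
    {Ω : ℕ → Type*} [∀ k, MeasurableSpace (Ω k)]
    (P : ∀ k, Measure (Ω k)) [∀ k, IsProbabilityMeasure (P k)]
    (Z G : ∀ k, Ω k → Fin (n k) → Fin (d k) → ℝ)
    (β : ∀ k, Ω k → Fin (d k) → ℝ) (ε : ∀ k, Ω k → Fin (n k) → ℝ)
    (hZ : ∀ k, HasLaw (fun ω => (Z k ω, β k ω, ε k ω))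
      (modelLaw D α σ (n k) (d k)) (P k))
    (hG : ∀ k, HasLaw (fun ω => (G k ω, β k ω, ε k ω))
      (modelLaw (matchingGaussian D) α σ (n k) (d k)) (P k)) :
    ∀ η : ℝ, 0 < η →
      Tendsto
        (fun k => P k {ω | |ridgeError lam (A k) (B k) (Z k ω) (β k ω) (ε k ω)
          - ridgeError lam (A k) (B k) (G k ω) (β k ω) (ε k ω)| ≤ η})
        atTop (𝓝 1) := by

  intro η hη
  -- Eventually γ/2 < d/n < γ + 1, so this `c` bounds both d/n and n/d.
  set c := max 1 (max (γ + 1) (2 / γ)) with hc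
  have hc1 : 1 ≤ c := le_max_left _ _
  have hcγ : γ + 1 ≤ c := (le_max_left _ _).trans (le_max_right _ _)
  have hcγ' : 2 / γ ≤ c := (le_max_right _ _).trans (le_max_right _ _)
  refine ENNReal.tendsto_nhds_of_Icc fun τ hτ => ?_
  by_cases hτt : τ = ⊤
  · exact Eventually.of_forall fun k => by simp [hτt]
  have hτ' : 0 < τ.toReal := ENNReal.toReal_pos hτ.ne' hτt
  obtain ⟨N, hN⟩ := exists_universality hD hlam α σ hc1 (η := η / 3) (ε := τ.toReal / 2)
    (by positivity) (by positivity)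
  filter_upwards [hn.eventually_ge_atTop (max N 1), hd.eventually_gt_atTop 0,
    hnd.eventually (Iio_mem_nhds (show γ < γ + 1 by linarith)),
    hnd.eventually (Ioi_mem_nhds (show γ / 2 < γ by linarith))] with k hk1 hk2 hk3 hk4
  refine ⟨?_, prob_le_one.trans le_self_add⟩
  have hnk : (0 : ℝ) < n k := by exact_mod_cast (le_max_right N 1).trans hk1
  have hdk : (d k : ℝ) ≤ c * n k := by
    rw [div_lt_iff₀ hnk] at hk3
    nlinarith
  have hdk' : (n k : ℝ) ≤ c * d k := by
    rw [lt_div_iff₀ hnk] at hk4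
    have hd0 : (0 : ℝ) ≤ d k := by positivity
    calc (n k : ℝ) = 2 / γ * (γ / 2 * n k) := by field_simp
      _ ≤ c * d k := by gcongr
  obtain ⟨m, m', hm, h1, h2⟩ := hN (n k) (d k) ((le_max_left _ _).trans hk1) hk2 hdk hdk' (A k) (B k)
  -- This inequality between a preimage and the pushforward needs no measurability of the event.
  have p1 := (Measure.le_map_apply (hZ k).aemeasurable _).trans (((hZ k).map_eq ▸ h1 :))
  have p2 := (Measure.le_map_apply (hG k).aemeasurable _).trans (((hG k).map_eq ▸ h2 :))
  set R := fun ω => ridgeError lam (A k) (B k) (Z k ω) (β k ω) (ε k ω)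
  set R' := fun ω => ridgeError lam (A k) (B k) (G k ω) (β k ω) (ε k ω)
  change P k {ω | η / 3 ≤ |R ω - m|} ≤ _ at p1
  change P k {ω | η / 3 ≤ |R' ω - m'|} ≤ _ at p2
  -- Each error is close to its own deterministic centre and the two centres are close. A union
  -- bound therefore suffices, whatever the joint law of `Z` and `G`.
  have hcover : (Set.univ : Set (Ω k)) ⊆ {ω | |R ω - R' ω| ≤ η}
      ∪ ({ω | η / 3 ≤ |R ω - m|} ∪ {ω | η / 3 ≤ |R' ω - m'|}) := by
    intro ω _
    by_contra hω
    simp only [Set.mem_union, Set.mem_ofPred_eq, not_or, not_le] at hω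
    obtain ⟨hω1, hω2, hω3⟩ := hω
    have := abs_add_three (R ω - m) (m - m') (m' - R' ω)
    rw [abs_sub_comm m' (R' ω), show R ω - m + (m - m') + (m' - R' ω) = R ω - R' ω by ring] at this
    linarith
  have hone := (measure_mono hcover).trans ((measure_union_le _ _).trans
    (add_le_add le_rfl ((measure_union_le _ _).trans (add_le_add p1 p2))))
  rw [measure_univ (μ := P k), ← ENNReal.ofReal_add (by positivity) (by positivity), add_halves,
    ENNReal.ofReal_toReal hτt] at hone
  exact tsub_le_iff_right.mpr hone
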